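/- Let $\Theta_M=\{\theta=(\theta_1,\theta_2,\theta_3,\theta_4)=(\mu,\sigma,\alpha,\beta):\mu\in\mathbb R,\ \sigma>0,\ \alpha\in(0,2],\ \beta\in[-1,1]\}$, with interior $\Theta_M^\circ$, and let $f(x;\theta)=\frac1{2\pi}\int_{-\infty}^{\infty}e^{-itx}\varphi_\theta(t)\,dt$ be the stable density whose characteristic function is, in the $(M_0)$ parameterization, $$\varphi_\theta(t)=\begin{cases}\exp\Big(-|\sigma t|^\alpha\big\{1+i\beta\,\mathrm{sign}(t)\tan\tfrac{\pi\alpha}{2}\,(|\sigma t|^{1-\alpha}-1)\big\}+i\mu t\Big),&\alpha\ne1,\\ \exp\Big(-|\sigma t|-i\sigma t\,\tfrac{2\beta}{\pi}\log|\sigma t|+i\mu t\Big),&\alpha=1.\end{cases}$$ Write $\ell=\log f$, $\ell_{\theta_i}=\partial\ell/\partial\theta_i$, $\ell'_{\theta_i}=\partial\ell_{\theta_i}/\partial x$, $\ell_{\theta_i\theta_j}=\partial\ell_{\theta_i}/\partial\theta_j$, and similarly for the derivatives of $f$. For all $\theta\in\Theta_M^\circ$, $x\in\mathbb R$ and $i,j\in\{1,2,3,4\}$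 one has $f(x;\theta)>0$, and $\ell_{\theta_i}$, $\ell'_{\theta_i}$, $\ell_{\theta_i\theta_j}$ are well defined (the derivatives exist and do not depend on the order of differentiation), with $$\ell_{\theta_i}=\frac{f_{\theta_i}}{f},\qquad \ell'_{\theta_i}=\frac{f'_{\theta_i}f-f_{\theta_i}f'}{f^2},\qquad \ell_{\theta_i\theta_j}=\frac{f_{\theta_i\theta_j}f-f_{\theta_i}f_{\theta_j}}{f^2}.$$ They are continuous in $\theta\in\Theta_M^\circ$ for every $x\in\mathbb R$, and jointly continuous in $(x,\theta)$ on $\mathbb R\times\Theta_M^\circ$. Moreover, for every fixed $\theta\in\Theta_M^\circ$, as $|x|\to\infty$, $$\begin{array}{ll} \ell_\mu(x)=O(|x|^{-1}), & \ell_{\mu\mu}(x)=-\ell'_\mu(x)=O(|x|^{-2}),\\ \ell_\sigma(x)=O(1), & \ell_{\mu\sigma}(x)=-\ell'_\sigma(x)=O(|x|^{-1}),\\ \ell_\alpha(x)=O(\log|x|), & \ell_{\mu\alpha}(x)=-\ell'_\alpha(x)=O(|x|^{-1}\log|x|),\\ \ell_\beta(x)=O(1), & \ell_{\mu\beta}(x)=-\ell'_\beta(x)=O(|x|^{-1}),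 \end{array}$$ $$\begin{array}{lll} \ell_{\sigma\sigma}(x)=O(1), & \ell_{\sigma\alpha}(x)=O(\log|x|), & \ell_{\sigma\beta}(x)=O(1),\\ \ell_{\alpha\alpha}(x)=O(\log^2|x|), & \ell_{\alpha\beta}(x)=O(\log|x|), & \ell_{\beta\beta}(x)=O(1), \end{array}$$ the equalities between derivatives holding for all $x\in\mathbb R$. -/

import Mathlib

open scoped Asymptotics

namespace StableM0

/-- A parameter vector `θ = (θ 0, θ 1, θ 2, θ 3)` is `(μ, σ, α, β)`. -/
abbrev Param : Type := Fin 4 → ℝ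

/-- The full parameter space: `μ ∈ ℝ`, `σ ∈ (0, ∞)`, `α ∈ (0, 2]`, `β ∈ [-1, 1]`. -/
def paramSpace : Set Param :=
  {θ | 0 < θ 1 ∧ θ 2 ∈ Set.Ioc (0 : ℝ) 2 ∧ θ 3 ∈ Set.Icc (-1 : ℝ) 1}

/-- The stable characteristic function in terms of its four scalar parameters. -/
noncomputable def charFn (μ σ α β t : ℝ) : ℂ :=
  if α = 1 then
    Complex.exp (-((|σ * t| : ℝ) : ℂ)
      - Complex.I * ((σ * t * (2 * β / Real.pi) * Real.log |σ * t| : ℝ) : ℂ)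
      + Complex.I * ((μ * t : ℝ) : ℂ))
  else
    Complex.exp (-((|σ * t| ^ α : ℝ) : ℂ) *
        (1 + Complex.I *
          ((β * Real.sign t * Real.tan (Real.pi * α / 2) * (|σ * t| ^ (1 - α) - 1) : ℝ) : ℂ))
      + Complex.I * ((μ * t : ℝ) : ℂ))

/-- The density `f(x; θ)`, by Fourier inversion of the characteristic function:
`f(x; θ) = (2π)⁻¹ ∫ exp(-itx) φ(t) dt`. -/
noncomputable def density (x : ℝ) (θ : Param) : ℝ :=
  (((2 * Real.pi)⁻¹ : ℝ) : ℂ) *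
    (∫ t : ℝ, Complex.exp (-(Complex.I * ((t * x : ℝ) : ℂ))) *
      charFn (θ 0) (θ 1) (θ 2) (θ 3) t) |>.re

/-- The partial derivative with respect to the `i`-th parameter. -/
noncomputable def pderiv (i : Fin 4) (g : Param → ℝ) (θ : Param) : ℝ :=
  deriv (fun s : ℝ => g (Function.update θ i s)) (θ i)

/-- Existence of the partial derivative with respect to the `i`-th parameter. -/
def HasPartial (i : Fin 4) (g : Param → ℝ) (θ : Param) : Prop :=
  DifferentiableAt ℝ (fun s : ℝ => g (Function.update θ i s)) (θ i)

/-- The log-likelihood `ℓ(x; θ) = log f(x; θ)`. -/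
noncomputable def logLik (x : ℝ) (θ : Param) : ℝ := Real.log (density x θ)

/-- The score `ℓ_{θ_i} = ∂ℓ/∂θ_i`. -/
noncomputable def score (i : Fin 4) (x : ℝ) (θ : Param) : ℝ :=
  pderiv i (logLik x) θ

/-- The derivative of the score in `x`: `ℓ'_{θ_i} = ∂ℓ_{θ_i}/∂x`. -/
noncomputable def scoreX (i : Fin 4) (x : ℝ) (θ : Param) : ℝ :=
  deriv (fun y : ℝ => score i y θ) x

/-- The second derivative `ℓ_{θ_i θ_j} = ∂ℓ_{θ_i}/∂θ_j`. -/
noncomputable def score2 (i j : Fin 4) (x : ℝ) (θ : Param) : ℝ :=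
  pderiv j (score i x) θ

/-- The partial derivative `f_{θ_i}` of the density. -/
noncomputable def densityP (i : Fin 4) (x : ℝ) (θ : Param) : ℝ :=
  pderiv i (density x) θ

end StableM0

/-! ### The stable exponent across α = 1: removable singularities -/

namespace StableM0
open MeasureTheory Filter Topology Set

/-! After the substitution `w = σ t`, Fourier inversion and Hermitian symmetry give `f = π⁻¹ Re ∫₀^∞
exp (phase w x θ) dw`, with an exponent holomorphic in `w` on the slit plane. The product `tan
(πα/2) (w - w^α)` is written as `kappa` times `driftCore`, both smooth in `α` through 1, so that `α
= 1` needs no separate treatment in the differentiation and tail estimates. On the strip `-1 ≤ Im w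
≤ 0`, `Re w ≥ 0`, the argument of `w` is `O(1/|w|)`, so `Re levyExp` still grows at least like a
positive power of `|w|`. Hence the kernel and its first two parameter derivatives are integrable,
locally uniformly in `θ`, and Cauchy's theorem moves the half line to the contour going from 0 down
to `-i` and then horizontally to infinity (`integral_exp_phase_contour`). Differentiation under this
integral gives the existence, symmetry and continuity of the derivatives of `f`.

The contour also yields the right tail. Put `u = (x - μ)/σ`. The horizontal leg carries a factor
`exp (-u)` and is negligible. On the vertical leg `w = -is` the variable `u` enters through the real
factor `exp (-su)`, and only the imaginary part of the kernel contributes. The phase there has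
imaginary part `(1 + β) sin (πα/2) s^α`, so a Laplace integral of `s^α` gives order `u^(-1-α)`: an
upper bound for `f`, and a matching lower bound because `1 + β` and the sine are positive
(`exists_le_density`). Differentiation in `μ` brings down a factor `s`, that is `u⁻¹`; in `α` a
logarithm, that is `log u`; in `σ` and `β` a factor of order one. Reflection `x ↦ -x`, `(μ, β) ↦
(-μ, -β)` transfers this to the left tail. In the quotients `f_i / f` and `f_ij / f` the common
power `u^(-1-α)` cancels, which leaves the stated orders.

The quotients require `f > 0`. For `α ≠ 1` the characteristic function is a pointwise limit of
exponentials of power series with nonnegative coefficients in damped characters, as for compound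
Poisson laws; such functions preserve nonnegativity of the Fourier transform, so `f ≥ 0`, and `α =
1` follows by continuity (`density_nonneg`). By stability `f` is the convolution of a stable density
with itself, and that density is positive far out in both tails, so the convolution is positive
everywhere (`density_pos`).

Finally `μ` is a location parameter, so `∂/∂x = -∂/∂μ`; this gives the identities for `ℓ'` and
reduces joint continuity to continuity in `θ` at `x = 0`. -/

/-- The entire function `z ↦ ∫₀¹ s ^ k * exp (s * z) ds`, the `k`-th derivative of
`(exp z - 1) / z`. -/
noncomputable def expMoment (k : ℕ) (z : ℂ) : ℂ :=
  ∫ s in (0 : ℝ)..1, (s : ℂ) ^ k * Complex.exp (s * z)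

/-- For `s` in `(0, 1]` the number `s * z.re` lies between `0` and `z.re`, so the exponential is at
most the larger of `1` and `exp z.re`, whatever the sign. -/
lemma norm_expMoment_integrand_le (k : ℕ) (z : ℂ) {s : ℝ} (hs : s ∈ Ioc (0 : ℝ) 1) :
    ‖(s : ℂ) ^ k * Complex.exp (s * z)‖ ≤ 1 + Real.exp z.re := by
  have h1 : ‖(s : ℂ) ^ k‖ ≤ 1 := by
    rw [norm_pow, Complex.norm_real, Real.norm_of_nonneg hs.1.le]
    exact pow_le_one₀ hs.1.le hs.2
  have h2 : ‖Complex.exp (s * z)‖ ≤ 1 + Real.exp z.re := by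
    rw [Complex.norm_exp, Complex.re_ofReal_mul]
    rcases le_total z.re 0 with h | h
    · have : Real.exp (s * z.re) ≤ 1 := Real.exp_le_one_iff.2 (mul_nonpos_of_nonneg_of_nonpos hs.1.le h)
      linarith [Real.exp_pos z.re]
    · have : Real.exp (s * z.re) ≤ Real.exp z.re :=
        Real.exp_le_exp.2 (mul_le_of_le_one_left h hs.2)
      linarith
  calc _ = ‖(s : ℂ) ^ k‖ * ‖Complex.exp (s * z)‖ := norm_mul _ _
    _ ≤ 1 * (1 + Real.exp z.re) := by gcongr
    _ = _ := one_mul _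

lemma norm_expMoment_le (k : ℕ) (z : ℂ) : ‖expMoment k z‖ ≤ 1 + Real.exp z.re := by
  have := intervalIntegral.norm_integral_le_of_norm_le_const (a := 0) (b := 1)
    (f := fun s : ℝ => (s : ℂ) ^ k * Complex.exp (s * z)) (C := 1 + Real.exp z.re)
    (fun s hs => norm_expMoment_integrand_le k z (by rwa [uIoc_of_le zero_le_one] at hs))
  simpa [expMoment] using this

lemma hasDerivAt_expMoment (k : ℕ) (z : ℂ) :
    HasDerivAt (expMoment k) (expMoment (k + 1) z) z := by
  refine (intervalIntegral.hasDerivAt_integral_of_dominated_loc_of_deriv_le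
    (F' := fun (z : ℂ) (s : ℝ) => (s : ℂ) ^ (k + 1) * Complex.exp (s * z))
    (bound := fun _ => 1 + Real.exp (z.re + 1)) (Metric.ball_mem_nhds z one_pos)
    (Eventually.of_forall fun z => ?_) ?_ ?_ ?_ ?_ ?_).2
  · exact (by fun_prop : Continuous fun s : ℝ => (s : ℂ) ^ k * Complex.exp (s * z)).aestronglyMeasurable
  · exact (by fun_prop : Continuous fun s : ℝ =>
      (s : ℂ) ^ k * Complex.exp (s * z)).intervalIntegrable _ _
  · exact (by fun_prop : Continuous fun s : ℝ =>
      (s : ℂ) ^ (k + 1) * Complex.exp (s * z)).aestronglyMeasurable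
  · refine Eventually.of_forall fun s hs y hy => ?_
    rw [uIoc_of_le zero_le_one] at hs
    refine (norm_expMoment_integrand_le (k + 1) y hs).trans ?_
    gcongr
    have := (Complex.abs_re_le_norm (y - z)).trans (mem_ball_iff_norm.1 hy).le
    have := (abs_le.1 this).2
    simp at this
    linarith
  · simp
  · refine Eventually.of_forall fun s _ y _ => ?_
    have := (((hasDerivAt_id' y).const_mul (s : ℂ)).cexp).const_mul ((s : ℂ) ^ k)
    exact this.congr_deriv (by ring)

lemma continuous_expMoment (k : ℕ) : Continuous (expMoment k) :=
  continuous_iff_continuousAt.2 fun z => (hasDerivAt_expMoment k z).continuousAt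

lemma mul_expMoment_zero (z : ℂ) : z * expMoment 0 z = Complex.exp z - 1 := by
  rcases eq_or_ne z 0 with rfl | hz
  · simp
  · rw [expMoment]
    simp only [pow_zero, one_mul, mul_comm _ z]
    rw [integral_exp_mul_complex hz]
    field_simp
    simp

lemma expMoment_zero_zero : expMoment 0 0 = 1 := by simp [expMoment]

/-- `∂^k/∂α^k` of `w ^ α`. -/
noncomputable def logPow (k : ℕ) (α : ℝ) (w : ℂ) : ℂ := Complex.log w ^ k * w ^ (α : ℂ)

/-- `∂^k/∂α^k` of `(w - w ^ α) / (1 - α)`, with its removable singularity at `α = 1` filled. -/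
noncomputable def driftCore (k : ℕ) (α : ℝ) (w : ℂ) : ℂ :=
  w * Complex.log w ^ (k + 1) * expMoment k (((α - 1 : ℝ) : ℂ) * Complex.log w)

lemma hasDerivAt_logPow (k : ℕ) (α : ℝ) {w : ℂ} (hw : w ≠ 0) :
    HasDerivAt (fun a : ℝ => logPow k a w) (logPow (k + 1) α w) α := by
  have h := ((hasDerivAt_id' (α : ℂ)).const_cpow (c := w) (Or.inl hw)).const_mul (Complex.log w ^ k)
  exact h.comp_ofReal.congr_deriv (by rw [logPow]; ring)

/-- The parameter `α` occurs only in the argument of `expMoment`, so each derivative contributes one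
`log w` and raises the moment by one. Nothing is divided by `1 - α`. -/
lemma hasDerivAt_driftCore (k : ℕ) (α : ℝ) (w : ℂ) :
    HasDerivAt (fun a : ℝ => driftCore k a w) (driftCore (k + 1) α w) α := by
  have h1 : HasDerivAt (fun a : ℂ => (a - 1) * Complex.log w) (Complex.log w) (α : ℂ) := by
    simpa using ((hasDerivAt_id (α : ℂ)).sub_const 1).mul_const (Complex.log w)
  have h := ((hasDerivAt_expMoment k (((α : ℂ) - 1) * Complex.log w)).comp (α : ℂ) h1).const_mul
    (w * Complex.log w ^ (k + 1))
  have := h.comp_ofReal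
  simp only [driftCore]
  convert this using 1
  · ext a; simp
  · push_cast; ring

lemma norm_logPow (k : ℕ) (α : ℝ) (w : ℂ) :
    ‖logPow k α w‖ ≤ ‖Complex.log w‖ ^ k * ‖w‖ ^ α := by
  rw [logPow, norm_mul, norm_pow]
  gcongr
  exact (Complex.norm_cpow_real _ _).le

/-- The bound `1 + exp (re z)` on `expMoment` turns into `1 + ‖w‖^(α-1)`, which stays bounded as `α`
passes through 1. -/
lemma norm_driftCore_le (k : ℕ) (α : ℝ) (w : ℂ) :
    ‖driftCore k α w‖ ≤ ‖Complex.log w‖ ^ (k + 1) * (‖w‖ + ‖w‖ ^ α) := by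
  rcases eq_or_ne w 0 with rfl | hw
  · simp [driftCore]
  have hw' := norm_pos_iff.2 hw
  rw [driftCore, norm_mul, norm_mul, norm_pow]
  have h := norm_expMoment_le k (((α - 1 : ℝ) : ℂ) * Complex.log w)
  rw [Complex.re_ofReal_mul, Complex.log_re, mul_comm (α - 1), ← Real.rpow_def_of_pos hw',
    Real.rpow_sub_one hw'.ne'] at h
  calc _ ≤ ‖w‖ * ‖Complex.log w‖ ^ (k + 1) * (1 + ‖w‖ ^ α / ‖w‖) := by gcongr
    _ = _ := by field_simp

/-- The side condition excludes only the convention `0 ^ 0 = 1`. -/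
lemma one_sub_mul_driftCore_zero {α : ℝ} (w : ℂ) (hw : w = 0 → α ≠ 0) :
    ((1 - α : ℝ) : ℂ) * driftCore 0 α w = w - w ^ (α : ℂ) := by
  rcases eq_or_ne w 0 with rfl | h0
  · have := hw rfl
    simp [driftCore, this]
  have h := mul_expMoment_zero (((α - 1 : ℝ) : ℂ) * Complex.log w)
  have h2 : w * Complex.exp (((α - 1 : ℝ) : ℂ) * Complex.log w) = w ^ (α : ℂ) := by
    rw [mul_comm ((α - 1 : ℝ) : ℂ), ← Complex.cpow_def_of_ne_zero h0, Complex.ofReal_sub,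
      Complex.ofReal_one, Complex.cpow_sub _ _ h0, Complex.cpow_one]
    field_simp
  rw [driftCore, ← h2]
  push_cast at h ⊢
  linear_combination (-w) * h

/-- `(1 - α) * tan (π α / 2)`, with its removable singularity at `α = 1` filled. -/
noncomputable def kappa (α : ℝ) : ℝ :=
  Real.sin (Real.pi * α / 2) / -dslope (fun a => Real.cos (Real.pi * a / 2)) 1 α

lemma kappa_of_ne {α : ℝ} (h : α ≠ 1) : kappa α = (1 - α) * Real.tan (Real.pi * α / 2) := by
  have h' : 1 - α ≠ 0 := sub_ne_zero.2 h.symm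
  have h'' : α - 1 ≠ 0 := sub_ne_zero.2 h
  rw [kappa, dslope_of_ne _ h, slope_def_field, Real.tan_eq_sin_div_cos]
  simp only [mul_one, Real.cos_pi_div_two, sub_zero]
  rcases eq_or_ne (Real.cos (Real.pi * α / 2)) 0 with hc | hc
  -- At the other zeros of the cosine both sides vanish through division by zero.
  · simp [hc]
  · field_simp; ring

lemma hasDerivAt_cos_pi_mul_div_two (a : ℝ) : HasDerivAt (fun a => Real.cos (Real.pi * a / 2))
    (-Real.sin (Real.pi * a / 2) * (Real.pi / 2)) a := by
  have := (((hasDerivAt_id a).const_mul Real.pi).div_const 2).cos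
  simpa using this

lemma kappa_one : kappa 1 = 2 / Real.pi := by
  rw [kappa, dslope_same, (hasDerivAt_cos_pi_mul_div_two 1).deriv]
  simp

/-- At 1 the power series of the cosine is shifted by one term; elsewhere this is an ordinary
quotient of analytic functions. -/
lemma analyticAt_dslope_cos (α : ℝ) :
    AnalyticAt ℝ (dslope (fun a => Real.cos (Real.pi * a / 2)) 1) α := by
  have hc : ∀ a : ℝ, AnalyticAt ℝ (fun a => Real.cos (Real.pi * a / 2)) a := fun a => by fun_prop
  rcases eq_or_ne α 1 with rfl | h
  · obtain ⟨p, hp⟩ := hc 1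
    exact ⟨_, hp.has_fpower_series_dslope_fslope⟩
  · have : (fun a => (a - 1)⁻¹ • (Real.cos (Real.pi * a / 2) - Real.cos (Real.pi * 1 / 2)))
        =ᶠ[𝓝 α] dslope (fun a => Real.cos (Real.pi * a / 2)) 1 := by
      filter_upwards [isOpen_ne.mem_nhds h] with a ha
      rw [dslope_of_ne _ ha, slope_def_field]
      simp [div_eq_inv_mul]
    refine AnalyticAt.congr ?_ this
    have h' : α - 1 ≠ 0 := sub_ne_zero.2 h
    simp only [smul_eq_mul]
    exact ((analyticAt_id.sub analyticAt_const).inv h').mul ((hc α).sub analyticAt_const)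

/-- On `(0, 2)` the cosine vanishes only at 1, and simply, so dividing by its slope cancels the pole
of the tangent without creating another. -/
lemma dslope_cos_ne_zero {α : ℝ} (h : α ∈ Ioo (0 : ℝ) 2) :
    dslope (fun a => Real.cos (Real.pi * a / 2)) 1 α ≠ 0 := by
  rcases eq_or_ne α 1 with rfl | h1
  · rw [dslope_same, (hasDerivAt_cos_pi_mul_div_two 1).deriv]
    simp [Real.pi_ne_zero]
  · rw [dslope_of_ne _ h1, slope_def_field]
    simp only [mul_one, Real.cos_pi_div_two, sub_zero]
    refine div_ne_zero ?_ (sub_ne_zero.2 h1)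
    rcases lt_or_gt_of_ne h1 with hl | hl
    · refine (Real.cos_pos_of_mem_Ioo ⟨?_, ?_⟩).ne' <;> nlinarith [Real.pi_pos, h.1, h.2]
    · refine (Real.cos_neg_of_pi_div_two_lt_of_lt ?_ ?_).ne <;> nlinarith [Real.pi_pos, h.1, h.2]

lemma analyticAt_kappa {α : ℝ} (h : α ∈ Ioo (0 : ℝ) 2) : AnalyticAt ℝ kappa α := by
  have hs : AnalyticAt ℝ (fun a => Real.sin (Real.pi * a / 2)) α := by fun_prop
  exact hs.div (analyticAt_dslope_cos α).neg (neg_ne_zero.2 (dslope_cos_ne_zero h))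

/-- The iterated derivatives of `kappa`. -/
noncomputable def kappaD (k : ℕ) : ℝ → ℝ := deriv^[k] kappa

lemma analyticAt_kappaD (k : ℕ) {α : ℝ} (h : α ∈ Ioo (0 : ℝ) 2) : AnalyticAt ℝ (kappaD k) α := by
  have : AnalyticOnNhd ℝ kappa (Ioo 0 2) := fun a ha => analyticAt_kappa ha
  exact this.iterated_deriv k α h

lemma hasDerivAt_kappaD (k : ℕ) {α : ℝ} (h : α ∈ Ioo (0 : ℝ) 2) :
    HasDerivAt (kappaD k) (kappaD (k + 1) α) α := by
  have := (analyticAt_kappaD k h).differentiableAt.hasDerivAt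
  rwa [kappaD, ← Function.iterate_succ_apply' deriv k kappa] at this

/-- `∂^k/∂α^k` of `tan (π α / 2) * (w - w ^ α)`, for `k ≤ 2`. -/
noncomputable def drift (α : ℝ) (w : ℂ) : ℂ := kappaD 0 α * driftCore 0 α w

/-- The derivative of `drift` in `α`. -/
noncomputable def driftA (α : ℝ) (w : ℂ) : ℂ :=
  kappaD 1 α * driftCore 0 α w + kappaD 0 α * driftCore 1 α w

/-- The second derivative of `drift` in `α`. -/
noncomputable def driftAA (α : ℝ) (w : ℂ) : ℂ :=
  kappaD 2 α * driftCore 0 α w + 2 * kappaD 1 α * driftCore 1 α w + kappaD 0 α * driftCore 2 α w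

lemma hasDerivAt_drift {α : ℝ} (h : α ∈ Ioo (0 : ℝ) 2) (w : ℂ) :
    HasDerivAt (fun a => drift a w) (driftA α w) α :=
  (hasDerivAt_kappaD 0 h).ofReal_comp.mul (hasDerivAt_driftCore 0 α w)

lemma hasDerivAt_driftA {α : ℝ} (h : α ∈ Ioo (0 : ℝ) 2) (w : ℂ) :
    HasDerivAt (fun a => driftA a w) (driftAA α w) α := by
  have h1 := (hasDerivAt_kappaD 1 h).ofReal_comp.mul (hasDerivAt_driftCore 0 α w)
  have h2 := (hasDerivAt_kappaD 0 h).ofReal_comp.mul (hasDerivAt_driftCore 1 α w)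
  exact (h1.add h2).congr_deriv (by rw [driftAA]; ring)

lemma drift_of_ne {α : ℝ} (h1 : α ≠ 1) (h0 : α ≠ 0) (w : ℂ) :
    drift α w = Real.tan (Real.pi * α / 2) * (w - w ^ (α : ℂ)) := by
  rw [← one_sub_mul_driftCore_zero w fun _ => h0, drift, kappaD, Function.iterate_zero, id,
    kappa_of_ne h1]
  push_cast; ring

lemma drift_one (w : ℂ) : drift 1 w = (2 / Real.pi : ℝ) * (w * Complex.log w) := by
  simp [drift, kappaD, kappa_one, driftCore, expMoment_zero_zero]

end StableM0

/-! ### The open parameter set, the holomorphic phase and its parameter derivatives -/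

namespace StableM0
open MeasureTheory Filter Topology Set

/-- An open set of parameters, shown below to be the interior of `paramSpace`. -/
def openParams : Set Param := {θ | 0 < θ 1 ∧ θ 2 ∈ Ioo (0 : ℝ) 2 ∧ θ 3 ∈ Ioo (-1 : ℝ) 1}

lemma isOpen_openParams : IsOpen openParams := by
  have h : openParams = (fun θ : Param => θ 1) ⁻¹' Ioi 0 ∩
      ((fun θ : Param => θ 2) ⁻¹' Ioo 0 2 ∩ (fun θ : Param => θ 3) ⁻¹' Ioo (-1) 1) := rfl
  rw [h]
  exact (isOpen_Ioi.preimage (continuous_apply 1)).inter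
    ((isOpen_Ioo.preimage (continuous_apply 2)).inter (isOpen_Ioo.preimage (continuous_apply 3)))

lemma eventually_update_mem {U : Set Param} (hU : IsOpen U) {θ : Param} (h : θ ∈ U) (i : Fin 4) :
    ∀ᶠ s in 𝓝 (θ i), Function.update θ i s ∈ U := by
  have hc : Continuous fun s : ℝ => Function.update θ i s := continuous_const.update i continuous_id
  refine hc.continuousAt.eventually_mem (hU.mem_nhds ?_)
  simpa using h

/-- A neighbourhood of `θ` restricts to a neighbourhood on each coordinate line, which forces `α`
and `β` into the interiors of their intervals. -/
lemma interior_paramSpace : interior paramSpace = openParams := by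
  apply Subset.antisymm
  · intro θ h
    have h0 := interior_subset h
    have key : ∀ i, ∀ᶠ s in 𝓝 (θ i), Function.update θ i s ∈ paramSpace := fun i =>
      (eventually_update_mem isOpen_interior h i).mono fun s hs => interior_subset hs
    refine ⟨h0.1, ?_, ?_⟩
    · rw [← interior_Ioc, mem_interior_iff_mem_nhds]
      filter_upwards [key 2] with s hs
      simpa using hs.2.1
    · rw [← interior_Icc, mem_interior_iff_mem_nhds]
      filter_upwards [key 3] with s hs
      simpa using hs.2.2
  · exact interior_maximal (fun θ h => ⟨h.1, ⟨h.2.1.1, h.2.1.2.le⟩, ⟨h.2.2.1.le, h.2.2.2.le⟩⟩)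
      isOpen_openParams

/-- The holomorphic exponent: `exp (phase w x θ)` is the analytic continuation in `w = σ t` of
`σ⁻¹ * exp (-i t x) * φ_θ(t)`. -/
noncomputable def phase (w : ℂ) (x : ℝ) (θ : Param) : ℂ :=
  -(Real.log (θ 1) : ℝ) - Complex.I * w * (((x - θ 0) / θ 1 : ℝ) : ℂ) - logPow 0 (θ 2) w
    - Complex.I * (θ 3 : ℂ) * drift (θ 2) w

/-- The first partial derivatives of `phase` in the parameters. -/
noncomputable def phase1 (i : Fin 4) (w : ℂ) (x : ℝ) (θ : Param) : ℂ :=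
  ![Complex.I * w * (((θ 1)⁻¹ : ℝ) : ℂ),
    -(((θ 1)⁻¹ : ℝ) : ℂ) + Complex.I * w * (((x - θ 0) / θ 1 ^ 2 : ℝ) : ℂ),
    -logPow 1 (θ 2) w - Complex.I * (θ 3 : ℂ) * driftA (θ 2) w,
    -Complex.I * drift (θ 2) w] i

/-- The second partial derivatives of `phase` in the parameters. -/
noncomputable def phase2 (i j : Fin 4) (w : ℂ) (x : ℝ) (θ : Param) : ℂ :=
  ![![0, -Complex.I * w * (((θ 1 ^ 2)⁻¹ : ℝ) : ℂ), 0, 0],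
    ![-Complex.I * w * (((θ 1 ^ 2)⁻¹ : ℝ) : ℂ),
      (((θ 1 ^ 2)⁻¹ : ℝ) : ℂ) - Complex.I * w * ((2 * (x - θ 0) / θ 1 ^ 3 : ℝ) : ℂ), 0, 0],
    ![0, 0, -logPow 2 (θ 2) w - Complex.I * (θ 3 : ℂ) * driftAA (θ 2) w,
      -Complex.I * driftA (θ 2) w],
    ![0, 0, -Complex.I * driftA (θ 2) w, 0]] i j

lemma phase2_symm (i j : Fin 4) (w : ℂ) (x : ℝ) (θ : Param) :
    phase2 i j w x θ = phase2 j i w x θ := by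
  fin_cases i <;> fin_cases j <;> rfl

lemma hasDerivAt_phase (i : Fin 4) {w : ℂ} (hw : w ≠ 0) (x : ℝ) {θ : Param} (h : θ ∈ openParams) :
    HasDerivAt (fun s => phase w x (Function.update θ i s)) (phase1 i w x θ) (θ i) := by
  obtain ⟨h1, h2, h3⟩ := h
  fin_cases i
  · have e := (((hasDerivAt_id' (θ 0)).const_sub x).div_const (θ 1)).ofReal_comp.const_mul
      (Complex.I * w)
    have := ((e.const_sub (-((Real.log (θ 1) : ℝ) : ℂ))).sub_const (logPow 0 (θ 2) w)).sub_const
      (Complex.I * (θ 3 : ℂ) * drift (θ 2) w)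
    simp only [phase, phase1]
    refine (this.congr_deriv ?_).congr_of_eventuallyEq (Eventually.of_forall fun s => ?_)
    · simp [div_eq_mul_inv]
    · simp [sub_eq_add_neg]
  · have e := ((hasDerivAt_id' (θ 1)).inv h1.ne').const_mul (x - θ 0) |>.ofReal_comp.const_mul
      (Complex.I * w)
    have := (((Real.hasDerivAt_log h1.ne').ofReal_comp.neg.sub e).sub_const
      (logPow 0 (θ 2) w)).sub_const (Complex.I * (θ 3 : ℂ) * drift (θ 2) w)
    simp only [phase, phase1]
    refine (this.congr_deriv ?_).congr_of_eventuallyEq (Eventually.of_forall fun s => ?_)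
    · simp; ring
    · simp [div_eq_mul_inv]
  · have := (((hasDerivAt_logPow 0 (θ 2) hw).const_sub (-((Real.log (θ 1) : ℝ) : ℂ)
      - Complex.I * w * (((x - θ 0) / θ 1 : ℝ) : ℂ))).sub
      ((hasDerivAt_drift h2 w).const_mul (Complex.I * (θ 3 : ℂ))))
    simp only [phase, phase1]
    refine (this.congr_deriv ?_).congr_of_eventuallyEq (Eventually.of_forall fun s => ?_)
    · simp
    · simp
  · have e := ((hasDerivAt_id' (θ 3)).ofReal_comp.const_mul Complex.I).mul_const (drift (θ 2) w)
    have := e.const_sub (-((Real.log (θ 1) : ℝ) : ℂ)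
      - Complex.I * w * (((x - θ 0) / θ 1 : ℝ) : ℂ) - logPow 0 (θ 2) w)
    simp only [phase, phase1]
    refine (this.congr_deriv ?_).congr_of_eventuallyEq (Eventually.of_forall fun s => ?_)
    · simp
    · simp

lemma hasDerivAt_phase1 (i j : Fin 4) {w : ℂ} (hw : w ≠ 0) (x : ℝ) {θ : Param}
    (h : θ ∈ openParams) :
    HasDerivAt (fun s => phase1 i w x (Function.update θ j s)) (phase2 i j w x θ) (θ j) := by
  obtain ⟨h1, h2, h3⟩ := h
  have hinv := (hasDerivAt_id' (θ 1)).inv h1.ne'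
  fin_cases i <;> fin_cases j
  all_goals
    simp only [phase1, phase2, Fin.zero_eta, Fin.mk_one, Fin.reduceFinMk, Matrix.cons_val,
        Function.update_self, ne_eq, Fin.reduceEq, not_false_eq_true, Function.update_of_ne]
    try exact hasDerivAt_const _ _
  · refine (hinv.ofReal_comp.const_mul (Complex.I * w)).congr_deriv ?_
    push_cast; field_simp
  · refine ((((hasDerivAt_id' (θ 0)).const_sub x).div_const (θ 1 ^ 2)).ofReal_comp.const_mul
      (Complex.I * w)).const_add _ |>.congr_deriv ?_
    push_cast; field_simp
  · have e := ((hinv.pow 2).const_mul (x - θ 0)).ofReal_comp.const_mul (Complex.I * w)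
    have h1' : (θ 1 : ℂ) ≠ 0 := by exact_mod_cast h1.ne'
    refine ((hinv.ofReal_comp.neg.add e).congr_deriv ?_).congr_of_eventuallyEq
      (Eventually.of_forall fun s => ?_)
    · simp only [Pi.inv_apply]
      push_cast; field_simp; ring
    · simp [div_eq_mul_inv]
  · exact (hasDerivAt_logPow 1 (θ 2) hw).neg.sub
      ((hasDerivAt_driftA h2 w).const_mul (Complex.I * (θ 3 : ℂ)))
  · refine ((((hasDerivAt_id' (θ 3)).ofReal_comp.const_mul Complex.I).mul_const
      (driftA (θ 2) w)).const_sub _).congr_deriv ?_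
    simp
  · exact (hasDerivAt_drift h2 w).const_mul (-Complex.I)

/-- The first partial derivatives of `exp phase`. -/
noncomputable def kern1 (i : Fin 4) (w : ℂ) (x : ℝ) (θ : Param) : ℂ :=
  phase1 i w x θ * Complex.exp (phase w x θ)

/-- The second partial derivatives of `exp phase`. -/
noncomputable def kern2 (i j : Fin 4) (w : ℂ) (x : ℝ) (θ : Param) : ℂ :=
  (phase2 i j w x θ + phase1 i w x θ * phase1 j w x θ) * Complex.exp (phase w x θ)

lemma kern2_symm (i j : Fin 4) (w : ℂ) (x : ℝ) (θ : Param) :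
    kern2 i j w x θ = kern2 j i w x θ := by
  rw [kern2, kern2, phase2_symm, mul_comm (phase1 i w x θ)]

lemma hasDerivAt_kern (i : Fin 4) {w : ℂ} (hw : w ≠ 0) (x : ℝ) {θ : Param} (h : θ ∈ openParams) :
    HasDerivAt (fun s => Complex.exp (phase w x (Function.update θ i s))) (kern1 i w x θ) (θ i) := by
  have := (hasDerivAt_phase i hw x h).cexp
  refine this.congr_deriv ?_
  simp only [Function.update_eq_self, kern1]; ring

lemma hasDerivAt_kern1 (i j : Fin 4) {w : ℂ} (hw : w ≠ 0) (x : ℝ) {θ : Param}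
    (h : θ ∈ openParams) :
    HasDerivAt (fun s => kern1 i w x (Function.update θ j s)) (kern2 i j w x θ) (θ j) := by
  have := (hasDerivAt_phase1 i j hw x h).mul (hasDerivAt_kern j hw x h)
  refine this.congr_deriv ?_
  simp only [Function.update_eq_self, kern1, kern2]; ring

/-! ### Continuity of the kernels in the parameters -/

section Continuity

lemma continuousOn_kappaD (k : ℕ) : ContinuousOn (fun θ : Param => kappaD k (θ 2)) openParams :=
  fun _ h => ((analyticAt_kappaD k h.2.1).continuousAt.comp
    (f := fun θ : Param => θ 2) (continuous_apply 2).continuousAt).continuousWithinAt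

lemma continuous_logPow_param (k : ℕ) {w : ℂ} (hw : w ≠ 0) :
    Continuous (fun θ : Param => logPow k (θ 2) w) := by
  have : Continuous (fun a : ℝ => logPow k a w) :=
    continuous_iff_continuousAt.2 fun a => (hasDerivAt_logPow k a hw).continuousAt
  exact this.comp (continuous_apply 2)

lemma continuous_driftCore_param (k : ℕ) (w : ℂ) :
    Continuous (fun θ : Param => driftCore k (θ 2) w) := by
  have : Continuous (fun a : ℝ => driftCore k a w) :=
    continuous_iff_continuousAt.2 fun a => (hasDerivAt_driftCore k a w).continuousAt
  exact this.comp (continuous_apply 2)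

lemma continuousOn_drift (w : ℂ) : ContinuousOn (fun θ : Param => drift (θ 2) w) openParams :=
  (Complex.continuous_ofReal.comp_continuousOn (continuousOn_kappaD 0)).mul
    (continuous_driftCore_param 0 w).continuousOn

lemma continuousOn_driftA (w : ℂ) : ContinuousOn (fun θ : Param => driftA (θ 2) w) openParams :=
  ((Complex.continuous_ofReal.comp_continuousOn (continuousOn_kappaD 1)).mul
    (continuous_driftCore_param 0 w).continuousOn).add
  ((Complex.continuous_ofReal.comp_continuousOn (continuousOn_kappaD 0)).mul
    (continuous_driftCore_param 1 w).continuousOn)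

lemma continuousOn_driftAA (w : ℂ) : ContinuousOn (fun θ : Param => driftAA (θ 2) w) openParams :=
  (((Complex.continuous_ofReal.comp_continuousOn (continuousOn_kappaD 2)).mul
    (continuous_driftCore_param 0 w).continuousOn).add
  ((continuousOn_const.mul (Complex.continuous_ofReal.comp_continuousOn (continuousOn_kappaD 1))).mul
    (continuous_driftCore_param 1 w).continuousOn)).add
  ((Complex.continuous_ofReal.comp_continuousOn (continuousOn_kappaD 0)).mul
    (continuous_driftCore_param 2 w).continuousOn)

lemma continuousOn_phase {w : ℂ} (hw : w ≠ 0) (x : ℝ) : ContinuousOn (phase w x) openParams := by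
  have hl : ContinuousOn (fun θ : Param => Real.log (θ 1)) openParams :=
    (continuous_apply 1).continuousOn.log fun θ h => h.1.ne'
  have hd : ContinuousOn (fun θ : Param => (x - θ 0) / θ 1) openParams :=
    (by fun_prop : Continuous fun θ : Param => x - θ 0).continuousOn.div
      (continuous_apply 1).continuousOn fun θ h => h.1.ne'
  have h3 : Continuous (fun θ : Param => (θ 3 : ℂ)) := by fun_prop
  exact (((Complex.continuous_ofReal.comp_continuousOn hl).neg.sub
    (continuousOn_const.mul (Complex.continuous_ofReal.comp_continuousOn hd))).sub
    (continuous_logPow_param 0 hw).continuousOn).sub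
    ((continuousOn_const.mul h3.continuousOn).mul (continuousOn_drift w))

lemma continuousOn_phase1 (i : Fin 4) {w : ℂ} (hw : w ≠ 0) (x : ℝ) :
    ContinuousOn (phase1 i w x) openParams := by
  have hs : ContinuousOn (fun θ : Param => (θ 1)⁻¹) openParams :=
    (continuous_apply 1).continuousOn.inv₀ fun θ h => h.1.ne'
  have hs' := Complex.continuous_ofReal.comp_continuousOn hs
  have hd : ContinuousOn (fun θ : Param => (x - θ 0) / θ 1 ^ 2) openParams :=
    (by fun_prop : Continuous fun θ : Param => x - θ 0).continuousOn.div
      (by fun_prop : Continuous fun θ : Param => θ 1 ^ 2).continuousOn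
      fun θ h => pow_ne_zero 2 h.1.ne'
  have h3 : Continuous (fun θ : Param => (θ 3 : ℂ)) := by fun_prop
  fin_cases i
  · exact continuousOn_const.mul hs'
  · exact hs'.neg.add (continuousOn_const.mul (Complex.continuous_ofReal.comp_continuousOn hd))
  · exact (continuous_logPow_param 1 hw).neg.continuousOn.sub
      ((continuousOn_const.mul h3.continuousOn).mul (continuousOn_driftA w))
  · exact continuousOn_const.mul (continuousOn_drift w)

lemma continuousOn_phase2 (i j : Fin 4) {w : ℂ} (hw : w ≠ 0) (x : ℝ) :
    ContinuousOn (phase2 i j w x) openParams := by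
  have hs : ContinuousOn (fun θ : Param => (θ 1 ^ 2)⁻¹) openParams :=
    (by fun_prop : Continuous fun θ : Param => θ 1 ^ 2).continuousOn.inv₀
      fun θ h => pow_ne_zero 2 h.1.ne'
  have hs' := Complex.continuous_ofReal.comp_continuousOn hs
  have hd : ContinuousOn (fun θ : Param => 2 * (x - θ 0) / θ 1 ^ 3) openParams :=
    (by fun_prop : Continuous fun θ : Param => 2 * (x - θ 0)).continuousOn.div
      (by fun_prop : Continuous fun θ : Param => θ 1 ^ 3).continuousOn
      fun θ h => pow_ne_zero 3 h.1.ne'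
  have h3 : Continuous (fun θ : Param => (θ 3 : ℂ)) := by fun_prop
  fin_cases i <;> fin_cases j
  all_goals first
    | exact continuousOn_const
    | exact continuousOn_const.mul hs'
    | exact hs'.sub (continuousOn_const.mul (Complex.continuous_ofReal.comp_continuousOn hd))
    | exact (continuous_logPow_param 2 hw).neg.continuousOn.sub
        ((continuousOn_const.mul h3.continuousOn).mul (continuousOn_driftAA w))
    | exact continuousOn_const.mul (continuousOn_driftA w)

lemma continuousOn_kern {w : ℂ} (hw : w ≠ 0) (x : ℝ) :
    ContinuousOn (fun θ => Complex.exp (phase w x θ)) openParams :=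
  Complex.continuous_exp.comp_continuousOn (continuousOn_phase hw x)

lemma continuousOn_kern1 (i : Fin 4) {w : ℂ} (hw : w ≠ 0) (x : ℝ) :
    ContinuousOn (kern1 i w x) openParams :=
  (continuousOn_phase1 i hw x).mul (continuousOn_kern hw x)

lemma continuousOn_kern2 (i j : Fin 4) {w : ℂ} (hw : w ≠ 0) (x : ℝ) :
    ContinuousOn (kern2 i j w x) openParams :=
  ((continuousOn_phase2 i j hw x).add
    ((continuousOn_phase1 i hw x).mul (continuousOn_phase1 j hw x))).mul (continuousOn_kern hw x)

end Continuity

/-! ### Measurability of the kernels along the contour -/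

section Measurability

lemma measurable_logPow (k : ℕ) (α : ℝ) : Measurable (logPow k α) :=
  (Complex.measurable_log.pow_const k).mul (measurable_id.pow_const _)

lemma measurable_driftCore (k : ℕ) (α : ℝ) : Measurable (driftCore k α) :=
  (measurable_id.mul (Complex.measurable_log.pow_const _)).mul
    ((continuous_expMoment k).measurable.comp (Complex.measurable_log.const_mul _))

lemma measurable_drift (α : ℝ) : Measurable (drift α) := (measurable_driftCore 0 α).const_mul _

lemma measurable_driftA (α : ℝ) : Measurable (driftA α) :=
  ((measurable_driftCore 0 α).const_mul _).add ((measurable_driftCore 1 α).const_mul _)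

lemma measurable_driftAA (α : ℝ) : Measurable (driftAA α) :=
  (((measurable_driftCore 0 α).const_mul _).add ((measurable_driftCore 1 α).const_mul _)).add
    ((measurable_driftCore 2 α).const_mul _)

lemma measurable_phase (x : ℝ) (θ : Param) : Measurable fun w => phase w x θ :=
  (((measurable_id.const_mul _).mul_const _).const_sub _ |>.sub (measurable_logPow 0 _)).sub
    ((measurable_drift _).const_mul _)

lemma measurable_phase1 (i : Fin 4) (x : ℝ) (θ : Param) : Measurable fun w => phase1 i w x θ := by
  fin_cases i
  · exact (measurable_id.const_mul _).mul_const _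
  · exact ((measurable_id.const_mul _).mul_const _).const_add _
  · exact (measurable_logPow 1 _).neg.sub ((measurable_driftA _).const_mul _)
  · exact (measurable_drift _).const_mul _

lemma measurable_phase2 (i j : Fin 4) (x : ℝ) (θ : Param) :
    Measurable fun w => phase2 i j w x θ := by
  fin_cases i <;> fin_cases j
  all_goals first
    | exact measurable_const
    | exact (measurable_id.const_mul _).mul_const _
    | exact ((measurable_id.const_mul _).mul_const _).const_sub _
    | exact (measurable_logPow 2 _).neg.sub ((measurable_driftAA _).const_mul _)
    | exact (measurable_driftA _).const_mul _

lemma measurable_kern (x : ℝ) (θ : Param) : Measurable fun w => Complex.exp (phase w x θ) :=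
  (measurable_phase x θ).cexp

lemma measurable_kern1 (i : Fin 4) (x : ℝ) (θ : Param) : Measurable fun w => kern1 i w x θ :=
  (measurable_phase1 i x θ).mul (measurable_kern x θ)

lemma measurable_kern2 (i j : Fin 4) (x : ℝ) (θ : Param) :
    Measurable fun w => kern2 i j w x θ :=
  ((measurable_phase2 i j x θ).add ((measurable_phase1 i x θ).mul (measurable_phase1 j x θ))).mul
    (measurable_kern x θ)

end Measurability

end StableM0

/-! ### Locally uniform bounds for the phase derivatives on the strip -/

namespace StableM0
open MeasureTheory Filter Topology Set

lemma add_two_pow_le_exp {a : ℝ} (ha : 0 < a) (m : ℕ) :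
    ∃ C, 0 ≤ C ∧ ∀ y, 0 ≤ y → (y + 2) ^ m ≤ C * Real.exp (a * y) := by
  refine ⟨m.factorial * Real.exp (2 * a) / a ^ m, by positivity, fun y hy => ?_⟩
  have h := Real.pow_div_factorial_le_exp (a * (y + 2)) (by positivity) m
  rw [div_le_iff₀ (by positivity), mul_pow] at h
  have h2 : Real.exp (a * (y + 2)) = Real.exp (2 * a) * Real.exp (a * y) := by
    rw [← Real.exp_add]; ring_nf
  rw [h2] at h
  rw [div_mul_eq_mul_div, le_div_iff₀ (by positivity)]
  linarith

/-- For `r ≤ 1` the power `r^a` absorbs any power of the logarithm. For `r ≥ 1` the logarithms cost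
one factor `r` on top of `r^α ≤ r²`, whence the exponent 3 for every `m`. -/
lemma rpow_mul_abs_log_le {a : ℝ} (ha : 0 < a) (m : ℕ) :
    ∃ C, 0 ≤ C ∧ ∀ r, 0 < r → ∀ α, a ≤ α → α ≤ 2 →
      r ^ α * (|Real.log r| + 2) ^ m ≤ C * (1 + r) ^ 3 := by
  obtain ⟨C₁, h₁, H₁⟩ := add_two_pow_le_exp ha m
  obtain ⟨C₂, h₂, H₂⟩ := add_two_pow_le_exp one_pos m
  refine ⟨C₁ + C₂, by positivity, fun r hr α hα hα2 => ?_⟩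
  have h3 : 1 ≤ (1 + r) ^ 3 := one_le_pow₀ (by linarith)
  rcases le_total r 1 with h | h
  · have hl : |Real.log r| = -Real.log r := abs_of_nonpos (Real.log_nonpos hr.le h)
    have e : Real.exp (a * |Real.log r|) = (r ^ a)⁻¹ := by
      rw [Real.rpow_def_of_pos hr, ← Real.exp_neg, hl]; ring_nf
    have := H₁ _ (abs_nonneg (Real.log r))
    rw [e] at this
    have hra := Real.rpow_pos_of_pos hr a
    calc r ^ α * (|Real.log r| + 2) ^ m ≤ r ^ a * (C₁ * (r ^ a)⁻¹) := by
          gcongr ?_ * ?_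
          exact Real.rpow_le_rpow_of_exponent_ge hr h hα
      _ = C₁ := by field_simp
      _ ≤ (C₁ + C₂) * 1 := by linarith
      _ ≤ _ := by gcongr
  · have hl : |Real.log r| = Real.log r := abs_of_nonneg (Real.log_nonneg h)
    have := H₂ _ (abs_nonneg (Real.log r))
    rw [one_mul, hl, Real.exp_log hr] at this
    rw [hl]
    have hl0 := Real.log_nonneg h
    calc r ^ α * (Real.log r + 2) ^ m ≤ r ^ (2 : ℝ) * (C₂ * r) := by
          gcongr ?_ * ?_
          exact Real.rpow_le_rpow_of_exponent_le h hα2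
      _ = C₂ * r ^ 3 := by rw [Real.rpow_two]; ring
      _ ≤ (C₁ + C₂) * (1 + r) ^ 3 := by gcongr <;> linarith

lemma eventually_add_mul_log_le_rpow (A B : ℝ) {a : ℝ} (ha : 0 < a) :
    ∀ᶠ r : ℝ in atTop, A + B * Real.log r ≤ r ^ a := by
  have h1 : (fun _ : ℝ => A) =o[atTop] fun r : ℝ => r ^ a :=
    Asymptotics.isLittleO_const_left.2 (Or.inr
      (tendsto_norm_atTop_atTop.comp (tendsto_rpow_atTop ha)))
  have h2 := (isLittleO_log_rpow_atTop ha).const_mul_left B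
  have := (h1.add h2).bound one_pos
  filter_upwards [this, eventually_gt_atTop 0] with r hr h0
  rw [one_mul, Real.norm_of_nonneg (Real.rpow_nonneg h0.le a)] at hr
  exact (le_abs_self _).trans hr

/-- The part of the closed fourth quadrant swept by the contour deformation. -/
def strip : Set ℂ := {w | w ≠ 0 ∧ 0 ≤ w.re ∧ w.im ∈ Icc (-1 : ℝ) 0}

lemma strip_ne {w : ℂ} (hw : w ∈ strip) : w ≠ 0 := hw.1

lemma arg_mem_of_strip {w : ℂ} (hw : w ∈ strip) : w.arg ∈ Icc (-(Real.pi / 2)) 0 := by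
  have h := (Complex.abs_arg_le_pi_div_two_iff).2 hw.2.1
  refine ⟨(abs_le.1 h).1, ?_⟩
  rcases eq_or_lt_of_le hw.2.2.2 with h0 | h0
  · exact (Complex.arg_eq_zero_iff.2 ⟨hw.2.1, h0⟩).le
  · exact (Complex.arg_neg_iff.2 h0).le

/-- Jordan's inequality turns `|Im w| ≤ 1` into `|arg w| ≤ (π/2)/‖w‖`: far out, the strip is nearly
the positive real axis, so the decay known there survives the change of contour. -/
lemma neg_arg_mul_norm_le {w : ℂ} (hw : w ∈ strip) : -w.arg * ‖w‖ ≤ 2 := by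
  have h := arg_mem_of_strip hw
  have h1 : Real.sin w.arg * ‖w‖ = w.im := by
    rw [Complex.sin_arg, div_mul_cancel₀ _ (norm_ne_zero_iff.2 hw.1)]
  have h2 := Real.mul_le_sin (neg_nonneg.2 h.2) (by linarith [h.1])
  rw [Real.sin_neg] at h2
  have h3 : 2 / Real.pi * -w.arg * ‖w‖ ≤ 1 := by nlinarith [norm_nonneg w, hw.2.2.1]
  have h4 : 1 / 2 ≤ 2 / Real.pi := by
    rw [div_le_div_iff₀ two_pos Real.pi_pos]; linarith [Real.pi_le_four]
  nlinarith [mul_nonneg (neg_nonneg.2 h.2) (norm_nonneg w)]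

lemma norm_log_le {w : ℂ} (hw : w ∈ strip) : ‖Complex.log w‖ ≤ |Real.log ‖w‖| + 2 := by
  have h := arg_mem_of_strip hw
  have : |w.arg| ≤ 2 := by
    rw [abs_le]; constructor <;> linarith [h.1, h.2, Real.pi_le_four]
  have h2 := Complex.norm_le_abs_re_add_abs_im (Complex.log w)
  rw [Complex.log_re, Complex.log_im] at h2
  linarith

/-- Quantitative bounds on a parameter vector, used to state locally uniform estimates. -/
structure BddBy (K : ℝ) (θ : Param) : Prop where
  one_le : 1 ≤ K
  le_scale : K⁻¹ ≤ θ 1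
  le_index : K⁻¹ ≤ θ 2
  index_le : θ 2 ≤ 2
  skew_le : |θ 3| ≤ 1
  loc_le : |θ 0| ≤ K
  kappa_le : |kappaD 0 (θ 2)| ≤ K
  kappa1_le : |kappaD 1 (θ 2)| ≤ K
  kappa2_le : |kappaD 2 (θ 2)| ≤ K

lemma BddBy.pos {K : ℝ} {θ : Param} (h : BddBy K θ) : 0 < K := one_pos.trans_le h.one_le

lemma BddBy.scale_pos {K : ℝ} {θ : Param} (h : BddBy K θ) : 0 < θ 1 :=
  (inv_pos.2 h.pos).trans_le h.le_scale

lemma BddBy.inv_scale_le {K : ℝ} {θ : Param} (h : BddBy K θ) : (θ 1)⁻¹ ≤ K :=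
  inv_le_of_inv_le₀ h.pos h.le_scale

/-- All the quantities involved are continuous at an interior point, so one `K` serves a whole
neighbourhood. Every dominating function below depends on `θ` only through such a `K`. -/
lemma exists_eventually_bddBy {θ₀ : Param} (h : θ₀ ∈ openParams) :
    ∃ K, ∀ᶠ θ in 𝓝 θ₀, BddBy K θ := by
  have hk : ∀ k, ContinuousAt (fun θ : Param => |kappaD k (θ 2)|) θ₀ := fun k =>
    ((continuousOn_kappaD k).continuousAt (isOpen_openParams.mem_nhds h)).abs
  have hc : ∀ i, ContinuousAt (fun θ : Param => θ i) θ₀ := fun i => (continuous_apply i).continuousAt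
  obtain ⟨K, hK⟩ : ∃ K, 1 ≤ K ∧ K⁻¹ < θ₀ 1 ∧ K⁻¹ < θ₀ 2 ∧ |θ₀ 0| < K ∧
      |kappaD 0 (θ₀ 2)| < K ∧ |kappaD 1 (θ₀ 2)| < K ∧ |kappaD 2 (θ₀ 2)| < K := by
    refine Eventually.exists (f := atTop) ?_
    exact (eventually_ge_atTop 1).and <|
      (tendsto_inv_atTop_zero.eventually_lt_const h.1).and <|
      (tendsto_inv_atTop_zero.eventually_lt_const h.2.1.1).and <|
      (eventually_gt_atTop _).and <| (eventually_gt_atTop _).and <| (eventually_gt_atTop _).and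
      (eventually_gt_atTop _)
  refine ⟨K, ?_⟩
  obtain ⟨h1, h2, h4, h5, h6, h7, h8⟩ := hK
  filter_upwards [isOpen_openParams.mem_nhds h, (hc 1).eventually_const_lt h2,
    (hc 2).eventually_const_lt h4,
    (hc 0).abs.eventually_lt_const h5, (hk 0).eventually_lt_const h6,
    (hk 1).eventually_lt_const h7, (hk 2).eventually_lt_const h8] with θ g g2 g4 g5 g6 g7 g8
  exact ⟨h1, g2.le, g4.le, g.2.1.2.le, abs_le.2 ⟨g.2.2.1.le, g.2.2.2.le⟩, g5.le, g6.le, g7.le,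
    g8.le⟩

lemma exists_norm_logPow_le (K : ℝ) (k : ℕ) : ∃ C, 0 ≤ C ∧ ∀ θ, BddBy K θ → ∀ w ∈ strip,
    ‖logPow k (θ 2) w‖ ≤ C * (1 + ‖w‖) ^ 3 := by
  by_cases hK : 1 ≤ K
  · obtain ⟨C, h0, hC⟩ := rpow_mul_abs_log_le (inv_pos.2 (one_pos.trans_le hK)) k
    refine ⟨C, h0, fun θ h w hw => (norm_logPow k (θ 2) w).trans ?_⟩
    refine le_trans ?_ (hC ‖w‖ (norm_pos_iff.2 hw.1) (θ 2) h.le_index h.index_le)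
    rw [mul_comm]
    gcongr
    exact norm_log_le hw
  -- For `K < 1` no parameter satisfies `BddBy K`, so the claim is empty; the same case split recurs
  -- in the bounds below.
  · exact ⟨0, le_rfl, fun θ h => absurd h.one_le hK⟩

lemma exists_norm_driftCore_le (K : ℝ) (k : ℕ) : ∃ C, 0 ≤ C ∧ ∀ θ, BddBy K θ → ∀ w ∈ strip,
    ‖driftCore k (θ 2) w‖ ≤ C * (1 + ‖w‖) ^ 3 := by
  by_cases hK : 1 ≤ K
  · obtain ⟨C, h0, hC⟩ := rpow_mul_abs_log_le (inv_pos.2 (one_pos.trans_le hK)) (k + 1)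
    refine ⟨C + C, by positivity, fun θ h w hw => (norm_driftCore_le k (θ 2) w).trans ?_⟩
    have h1 := hC ‖w‖ (norm_pos_iff.2 hw.1) (θ 2) h.le_index h.index_le
    have h2 := hC ‖w‖ (norm_pos_iff.2 hw.1) 1 (inv_le_one_of_one_le₀ hK) one_le_two
    rw [Real.rpow_one] at h2
    calc _ ≤ (|Real.log ‖w‖| + 2) ^ (k + 1) * (‖w‖ + ‖w‖ ^ (θ 2)) := by
          gcongr; exact norm_log_le hw
      _ ≤ _ := by linarith
  · exact ⟨0, le_rfl, fun θ h => absurd h.one_le hK⟩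

lemma exists_norm_drift_le (K : ℝ) : ∃ C, 0 ≤ C ∧ ∀ θ, BddBy K θ → ∀ w ∈ strip,
    ‖drift (θ 2) w‖ ≤ C * (1 + ‖w‖) ^ 3 ∧ ‖driftA (θ 2) w‖ ≤ C * (1 + ‖w‖) ^ 3 ∧
    ‖driftAA (θ 2) w‖ ≤ C * (1 + ‖w‖) ^ 3 := by
  by_cases hK : 1 ≤ K
  · have hK0 : 0 < K := one_pos.trans_le hK
    obtain ⟨C₀, h₀, H₀⟩ := exists_norm_driftCore_le K 0
    obtain ⟨C₁, h₁, H₁⟩ := exists_norm_driftCore_le K 1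
    obtain ⟨C₂, h₂, H₂⟩ := exists_norm_driftCore_le K 2
    refine ⟨K * C₀ + 2 * K * C₁ + K * C₂, by positivity, fun θ h w hw => ?_⟩
    have a0 := H₀ θ h w hw
    have a1 := H₁ θ h w hw
    have a2 := H₂ θ h w hw
    set P := (1 + ‖w‖) ^ 3 with hP
    have hP0 : 0 ≤ P := by positivity
    have n0 : ‖((kappaD 0 (θ 2) : ℝ) : ℂ)‖ ≤ K := by rw [Complex.norm_real]; exact h.kappa_le
    have n1 : ‖((kappaD 1 (θ 2) : ℝ) : ℂ)‖ ≤ K := by rw [Complex.norm_real]; exact h.kappa1_le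
    have n2 : ‖((kappaD 2 (θ 2) : ℝ) : ℂ)‖ ≤ K := by rw [Complex.norm_real]; exact h.kappa2_le
    have q0 : 0 ≤ K * C₀ * P := by positivity
    have q1 : 0 ≤ K * C₁ * P := by positivity
    have q2 : 0 ≤ K * C₂ * P := by positivity
    have m : ∀ {a b : ℂ} {c : ℝ}, ‖a‖ ≤ K → ‖b‖ ≤ c * P → ‖a * b‖ ≤ K * c * P := by
      intro a b c ha hb
      rw [norm_mul, mul_assoc]
      exact mul_le_mul ha hb (norm_nonneg _) hK0.le
    refine ⟨?_, ?_, ?_⟩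
    · have := m n0 a0
      rw [drift]; linarith
    · have := norm_add_le_of_le (m n1 a0) (m n0 a1)
      rw [driftA]; linarith
    · have b1 := m n1 a1
      have b2 : ‖2 * ((kappaD 1 (θ 2) : ℝ) : ℂ) * driftCore 1 (θ 2) w‖ ≤ 2 * (K * C₁ * P) := by
        rw [mul_assoc, norm_mul, Complex.norm_two]; linarith
      have := norm_add_le_of_le (norm_add_le_of_le (m n2 a0) b2) (m n0 a2)
      rw [driftAA]; linarith
  · exact ⟨0, le_rfl, fun θ h => absurd h.one_le hK⟩

/-- Weights measuring how differentiation in the parameters affects `exp phase` at distance `r`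
from the origin, with `y` the distance from `x` to the location parameter. -/
noncomputable def weight (i : Fin 4) (r y : ℝ) : ℝ := ![r, 1 + r * y, 1, 1] i

lemma weight_nonneg (i : Fin 4) {r y : ℝ} (hr : 0 ≤ r) (hy : 0 ≤ y) : 0 ≤ weight i r y := by
  have := mul_nonneg hr hy
  fin_cases i <;> simp [weight] <;> linarith

lemma exists_norm_phase1_le (K : ℝ) : ∃ C, 0 ≤ C ∧ ∀ θ, BddBy K θ → ∀ w ∈ strip, ∀ x i,
    ‖phase1 i w x θ‖ ≤ C * (1 + ‖w‖) ^ 3 * weight i ‖w‖ |x - θ 0| := by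
  by_cases hK : 1 ≤ K
  swap
  · exact ⟨0, le_rfl, fun θ h => absurd h.one_le hK⟩
  have hK0 : 0 < K := one_pos.trans_le hK
  obtain ⟨C₁, h₁, H₁⟩ := exists_norm_logPow_le K 1
  obtain ⟨C₂, h₂, H₂⟩ := exists_norm_drift_le K
  refine ⟨K ^ 2 + C₁ + C₂, by positivity, fun θ h w hw x i => ?_⟩
  have a1 := H₁ θ h w hw
  obtain ⟨b0, b1, -⟩ := H₂ θ h w hw
  have hs := h.inv_scale_le
  have hsp := h.scale_pos
  have hP : 1 ≤ (1 + ‖w‖) ^ 3 := one_le_pow₀ (by linarith [norm_nonneg w])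
  set P := (1 + ‖w‖) ^ 3
  have hKK : K ≤ K ^ 2 := by nlinarith
  have hCK : K ^ 2 ≤ (K ^ 2 + C₁ + C₂) * P := by nlinarith
  have hin : ‖(((θ 1)⁻¹ : ℝ) : ℂ)‖ ≤ K := by
    rw [Complex.norm_real, Real.norm_of_nonneg (inv_nonneg.2 hsp.le)]; exact hs
  have hIβ : ‖Complex.I * (θ 3 : ℂ)‖ ≤ 1 := by
    rw [norm_mul, Complex.norm_I, one_mul, Complex.norm_real]; exact h.skew_le
  fin_cases i
  · have : ‖Complex.I * w * (((θ 1)⁻¹ : ℝ) : ℂ)‖ ≤ ‖w‖ * K := by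
      rw [norm_mul, norm_mul, Complex.norm_I, one_mul]; gcongr
    simp only [phase1, weight, Fin.zero_eta, Matrix.cons_val]
    nlinarith [norm_nonneg w]
  · have hd : ‖(((x - θ 0) / θ 1 ^ 2 : ℝ) : ℂ)‖ ≤ |x - θ 0| * K ^ 2 := by
      rw [Complex.norm_real, Real.norm_eq_abs, abs_div, div_eq_mul_inv,
        abs_of_nonneg (sq_nonneg (θ 1)), ← inv_pow]
      gcongr
    have : ‖-(((θ 1)⁻¹ : ℝ) : ℂ) + Complex.I * w * (((x - θ 0) / θ 1 ^ 2 : ℝ) : ℂ)‖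
        ≤ K + ‖w‖ * (|x - θ 0| * K ^ 2) := by
      refine norm_add_le_of_le (by rwa [norm_neg]) ?_
      rw [norm_mul, norm_mul, Complex.norm_I, one_mul]; gcongr
    simp only [phase1, weight, Fin.mk_one, Matrix.cons_val]
    have h' : 0 ≤ ‖w‖ * |x - θ 0| := by positivity
    nlinarith
  · have : ‖-logPow 1 (θ 2) w - Complex.I * (θ 3 : ℂ) * driftA (θ 2) w‖ ≤ C₁ * P + 1 * (C₂ * P) := by
      refine norm_sub_le_of_le (by rwa [norm_neg]) ?_
      rw [norm_mul]; gcongr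
    simp only [phase1, weight, Fin.reduceFinMk, Matrix.cons_val]
    nlinarith [sq_nonneg K]
  · have : ‖-Complex.I * drift (θ 2) w‖ ≤ C₂ * P := by
      rwa [norm_mul, norm_neg, Complex.norm_I, one_mul]
    simp only [phase1, weight, Fin.reduceFinMk, Matrix.cons_val]
    nlinarith [sq_nonneg K]

/-- The product of two weights is not the sharpest bound, but it matches the term `phase1 i * phase1
j` of `kern2`, so both can be estimated together. -/
lemma exists_norm_phase2_le (K : ℝ) : ∃ C, 0 ≤ C ∧ ∀ θ, BddBy K θ → ∀ w ∈ strip, ∀ x i j,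
    ‖phase2 i j w x θ‖ ≤
      C * (1 + ‖w‖) ^ 3 * (weight i ‖w‖ |x - θ 0| * weight j ‖w‖ |x - θ 0|) := by
  by_cases hK : 1 ≤ K
  swap
  · exact ⟨0, le_rfl, fun θ h => absurd h.one_le hK⟩
  have hK0 : 0 < K := one_pos.trans_le hK
  obtain ⟨C₁, h₁, H₁⟩ := exists_norm_logPow_le K 2
  obtain ⟨C₂, h₂, H₂⟩ := exists_norm_drift_le K
  refine ⟨2 * K ^ 3 + C₁ + C₂, by positivity, fun θ h w hw x i j => ?_⟩
  have a1 := H₁ θ h w hw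
  obtain ⟨-, b1, b2⟩ := H₂ θ h w hw
  have hs := h.inv_scale_le
  have hsp := h.scale_pos
  have hP : 1 ≤ (1 + ‖w‖) ^ 3 := one_le_pow₀ (by linarith [norm_nonneg w])
  have hW := mul_nonneg (weight_nonneg i (norm_nonneg w) (abs_nonneg (x - θ 0)))
    (weight_nonneg j (norm_nonneg w) (abs_nonneg (x - θ 0)))
  set P := (1 + ‖w‖) ^ 3
  have hKK : K ^ 2 ≤ K ^ 3 := pow_le_pow_right₀ hK (by norm_num)
  have hCK : 2 * K ^ 3 ≤ (2 * K ^ 3 + C₁ + C₂) * P := by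
    have : 0 ≤ K ^ 3 := by positivity
    nlinarith
  have hin : ‖(((θ 1 ^ 2)⁻¹ : ℝ) : ℂ)‖ ≤ K ^ 2 := by
    rw [Complex.norm_real, Real.norm_of_nonneg (by positivity), ← inv_pow]; gcongr
  have hIβ : ‖Complex.I * (θ 3 : ℂ)‖ ≤ 1 := by
    rw [norm_mul, Complex.norm_I, one_mul, Complex.norm_real]; exact h.skew_le
  have h' : 0 ≤ ‖w‖ * |x - θ 0| := by positivity
  have h01 : ‖-Complex.I * w * (((θ 1 ^ 2)⁻¹ : ℝ) : ℂ)‖ ≤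
      (2 * K ^ 3 + C₁ + C₂) * P * (‖w‖ * (1 + ‖w‖ * |x - θ 0|)) := by
    rw [norm_mul, norm_mul, norm_neg, Complex.norm_I, one_mul]
    calc _ ≤ ‖w‖ * K ^ 2 := by gcongr
      _ ≤ ‖w‖ * ((2 * K ^ 3 + C₁ + C₂) * P) := by
        gcongr
        have : 0 ≤ K ^ 3 := by positivity
        linarith
      _ ≤ ‖w‖ * ((2 * K ^ 3 + C₁ + C₂) * P) * (1 + ‖w‖ * |x - θ 0|) :=
        le_mul_of_one_le_right (by positivity) (by linarith)
      _ = _ := by ring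
  have h23 : ‖-Complex.I * driftA (θ 2) w‖ ≤ (2 * K ^ 3 + C₁ + C₂) * P * (1 * 1) := by
    rw [norm_mul, norm_neg, Complex.norm_I, one_mul]
    have : 0 ≤ (2 * K ^ 3 + C₁) * P := by positivity
    linarith
  fin_cases i <;> fin_cases j
  all_goals
    simp only [phase2, Fin.zero_eta, Fin.mk_one, Fin.reduceFinMk, Matrix.cons_val]
      at hW ⊢
    try (rw [norm_zero]; exact mul_nonneg (by positivity) hW)
  · simpa only [weight, Matrix.cons_val] using h01
  · rw [mul_comm (weight 1 _ _)]
    simpa only [weight, Matrix.cons_val] using h01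
  · have hd : ‖((2 * (x - θ 0) / θ 1 ^ 3 : ℝ) : ℂ)‖ ≤ 2 * |x - θ 0| * K ^ 3 := by
      rw [Complex.norm_real, Real.norm_eq_abs, abs_div, div_eq_mul_inv, abs_mul, abs_two,
        abs_of_nonneg (pow_pos hsp 3).le, ← inv_pow]
      gcongr
    have : ‖(((θ 1 ^ 2)⁻¹ : ℝ) : ℂ) - Complex.I * w * ((2 * (x - θ 0) / θ 1 ^ 3 : ℝ) : ℂ)‖
        ≤ K ^ 2 + ‖w‖ * (2 * |x - θ 0| * K ^ 3) := by
      refine norm_sub_le_of_le hin ?_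
      rw [norm_mul, norm_mul, Complex.norm_I, one_mul]; gcongr
    simp only [weight, Matrix.cons_val]
    set A := ‖w‖ * |x - θ 0|
    calc _ ≤ 2 * K ^ 3 * (1 + A) := by
          have : 0 ≤ K ^ 3 := by positivity
          have e : ‖w‖ * (2 * |x - θ 0| * K ^ 3) = 2 * K ^ 3 * A := by ring
          linarith
      _ ≤ (2 * K ^ 3 + C₁ + C₂) * P * (1 + A) := by gcongr
      _ ≤ (2 * K ^ 3 + C₁ + C₂) * P * ((1 + A) * (1 + A)) := by
          gcongr
          nlinarith
  · have : ‖-logPow 2 (θ 2) w - Complex.I * (θ 3 : ℂ) * driftAA (θ 2) w‖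
        ≤ C₁ * P + 1 * (C₂ * P) := by
      refine norm_sub_le_of_le (by rwa [norm_neg]) ?_
      rw [norm_mul]; gcongr
    simp only [weight, Matrix.cons_val]
    have : 0 ≤ 2 * K ^ 3 * P := by positivity
    linarith
  · simpa only [weight, Matrix.cons_val] using h23
  · simpa only [weight, Matrix.cons_val] using h23

end StableM0

/-! ### Decay of the continued characteristic function on the strip -/

namespace StableM0
open MeasureTheory Filter Topology Set

/-- `-log φ(w)` for the standardised law, continued analytically. -/
noncomputable def levyExp (α β : ℝ) (w : ℂ) : ℂ :=
  logPow 0 α w + Complex.I * (β : ℂ) * drift α w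

/-- Since `driftCore 0 α w` is the integral over `s` in `[0, 1]` of `L exp ((1 + s(α-1)) L)` with `L
= log w`, its imaginary part vanishes for real positive `w` and is in general proportional to `arg
w`. With `arg w = O(1/‖w‖)` this makes the skewness term smaller than `‖w‖^α` at infinity. -/
lemma abs_im_driftCore_zero_le (α : ℝ) (hα : α ∈ Ioc (0 : ℝ) 2) {w : ℂ} (hw : w ∈ strip)
    (h1 : 1 ≤ ‖w‖) :
    |(driftCore 0 α w).im| ≤ (‖w‖ + ‖w‖ ^ α) * (-w.arg * (1 + 2 * Real.log ‖w‖)) := by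
  have hr : 0 < ‖w‖ := norm_pos_iff.2 hw.1
  have harg := arg_mem_of_strip hw
  set L := Complex.log w with hL
  have hLre : L.re = Real.log ‖w‖ := Complex.log_re w
  have hLim : L.im = w.arg := Complex.log_im w
  have hl : 0 ≤ Real.log ‖w‖ := Real.log_nonneg h1
  have e : driftCore 0 α w =
      ∫ s in (0 : ℝ)..1, L * Complex.exp (((1 + s * (α - 1) : ℝ) : ℂ) * L) := by
    rw [driftCore, expMoment, ← intervalIntegral.integral_const_mul]
    congr 1
    ext s
    rw [← hL]
    have : Complex.exp (((1 + s * (α - 1) : ℝ) : ℂ) * L) =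
        w * Complex.exp (s * (((α - 1 : ℝ) : ℂ) * L)) := by
      calc _ = Complex.exp L * Complex.exp (s * (((α - 1 : ℝ) : ℂ) * L)) := by
            rw [← Complex.exp_add]; push_cast; ring_nf
        _ = _ := by rw [hL, Complex.exp_log hw.1]
    rw [this]; ring
  have hcont : Continuous fun s : ℝ => L * Complex.exp (((1 + s * (α - 1) : ℝ) : ℂ) * L) := by
    fun_prop
  have e2 := Complex.imCLM.intervalIntegral_comp_comm (hcont.intervalIntegrable 0 1 (μ := volume))
  simp only [Complex.imCLM_apply] at e2
  rw [e, ← e2]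
  have := intervalIntegral.norm_integral_le_of_norm_le_const (a := 0) (b := 1)
    (f := fun s : ℝ => (L * Complex.exp (((1 + s * (α - 1) : ℝ) : ℂ) * L)).im)
    (C := (‖w‖ + ‖w‖ ^ α) * (-w.arg * (1 + 2 * Real.log ‖w‖))) ?_
  · simpa using this
  intro s hs
  rw [uIoc_of_le zero_le_one] at hs
  set p := 1 + s * (α - 1) with hp
  have hp0 : 0 ≤ p := by nlinarith [hs.1, hs.2, hα.1]
  have hp2 : p ≤ 2 := by nlinarith [hs.1, hs.2, hα.2]
  rw [Complex.mul_im, Complex.exp_re, Complex.exp_im, Complex.re_ofReal_mul, Complex.im_ofReal_mul,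
    hLre, hLim]
  have hexp : Real.exp (p * Real.log ‖w‖) ≤ ‖w‖ + ‖w‖ ^ α := by
    rw [mul_comm, ← Real.rpow_def_of_pos hr]
    rcases le_total α 1 with h | h
    · have : p ≤ 1 := by nlinarith [hs.1]
      have := Real.rpow_le_rpow_of_exponent_le h1 this
      rw [Real.rpow_one] at this
      linarith [Real.rpow_pos_of_pos hr α]
    · have : p ≤ α := by nlinarith [hs.2]
      have := Real.rpow_le_rpow_of_exponent_le h1 this
      linarith
  have hsin : |Real.sin (p * w.arg)| ≤ 2 * -w.arg := by
    have h2 : |p * w.arg| ≤ 2 * -w.arg := by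
      rw [abs_mul, abs_of_nonneg hp0, abs_of_nonpos harg.2]
      nlinarith [harg.2]
    exact (Real.abs_sin_le_abs).trans h2
  have hcos := Real.abs_cos_le_one (p * w.arg)
  have key : |Real.log ‖w‖ * Real.sin (p * w.arg) + w.arg * Real.cos (p * w.arg)| ≤
      -w.arg * (1 + 2 * Real.log ‖w‖) := by
    refine (abs_add_le _ _).trans ?_
    rw [abs_mul, abs_mul, abs_of_nonneg hl, abs_of_nonpos harg.2]
    nlinarith [harg.2]
  have e3 : Real.log ‖w‖ * (Real.exp (p * Real.log ‖w‖) * Real.sin (p * w.arg)) +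
      w.arg * (Real.exp (p * Real.log ‖w‖) * Real.cos (p * w.arg)) =
      Real.exp (p * Real.log ‖w‖) *
        (Real.log ‖w‖ * Real.sin (p * w.arg) + w.arg * Real.cos (p * w.arg)) := by ring
  rw [e3, Real.norm_eq_abs, abs_mul, abs_of_pos (Real.exp_pos _)]
  gcongr

lemma exists_norm_levyExp_le (K : ℝ) : ∃ C, 0 ≤ C ∧ ∀ θ, BddBy K θ → ∀ w ∈ strip,
    ‖levyExp (θ 2) (θ 3) w‖ ≤ C * (1 + ‖w‖) ^ 3 := by
  obtain ⟨C₁, h₁, H₁⟩ := exists_norm_logPow_le K 0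
  obtain ⟨C₂, h₂, H₂⟩ := exists_norm_drift_le K
  refine ⟨C₁ + C₂, by positivity, fun θ h w hw => ?_⟩
  have hIβ : ‖Complex.I * (θ 3 : ℂ)‖ ≤ 1 := by
    rw [norm_mul, Complex.norm_I, one_mul, Complex.norm_real]; exact h.skew_le
  have h2 : ‖Complex.I * (θ 3 : ℂ) * drift (θ 2) w‖ ≤ 1 * (C₂ * (1 + ‖w‖) ^ 3) := by
    rw [norm_mul]; have := (H₂ θ h w hw).1; gcongr
  have := norm_add_le_of_le (H₁ θ h w hw) h2
  rw [levyExp]; linarith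

/-- For `‖w‖ ≥ 4` one has `|arg w| ≤ 1/2`, hence `|α arg w| ≤ 1`, and the cosine of an angle of at
most 1 is at least `1/2`. -/
lemma le_re_logPow_zero {α : ℝ} (hα : α ∈ Ioc (0 : ℝ) 2) {w : ℂ} (hw : w ∈ strip) (h4 : 4 ≤ ‖w‖) :
    ‖w‖ ^ α / 2 ≤ (logPow 0 α w).re := by
  have hr : 0 < ‖w‖ := norm_pos_iff.2 hw.1
  have harg := arg_mem_of_strip hw
  have h2 := neg_arg_mul_norm_le hw
  have e : (logPow 0 α w).re = ‖w‖ ^ α * Real.cos (α * w.arg) := by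
    rw [logPow, pow_zero, one_mul, Complex.cpow_def_of_ne_zero hw.1, mul_comm, Complex.exp_re,
      Complex.re_ofReal_mul, Complex.im_ofReal_mul, Complex.log_re, Complex.log_im, mul_comm α,
      ← Real.rpow_def_of_pos hr]
  have hc : 1 / 2 ≤ Real.cos (α * w.arg) := by
    have := Real.one_sub_sq_div_two_le_cos (x := α * w.arg)
    have h5 : -w.arg ≤ 1 / 2 := by nlinarith [harg.2]
    have h6 : (α * w.arg) ^ 2 ≤ 1 := by
      rw [sq_le_one_iff_abs_le_one, abs_mul, abs_of_pos hα.1, abs_of_nonpos harg.2]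
      nlinarith [hα.1, hα.2, harg.2]
    linarith
  rw [e]
  have := Real.rpow_pos_of_pos hr α
  nlinarith

/-- The main term contributes at least `‖w‖^α / 2`, and the skewness term, whose real part is
governed by the imaginary part of `driftCore`, takes away at most `‖w‖^α / 4`. -/
lemma exists_le_re_levyExp {K : ℝ} (hK : 1 ≤ K) : ∃ R, 4 ≤ R ∧ ∀ θ, BddBy K θ → ∀ w ∈ strip,
    R ≤ ‖w‖ → ‖w‖ ^ K⁻¹ / 4 ≤ (levyExp (θ 2) (θ 3) w).re := by
  have hK0 : 0 < K := one_pos.trans_le hK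
  -- The quantity `16K(1 + 2 log r)` must stay below both `r^(1/K)` and `r`, so that each of the two
  -- error terms below is at most `P / 8`.
  have ev := ((eventually_add_mul_log_le_rpow (16 * K) (32 * K) (inv_pos.2 hK0)).and
    ((eventually_add_mul_log_le_rpow (16 * K) (32 * K) one_pos).and (eventually_ge_atTop 4)))
  obtain ⟨R, hR⟩ := eventually_atTop.1 ev
  refine ⟨max R 4, le_max_right _ _, fun θ h w hw hwR => ?_⟩
  obtain ⟨e1, e2, e4⟩ := hR ‖w‖ ((le_max_left _ _).trans hwR)
  rw [Real.rpow_one] at e2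
  have hα : θ 2 ∈ Ioc (0 : ℝ) 2 := ⟨(inv_pos.2 hK0).trans_le h.le_index, h.index_le⟩
  have hr : 0 < ‖w‖ := by linarith
  have hre := le_re_logPow_zero hα hw e4
  have him := abs_im_driftCore_zero_le (θ 2) hα hw (by linarith)
  have harg := neg_arg_mul_norm_le hw
  have hle : ‖w‖ ^ K⁻¹ ≤ ‖w‖ ^ (θ 2) := Real.rpow_le_rpow_of_exponent_le (by linarith) h.le_index
  have hl : 0 ≤ Real.log ‖w‖ := Real.log_nonneg (by linarith)
  set r := ‖w‖
  set P := r ^ (θ 2)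
  set l := Real.log r
  have hP : 0 < P := Real.rpow_pos_of_pos hr _
  have hre2 : (Complex.I * (θ 3 : ℂ) * drift (θ 2) w).re =
      -(θ 3 * kappaD 0 (θ 2) * (driftCore 0 (θ 2) w).im) := by
    rw [drift]; simp; ring
  have hb : |θ 3 * kappaD 0 (θ 2)| ≤ K := by
    rw [abs_mul]
    have := mul_le_mul h.skew_le h.kappa_le (abs_nonneg _) zero_le_one
    linarith
  have harg' : -w.arg ≤ 2 / r := by rwa [le_div_iff₀ hr]
  have him2 : |θ 3 * kappaD 0 (θ 2) * (driftCore 0 (θ 2) w).im| ≤ P / 4 := by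
    rw [abs_mul]
    calc _ ≤ K * ((r + P) * (2 / r * (1 + 2 * l))) := by
          have h0 : 0 ≤ -w.arg := neg_nonneg.2 (arg_mem_of_strip hw).2
          refine mul_le_mul hb (him.trans ?_) (abs_nonneg _) hK0.le
          gcongr
      _ = 2 * (K * (1 + 2 * l)) + 2 * P * (K * (1 + 2 * l)) / r := by field_simp
      _ ≤ 2 * (P / 16) + 2 * P * (r / 16) / r := by
          gcongr
          · linarith
          · linarith
      _ = P / 4 := by field_simp; norm_num
  have := (abs_le.1 him2).2
  rw [levyExp, Complex.add_re, hre2]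
  linarith

/-- Far out, `exp (-‖w‖^(1/K) / 4)` beats every power of `‖w‖`; on the remaining bounded part of the
strip the crude norm bound on `levyExp` is enough. -/
lemma exists_exp_neg_levyExp_le (K : ℝ) (n : ℕ) : ∃ C, 0 ≤ C ∧ ∀ θ, BddBy K θ → ∀ w ∈ strip,
    Real.exp (-(levyExp (θ 2) (θ 3) w).re) * (1 + ‖w‖) ^ n ≤ C := by
  by_cases hK : 1 ≤ K
  swap
  · exact ⟨0, le_rfl, fun θ h => absurd h.one_le hK⟩
  have hK0 : 0 < K := one_pos.trans_le hK
  obtain ⟨R, h4, hR⟩ := exists_le_re_levyExp hK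
  obtain ⟨C₁, h₁, H₁⟩ := exists_norm_levyExp_le K
  -- Since `(1 + r)^n ≤ (2r)^n`, the exponent `n (log 2 + log r)` has to be at most `r^(1/K) / 4`.
  obtain ⟨R', hR'⟩ := eventually_atTop.1
    (eventually_add_mul_log_le_rpow (4 * n * Real.log 2) (4 * n) (inv_pos.2 hK0))
  set M := max R R'
  have hM : 4 ≤ M := h4.trans (le_max_left _ _)
  refine ⟨1 + Real.exp (C₁ * (1 + M) ^ 3) * (1 + M) ^ n, by positivity, fun θ h w hw => ?_⟩
  have hr : 0 < ‖w‖ := norm_pos_iff.2 hw.1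
  rcases le_total ‖w‖ M with hw' | hw'
  · have h1 : -(levyExp (θ 2) (θ 3) w).re ≤ C₁ * (1 + M) ^ 3 := by
      have a := (abs_le.1 (Complex.abs_re_le_norm (levyExp (θ 2) (θ 3) w))).1
      have b := H₁ θ h w hw
      have : C₁ * (1 + ‖w‖) ^ 3 ≤ C₁ * (1 + M) ^ 3 := by gcongr
      linarith
    have : Real.exp (-(levyExp (θ 2) (θ 3) w).re) * (1 + ‖w‖) ^ n ≤
      Real.exp (C₁ * (1 + M) ^ 3) * (1 + M) ^ n := by gcongr
    linarith
  · have a := hR θ h w hw ((le_max_left _ _).trans hw')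
    have b := hR' ‖w‖ ((le_max_right _ _).trans hw')
    have hp : (1 + ‖w‖) ^ n ≤ Real.exp (n * (Real.log 2 + Real.log ‖w‖)) := by
      rw [← Real.log_mul two_ne_zero hr.ne', mul_comm, ← Real.rpow_def_of_pos (by positivity),
        Real.rpow_natCast]
      gcongr
      linarith
    have : Real.exp (-(levyExp (θ 2) (θ 3) w).re) * (1 + ‖w‖) ^ n ≤ 1 := by
      calc _ ≤ Real.exp (-(levyExp (θ 2) (θ 3) w).re) *
            Real.exp (n * (Real.log 2 + Real.log ‖w‖)) := by gcongr
        _ = Real.exp (-(levyExp (θ 2) (θ 3) w).re + n * (Real.log 2 + Real.log ‖w‖)) := by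
          rw [Real.exp_add]
        _ ≤ 1 := Real.exp_le_one_iff.2 (by nlinarith)
    have : 0 ≤ Real.exp (C₁ * (1 + M) ^ 3) * (1 + M) ^ n := by positivity
    linarith

lemma phase_eq_levyExp (w : ℂ) (x : ℝ) (θ : Param) : phase w x θ =
    -(Real.log (θ 1) : ℝ) - Complex.I * w * (((x - θ 0) / θ 1 : ℝ) : ℂ)
      - levyExp (θ 2) (θ 3) w := by
  rw [phase, levyExp]; ring

/-- The modulus depends on `x` only through `exp (Im w * (x - μ)/σ)`, which is the reason for moving
the contour into the lower half plane. -/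
lemma norm_exp_phase {θ : Param} (h : 0 < θ 1) (w : ℂ) (x : ℝ) :
    ‖Complex.exp (phase w x θ)‖ = (θ 1)⁻¹ * Real.exp (w.im * ((x - θ 0) / θ 1)) *
      Real.exp (-(levyExp (θ 2) (θ 3) w).re) := by
  rw [Complex.norm_exp, phase_eq_levyExp, Complex.sub_re, Complex.sub_re, Complex.re_mul_ofReal,
    sub_eq_add_neg, sub_eq_add_neg, Real.exp_add, Real.exp_add]
  congr 2
  · rw [← Complex.ofReal_neg, Complex.ofReal_re, Real.exp_neg, Real.exp_log h]
  · simp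

/-- Bound for `exp phase` on the strip, with arbitrary polynomial decay. -/
lemma exists_norm_exp_phase_le (K : ℝ) (n : ℕ) : ∃ C, 0 ≤ C ∧ ∀ θ, BddBy K θ → ∀ w ∈ strip, ∀ x,
    ‖Complex.exp (phase w x θ)‖ * (1 + ‖w‖) ^ n ≤ C * Real.exp (w.im * ((x - θ 0) / θ 1)) := by
  by_cases hK : 1 ≤ K
  swap
  · exact ⟨0, le_rfl, fun θ h => absurd h.one_le hK⟩
  have hK0 : 0 < K := one_pos.trans_le hK
  obtain ⟨C, h0, hC⟩ := exists_exp_neg_levyExp_le K n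
  refine ⟨K * C, by positivity, fun θ h w hw x => ?_⟩
  rw [norm_exp_phase h.scale_pos]
  have h1 := hC θ h w hw
  have h2 := h.inv_scale_le
  calc _ = (θ 1)⁻¹ * (Real.exp (-(levyExp (θ 2) (θ 3) w).re) * (1 + ‖w‖) ^ n) *
        Real.exp (w.im * ((x - θ 0) / θ 1)) := by ring
    _ ≤ K * C * Real.exp (w.im * ((x - θ 0) / θ 1)) := by gcongr

lemma weight_le (i : Fin 4) {r y : ℝ} (hr : 0 ≤ r) (hy : 0 ≤ y) :
    weight i r y ≤ (1 + r) * (1 + y) := by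
  have := mul_nonneg hr hy
  fin_cases i <;> simp [weight] <;> nlinarith

lemma norm_add_mul_le_weight {a b c : ℂ} {C₁ C₂ P r y : ℝ} {i j : Fin 4} (hr : 0 ≤ r) (hy : 0 ≤ y)
    (h1 : 0 ≤ C₁) (hP : 1 ≤ P)
    (h2 : 0 ≤ C₂) (ha : ‖a‖ ≤ C₂ * P * (weight i r y * weight j r y))
    (hb : ‖b‖ ≤ C₁ * P * weight i r y) (hc : ‖c‖ ≤ C₁ * P * weight j r y) :
    ‖a + b * c‖ ≤ (C₂ + C₁ ^ 2) * P ^ 2 * (weight i r y * weight j r y) := by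
  have wi := weight_nonneg i hr hy
  have wj := weight_nonneg j hr hy
  have hbc : ‖b * c‖ ≤ C₁ * P * weight i r y * (C₁ * P * weight j r y) := by
    rw [norm_mul]; gcongr
  have hPP : P ≤ P ^ 2 := by nlinarith
  calc _ ≤ C₂ * P * (weight i r y * weight j r y) +
        C₁ * P * weight i r y * (C₁ * P * weight j r y) := norm_add_le_of_le ha hbc
    _ ≤ C₂ * P ^ 2 * (weight i r y * weight j r y) +
        C₁ * P * weight i r y * (C₁ * P * weight j r y) := by gcongr
    _ = _ := by ring

/-- Bounds for `exp phase` and its first two derivatives in the parameters on the strip. -/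
lemma exists_norm_kern_le (K : ℝ) : ∃ C, 0 ≤ C ∧ ∀ θ, BddBy K θ → ∀ w ∈ strip, ∀ x,
    ‖Complex.exp (phase w x θ)‖ ≤
      C * (1 + |x - θ 0|) ^ 2 * Real.exp (w.im * ((x - θ 0) / θ 1)) * ((1 + ‖w‖) ^ 2)⁻¹ ∧
    (∀ i, ‖kern1 i w x θ‖ ≤
      C * (1 + |x - θ 0|) ^ 2 * Real.exp (w.im * ((x - θ 0) / θ 1)) * ((1 + ‖w‖) ^ 2)⁻¹) ∧
    ∀ i j, ‖kern2 i j w x θ‖ ≤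
      C * (1 + |x - θ 0|) ^ 2 * Real.exp (w.im * ((x - θ 0) / θ 1)) * ((1 + ‖w‖) ^ 2)⁻¹ := by
  obtain ⟨C₁, h₁, H₁⟩ := exists_norm_phase1_le K
  obtain ⟨C₂, h₂, H₂⟩ := exists_norm_phase2_le K
  -- The factor in front of the exponential in `kern2` grows like `(1 + r)^8`: six powers from two
  -- cubic bounds and two from the weights. Ten powers of decay leave an integrable `(1 + r)^(-2)`.
  obtain ⟨C, h0, hC⟩ := exists_norm_exp_phase_le K 10
  refine ⟨(1 + C₁ + (C₂ + C₁ ^ 2)) * C, by positivity, fun θ h w hw x => ?_⟩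
  have hk := hC θ h w hw x
  set k := ‖Complex.exp (phase w x θ)‖
  have hk0 : 0 ≤ k := norm_nonneg _
  set r := ‖w‖
  have hr : 0 ≤ r := norm_nonneg _
  set y := |x - θ 0|
  have hy : 0 ≤ y := abs_nonneg _
  set E := Real.exp (w.im * ((x - θ 0) / θ 1))
  have hE : 0 < E := Real.exp_pos _
  have hPn : ∀ n, 1 ≤ (1 + r) ^ n := fun n => one_le_pow₀ (by linarith)
  have hY : 1 + y ≤ (1 + y) ^ 2 := by nlinarith
  have hY1 : 1 ≤ (1 + y) ^ 2 := by nlinarith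
  have main : ∀ (q : ℂ) (c : ℝ), 0 ≤ c → c ≤ 1 + C₁ + (C₂ + C₁ ^ 2) →
      ‖q‖ ≤ c * (1 + r) ^ 8 * (1 + y) ^ 2 →
      ‖q‖ * k ≤ (1 + C₁ + (C₂ + C₁ ^ 2)) * C * (1 + y) ^ 2 * E * ((1 + r) ^ 2)⁻¹ := by
    intro q c hc hc' hq
    rw [← div_eq_mul_inv, le_div_iff₀ (by positivity)]
    calc ‖q‖ * k * (1 + r) ^ 2 ≤ c * (1 + r) ^ 8 * (1 + y) ^ 2 * k * (1 + r) ^ 2 := by gcongr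
      _ = c * (1 + y) ^ 2 * (k * (1 + r) ^ 10) := by ring
      _ ≤ (1 + C₁ + (C₂ + C₁ ^ 2)) * (1 + y) ^ 2 * (C * E) := by gcongr
      _ = _ := by ring
  refine ⟨?_, fun i => ?_, fun i j => ?_⟩
  · have := main 1 1 zero_le_one (by nlinarith [sq_nonneg C₁]) (by
      rw [norm_one]; nlinarith [hPn 8])
    simpa using this
  · rw [kern1, norm_mul]
    refine main _ C₁ h₁ (by nlinarith [sq_nonneg C₁]) ((H₁ θ h w hw x i).trans ?_)
    calc C₁ * (1 + r) ^ 3 * weight i r y ≤ C₁ * (1 + r) ^ 3 * ((1 + r) * (1 + y)) := by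
          gcongr; exact weight_le i hr hy
      _ = C₁ * (1 + r) ^ 4 * (1 + y) := by ring
      _ ≤ C₁ * (1 + r) ^ 8 * (1 + y) ^ 2 := by
          gcongr
          · linarith
          · norm_num
  · rw [kern2, norm_mul]
    refine main _ (C₂ + C₁ ^ 2) (by positivity) (by linarith) ?_
    refine (norm_add_mul_le_weight hr hy h₁ (hPn 3) h₂ (H₂ θ h w hw x i j) (H₁ θ h w hw x i)
      (H₁ θ h w hw x j)).trans ?_
    have wi := weight_le i hr hy
    have wj := weight_le j hr hy
    have wi0 := weight_nonneg i hr hy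
    have wj0 := weight_nonneg j hr hy
    calc _ ≤ (C₂ + C₁ ^ 2) * ((1 + r) ^ 3) ^ 2 * (((1 + r) * (1 + y)) * ((1 + r) * (1 + y))) := by
          gcongr
      _ = _ := by ring

end StableM0

/-! ### Deformation of the integration contour -/

namespace StableM0
open MeasureTheory Filter Topology Set

lemma strip_mem_slitPlane {w : ℂ} (hw : w ∈ strip) : w ∈ Complex.slitPlane := by
  rw [Complex.mem_slitPlane_iff]
  by_contra! h
  exact hw.1 (Complex.ext (le_antisymm h.1 hw.2.1) h.2)

lemma differentiableAt_exp_phase {w : ℂ} (hw : w ∈ Complex.slitPlane) (x : ℝ) (θ : Param) :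
    DifferentiableAt ℂ (fun w => Complex.exp (phase w x θ)) w := by
  have hl : DifferentiableAt ℂ Complex.log w := Complex.differentiableAt_log hw
  have hp : DifferentiableAt ℂ (fun w : ℂ => w ^ ((θ 2 : ℝ) : ℂ)) w :=
    differentiableAt_id.cpow_const hw
  have he : DifferentiableAt ℂ (fun w => expMoment 0 (((θ 2 - 1 : ℝ) : ℂ) * Complex.log w)) w :=
    (hasDerivAt_expMoment 0 _).differentiableAt.comp w (hl.const_mul _)
  simp only [phase, logPow, drift, driftCore]
  fun_prop

/-- A power `‖w‖^a` with `a = min α 1 / 2` is spent on the logarithm, and the remaining exponents `1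
- a` and `α - a` are positive. -/
lemma tendsto_driftCore_zero {α : ℝ} (h : α ∈ Ioo (0 : ℝ) 2) :
    Tendsto (driftCore 0 α) (𝓝[strip] 0) (𝓝 0) := by
  set a := min α 1 / 2 with ha
  have ha0 : 0 < a := half_pos (lt_min h.1 one_pos)
  obtain ⟨C, hC0, hC⟩ := rpow_mul_abs_log_le ha0 1
  have hb : ∀ w ∈ strip, ‖driftCore 0 α w‖ ≤
      C * (1 + ‖w‖) ^ 3 * (‖w‖ ^ (1 - a) + ‖w‖ ^ (α - a)) := by
    intro w hw
    have hr : 0 < ‖w‖ := norm_pos_iff.2 hw.1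
    have h1 := norm_driftCore_le 0 α w
    have h2 := hC ‖w‖ hr a le_rfl (by linarith [min_le_right α 1])
    have h3 := norm_log_le hw
    simp only [zero_add, pow_one] at h1 h2
    rw [Real.rpow_sub hr, Real.rpow_sub hr, Real.rpow_one]
    have hra := Real.rpow_pos_of_pos hr a
    have hrα := Real.rpow_pos_of_pos hr α
    calc _ ≤ (|Real.log ‖w‖| + 2) * (‖w‖ + ‖w‖ ^ α) := h1.trans (by gcongr)
      _ = (‖w‖ ^ a * (|Real.log ‖w‖| + 2)) * (‖w‖ / ‖w‖ ^ a + ‖w‖ ^ α / ‖w‖ ^ a) := by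
        field_simp
      _ ≤ _ := by gcongr
  have h1a : 0 < 1 - a := by linarith [min_le_right α 1]
  have hαa : 0 < α - a := by linarith [min_le_left α 1, h.1]
  have ht : Tendsto (fun w : ℂ => C * (1 + ‖w‖) ^ 3 * (‖w‖ ^ (1 - a) + ‖w‖ ^ (α - a))) (𝓝[strip] 0)
      (𝓝 0) := by
    have : Continuous fun w : ℂ => C * (1 + ‖w‖) ^ 3 * (‖w‖ ^ (1 - a) + ‖w‖ ^ (α - a)) := by
      have c1 : Continuous fun w : ℂ => ‖w‖ ^ (1 - a) :=
        continuous_norm.rpow_const fun _ => Or.inr h1a.le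
      have c2 : Continuous fun w : ℂ => ‖w‖ ^ (α - a) :=
        continuous_norm.rpow_const fun _ => Or.inr hαa.le
      fun_prop
    have h0 := this.tendsto 0
    simp only [norm_zero, Real.zero_rpow h1a.ne', Real.zero_rpow hαa.ne', add_zero, mul_zero] at h0
    exact h0.mono_left nhdsWithin_le_nhds
  exact squeeze_zero_norm' (eventually_mem_nhdsWithin.mono hb) ht

/-- The origin is both a branch point and a corner of the contour. Continuity there suffices, since
Cauchy's theorem for rectangles asks for holomorphy only in the open rectangle. -/
lemma continuousOn_exp_phase {θ : Param} (h : θ ∈ openParams) (x : ℝ) :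
    ContinuousOn (fun w => Complex.exp (phase w x θ)) (insert 0 strip) := by
  intro w hw
  rcases hw with rfl | hw
  · have h0 : ContinuousWithinAt (driftCore 0 (θ 2)) (insert 0 strip) 0 := by
      rw [continuousWithinAt_insert_self, ContinuousWithinAt]
      convert tendsto_driftCore_zero h.2.1 using 2
      simp [driftCore]
    have h1 : ContinuousAt (logPow 0 (θ 2)) 0 := by
      have : ContinuousAt (fun w : ℂ => w ^ ((θ 2 : ℝ) : ℂ)) 0 :=
        (Complex.continuousAt_cpow_zero_of_re_pos (z := (θ 2 : ℂ)) (by simpa using h.2.1.1)).comp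
          (f := fun w : ℂ => (w, ((θ 2 : ℝ) : ℂ))) (by fun_prop)
      have e : logPow 0 (θ 2) = fun w => w ^ ((θ 2 : ℝ) : ℂ) := by ext w; simp [logPow]
      rwa [e]
    have h2 : ContinuousWithinAt (drift (θ 2)) (insert 0 strip) 0 :=
      continuousWithinAt_const.mul h0
    simp only [phase]
    exact (((by fun_prop : ContinuousAt (fun w : ℂ => -((Real.log (θ 1) : ℝ) : ℂ) -
      Complex.I * w * (((x - θ 0) / θ 1 : ℝ) : ℂ)) 0).continuousWithinAt.sub
      h1.continuousWithinAt).sub (continuousWithinAt_const.mul h2)).cexp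
  · exact (differentiableAt_exp_phase (strip_mem_slitPlane hw) x θ).continuousAt.continuousWithinAt

lemma mem_strip_of_pos_re {t y : ℝ} (ht : 0 < t) (hy : y ∈ Icc (-1 : ℝ) 0) :
    (t : ℂ) + y * Complex.I ∈ strip := by
  refine ⟨fun h => ?_, by simpa using ht.le, by simpa using hy⟩
  have := congrArg Complex.re h
  simp at this
  exact ht.ne' this

/-- For fixed parameters, `exp phase` decays quadratically on the strip. -/
lemma exists_norm_exp_phase_le_inv_sq {θ : Param} (h : θ ∈ openParams) (x : ℝ) :
    ∃ C, 0 ≤ C ∧ ∀ w ∈ strip, ‖Complex.exp (phase w x θ)‖ ≤ C * ((1 + ‖w‖) ^ 2)⁻¹ := by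
  obtain ⟨K, hK⟩ := exists_eventually_bddBy h
  obtain ⟨C, h0, hC⟩ := exists_norm_kern_le K
  refine ⟨C * (1 + |x - θ 0|) ^ 2 * Real.exp |(x - θ 0) / θ 1|, by positivity, fun w hw => ?_⟩
  refine ((hC θ hK.self_of_nhds w hw x).1).trans ?_
  gcongr
  refine (le_abs_self _).trans ?_
  rw [abs_mul]
  have : |w.im| ≤ 1 := abs_le.2 ⟨hw.2.2.1, hw.2.2.2.trans zero_le_one⟩
  exact mul_le_of_le_one_left (abs_nonneg _) this

lemma one_add_sq_le {r t : ℝ} (ht : 0 ≤ t) (h : t ≤ r) : 1 + t ^ 2 ≤ (1 + r) ^ 2 := by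
  nlinarith

lemma integrableOn_exp_phase_line {θ : Param} (h : θ ∈ openParams) (x : ℝ) {y : ℝ}
    (hy : y ∈ Icc (-1 : ℝ) 0) :
    IntegrableOn (fun t : ℝ => Complex.exp (phase (t + y * Complex.I) x θ)) (Ioi 0) := by
  obtain ⟨C, h0, hC⟩ := exists_norm_exp_phase_le_inv_sq h x
  refine Integrable.mono' ((integrable_inv_one_add_sq.const_mul C).integrableOn) ?_ ?_
  · exact ((measurable_kern x θ).comp (by fun_prop :
      Measurable fun t : ℝ => (t : ℂ) + y * Complex.I)).aestronglyMeasurable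
  · refine (ae_restrict_iff' measurableSet_Ioi).2 (Eventually.of_forall fun t ht => ?_)
    refine (hC _ (mem_strip_of_pos_re ht hy)).trans ?_
    gcongr
    refine one_add_sq_le (le_of_lt ht) ?_
    have := Complex.abs_re_le_norm ((t : ℂ) + y * Complex.I)
    simp only [Complex.add_re, Complex.ofReal_re, Complex.re_ofReal_mul, Complex.I_re, mul_zero,
      add_zero] at this
    exact (le_abs_self t).trans this

/-- Cauchy's theorem on the rectangle with sides `[0, R]` and `[-1, 0]`; the right side tends to
zero by the quadratic decay on the strip. -/
lemma integral_exp_phase_contour {θ : Param} (h : θ ∈ openParams) (x : ℝ) :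
    ∫ t in Ioi (0 : ℝ), Complex.exp (phase t x θ) =
      (∫ t in Ioi (0 : ℝ), Complex.exp (phase (t + (-1 : ℝ) * Complex.I) x θ)) +
        ∫ s in (0 : ℝ)..1, -Complex.I * Complex.exp (phase (-Complex.I * s) x θ) := by
  obtain ⟨C, hC0, hC⟩ := exists_norm_exp_phase_le_inv_sq h x
  set F : ℂ → ℂ := fun w => Complex.exp (phase w x θ) with hF
  have i0 := integrableOn_exp_phase_line h x (y := 0) ⟨by norm_num, le_rfl⟩
  have i1 := integrableOn_exp_phase_line h x (y := -1) ⟨le_rfl, by norm_num⟩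
  simp only [Complex.ofReal_zero, zero_mul, add_zero] at i0
  have t0 := intervalIntegral_tendsto_integral_Ioi 0 i0 tendsto_id
  have t1 := intervalIntegral_tendsto_integral_Ioi 0 i1 tendsto_id
  have t2 : Tendsto (fun R : ℝ => ∫ y in (-1 : ℝ)..0, F (R + y * Complex.I)) atTop (𝓝 0) := by
    have hb : Tendsto (fun R : ℝ => C * (1 + R ^ 2)⁻¹) atTop (𝓝 0) := by
      have : Tendsto (fun R : ℝ => 1 + R ^ 2) atTop atTop :=
        tendsto_atTop_add_const_left _ _ (tendsto_pow_atTop two_ne_zero)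
      simpa using this.inv_tendsto_atTop.const_mul C
    refine squeeze_zero_norm' ?_ hb
    filter_upwards [eventually_gt_atTop 0] with R hR
    have := intervalIntegral.norm_integral_le_of_norm_le_const (a := -1) (b := 0)
      (f := fun y : ℝ => F (R + y * Complex.I)) (C := C * (1 + R ^ 2)⁻¹) ?_
    · simpa using this
    intro y hy
    rw [uIoc_of_le (by norm_num)] at hy
    refine (hC _ (mem_strip_of_pos_re hR ⟨hy.1.le, hy.2⟩)).trans ?_
    gcongr
    refine one_add_sq_le hR.le ?_
    have := Complex.abs_re_le_norm ((R : ℂ) + y * Complex.I)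
    simp only [Complex.add_re, Complex.ofReal_re, Complex.re_ofReal_mul, Complex.I_re, mul_zero,
      add_zero] at this
    exact (le_abs_self R).trans this
  have t3 : ∫ y in (-1 : ℝ)..0, F (((0 : ℝ) : ℂ) + y * Complex.I) =
      ∫ s in (0 : ℝ)..1, F (-Complex.I * s) := by
    have := intervalIntegral.integral_comp_neg (a := 0) (b := 1)
      (fun y : ℝ => F (((0 : ℝ) : ℂ) + y * Complex.I))
    rw [neg_zero] at this
    rw [← this]
    congr 1
    ext s
    push_cast
    ring_nf
  have key : ∀ᶠ R : ℝ in atTop, (∫ t in (0 : ℝ)..R, F t) =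
      (∫ t in (0 : ℝ)..R, F (t + (-1 : ℝ) * Complex.I)) +
        Complex.I * (∫ y in (-1 : ℝ)..0, F (R + y * Complex.I)) -
        Complex.I * ∫ s in (0 : ℝ)..1, F (-Complex.I * s) := by
    filter_upwards [eventually_gt_atTop 0] with R hR
    have := Complex.integral_boundary_rect_eq_zero_of_continuousOn_of_differentiableOn F
      (((0 : ℝ) : ℂ) + (-1 : ℝ) * Complex.I) ((R : ℂ) + (0 : ℝ) * Complex.I) ?_ ?_
    · have s1 : (((0 : ℝ) : ℂ) + (-1 : ℝ) * Complex.I).re = 0 := by simp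
      have s2 : (((0 : ℝ) : ℂ) + (-1 : ℝ) * Complex.I).im = -1 := by simp
      have s3 : ((R : ℂ) + (0 : ℝ) * Complex.I).re = R := by simp
      have s4 : ((R : ℂ) + (0 : ℝ) * Complex.I).im = 0 := by simp
      rw [s1, s2, s3, s4, t3] at this
      simp only [smul_eq_mul, Complex.ofReal_zero, zero_mul, add_zero] at this
      linear_combination -this
    · refine (continuousOn_exp_phase h x).mono fun w hw => ?_
      rw [Complex.mem_reProdIm] at hw
      simp only [Complex.add_re, Complex.ofReal_re, Complex.re_ofReal_mul, Complex.I_re, mul_zero,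
        add_zero, Complex.add_im, Complex.ofReal_im, Complex.im_ofReal_mul, Complex.I_im, mul_one,
        zero_add, uIcc_of_le hR.le, uIcc_of_le (by norm_num : (-1 : ℝ) ≤ 0)] at hw
      by_cases hw0 : w = 0
      · exact Or.inl hw0
      · exact Or.inr ⟨hw0, hw.1.1, hw.2⟩
    · intro w hw
      rw [Complex.mem_reProdIm] at hw
      simp only [Complex.add_re, Complex.ofReal_re, Complex.re_ofReal_mul, Complex.I_re, mul_zero,
        add_zero, min_eq_left hR.le] at hw
      exact (differentiableAt_exp_phase (Or.inl hw.1.1) x θ).differentiableWithinAt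
  have lim := (t1.add (t2.const_mul Complex.I)).sub_const
    (Complex.I * ∫ s in (0 : ℝ)..1, F (-Complex.I * s))
  have := tendsto_nhds_unique (t0.congr' key) lim
  rw [intervalIntegral.integral_const_mul, this]
  ring

end StableM0

/-! ### The density as a contour integral, and its parameter derivatives -/

namespace StableM0
open MeasureTheory Filter Topology Set
open scoped ComplexConjugate

/-- The integrand `exp (-itx) * φ_θ(t)` of the inversion formula. -/
noncomputable def invKernel (x : ℝ) (θ : Param) (t : ℝ) : ℂ :=
  Complex.exp (-(Complex.I * ((t * x : ℝ) : ℂ))) * charFn (θ 0) (θ 1) (θ 2) (θ 3) t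

lemma density_eq (x : ℝ) (θ : Param) :
    density x θ = (2 * Real.pi)⁻¹ * (∫ t, invKernel x θ t).re := by
  rw [density, Complex.re_ofReal_mul]; rfl

lemma charFn_neg (μ σ α β t : ℝ) : charFn μ σ α β (-t) = conj (charFn μ σ α β t) := by
  unfold charFn
  split_ifs with h
  · rw [← Complex.exp_conj]
    congr 1
    simp only [mul_neg, abs_neg, map_add, map_sub, map_neg, map_mul, Complex.conj_ofReal,
      Complex.conj_I]
    push_cast; ring
  · rw [← Complex.exp_conj]
    congr 1
    simp only [mul_neg, abs_neg, map_add, map_neg, map_mul, map_one, Complex.conj_ofReal,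
      Complex.conj_I, Real.sign_neg]
    push_cast; ring

lemma invKernel_neg (x : ℝ) (θ : Param) (t : ℝ) : invKernel x θ (-t) = conj (invKernel x θ t) := by
  rw [invKernel, invKernel, charFn_neg, map_mul, ← Complex.exp_conj]
  congr 2
  simp

lemma charFn_of_pos {μ σ α β t : ℝ} (hσ : 0 < σ) (hα : 0 < α) (ht : 0 < t) :
    charFn μ σ α β t = Complex.exp (-levyExp α β ((σ * t : ℝ) : ℂ) + Complex.I * ((μ * t : ℝ) : ℂ)) := by
  have hst : 0 < σ * t := mul_pos hσ ht
  have hw : ((σ * t : ℝ) : ℂ) ≠ 0 := by exact_mod_cast hst.ne'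
  have hpw : ((σ * t : ℝ) : ℂ) ^ (α : ℂ) = (((σ * t) ^ α : ℝ) : ℂ) :=
    (Complex.ofReal_cpow hst.le α).symm
  unfold charFn levyExp
  split_ifs with h
  · subst h
    rw [drift_one, logPow, pow_zero, one_mul, ← Complex.ofReal_log hst.le, hpw, Real.rpow_one,
      abs_of_pos hst]
    congr 1
    push_cast; ring
  · rw [drift_of_ne h hα.ne', logPow, pow_zero, one_mul, hpw, abs_of_pos hst, Real.sign_of_pos ht,
      Real.rpow_sub hst, Real.rpow_one]
    congr 1
    have := (Real.rpow_pos_of_pos hst α).ne'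
    have h3 : (((σ * t) ^ α : ℝ) : ℂ) ≠ 0 := by exact_mod_cast this
    push_cast at h3 ⊢
    field_simp

lemma invKernel_of_pos {θ : Param} (h : θ ∈ openParams) (x : ℝ) {t : ℝ} (ht : 0 < t) :
    invKernel x θ t = θ 1 * Complex.exp (phase ((θ 1 * t : ℝ) : ℂ) x θ) := by
  have h1 := h.1
  have h1' : (θ 1 : ℂ) ≠ 0 := by exact_mod_cast h1.ne'
  rw [invKernel, charFn_of_pos h1 h.2.1.1 ht, phase_eq_levyExp, ← Complex.exp_add]
  have : (θ 1 : ℂ) = Complex.exp (Real.log (θ 1) : ℝ) := by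
    rw [← Complex.ofReal_exp, Real.exp_log h1]
  rw [this]
  rw [← Complex.exp_add]
  congr 1
  push_cast
  field_simp
  ring

lemma integrable_invKernel {θ : Param} (h : θ ∈ openParams) (x : ℝ) :
    Integrable (invKernel x θ) := by
  have h1 := h.1
  have i0 := integrableOn_exp_phase_line h x (y := 0) ⟨by norm_num, le_rfl⟩
  simp only [Complex.ofReal_zero, zero_mul, add_zero] at i0
  have i1 : IntegrableOn (invKernel x θ) (Ioi 0) := by
    have := (integrableOn_Ioi_comp_mul_left_iff (fun t : ℝ => Complex.exp (phase t x θ)) 0 h1).2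
      (by rwa [mul_zero])
    have h2 : IntegrableOn (fun t : ℝ => (θ 1 : ℂ) * Complex.exp (phase ((θ 1 * t : ℝ) : ℂ) x θ))
      (Ioi 0) := this.const_mul (θ 1 : ℂ)
    exact h2.congr_fun (fun t ht => (invKernel_of_pos h x ht).symm)
      measurableSet_Ioi
  have i2 : IntegrableOn (invKernel x θ) (Iio 0) := by
    have h3 : IntegrableOn (fun t => conj (invKernel x θ t)) (Ioi 0) :=
      (Complex.conjCLE.integrable_comp_iff (φ := invKernel x θ)).2 i1
    have h4 : IntegrableOn (fun t => invKernel x θ (-t)) (Ioi 0) :=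
      h3.congr_fun (fun t _ => (invKernel_neg x θ t).symm) measurableSet_Ioi
    have := h4.comp_neg
    simpa using this
  have h5 : IntegrableOn (invKernel x θ) (Iic 0) := (integrableOn_Iic_iff_integrableOn_Iio (by simp)).2 i2
  rw [← integrableOn_univ, ← Iic_union_Ioi (a := (0 : ℝ))]
  exact h5.union i1

/-- Hermitian symmetry makes the full integral twice the real part of the half-line integral, and
the substitution `w = σ t` absorbs the factor `σ` of `invKernel_of_pos`. -/
lemma density_eq_half_line {θ : Param} (h : θ ∈ openParams) (x : ℝ) :
    density x θ = Real.pi⁻¹ * (∫ t in Ioi (0 : ℝ), Complex.exp (phase t x θ)).re := by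
  have hi := integrable_invKernel h x
  have e1 : ∫ t in Ioi (0 : ℝ), invKernel x θ t = ∫ t in Ioi (0 : ℝ), Complex.exp (phase t x θ) := by
    have := integral_comp_mul_left_Ioi (fun t : ℝ => Complex.exp (phase t x θ)) 0 h.1
    rw [mul_zero] at this
    rw [setIntegral_congr_fun measurableSet_Ioi (fun t ht => invKernel_of_pos h x ht),
      integral_const_mul, this, Complex.real_smul]
    have h1' : (θ 1 : ℂ) ≠ 0 := by exact_mod_cast h.1.ne'
    push_cast
    field_simp
  have e2 : ∫ t in Iic (0 : ℝ), invKernel x θ t = conj (∫ t in Ioi (0 : ℝ), invKernel x θ t) := by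
    rw [← integral_conj, ← neg_zero, ← integral_comp_neg_Ioi, neg_zero]
    exact setIntegral_congr_fun measurableSet_Ioi fun t _ => invKernel_neg x θ t
  rw [density_eq, ← intervalIntegral.integral_Iic_add_Ioi (b := 0) hi.integrableOn hi.integrableOn,
    e2, e1]
  simp only [Complex.add_re, Complex.conj_re]
  field_simp
  ring

/-- The deformed contour: down the imaginary axis to `-i`, then horizontally to the right. -/
noncomputable def pathPt (τ : ℝ) : ℂ :=
  if τ ≤ 1 then -Complex.I * τ else ((τ - 1 : ℝ) : ℂ) + (-1 : ℝ) * Complex.I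

/-- The tangent vector of the deformed contour. -/
noncomputable def pathDir (τ : ℝ) : ℂ := if τ ≤ 1 then -Complex.I else 1

lemma measurable_pathPt : Measurable pathPt :=
  Measurable.ite measurableSet_Iic (by fun_prop) (by fun_prop)

lemma measurable_pathDir : Measurable pathDir :=
  Measurable.ite measurableSet_Iic measurable_const measurable_const

lemma norm_pathDir (τ : ℝ) : ‖pathDir τ‖ = 1 := by
  unfold pathDir; split_ifs <;> simp

lemma pathPt_mem_strip {τ : ℝ} (h : 0 < τ) : pathPt τ ∈ strip := by
  unfold pathPt
  split_ifs with h1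
  · refine ⟨?_, by simp, by simpa using h1, by simpa using h.le⟩
    simp [h.ne']
  · exact mem_strip_of_pos_re (by linarith) ⟨le_rfl, by norm_num⟩

lemma inv_one_add_norm_pathPt_sq_le {τ : ℝ} (h : 0 < τ) :
    ((1 + ‖pathPt τ‖) ^ 2)⁻¹ ≤ 2 * (1 + τ ^ 2)⁻¹ := by
  have h0 := norm_nonneg (pathPt τ)
  have key : 1 + τ ^ 2 ≤ 2 * (1 + ‖pathPt τ‖) ^ 2 := by
    rcases le_or_gt τ 1 with h1 | h1
    · nlinarith
    · have : τ - 1 ≤ ‖pathPt τ‖ := by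
        rw [pathPt, if_neg h1.not_ge]
        refine le_trans ?_ (Complex.re_le_norm _)
        simp
      nlinarith
  rw [inv_eq_one_div, inv_eq_one_div, mul_one_div, div_le_div_iff₀ (by positivity) (by positivity)]
  linarith

lemma abs_im_pathPt_le {τ : ℝ} (h : 0 < τ) : |(pathPt τ).im| ≤ 1 := by
  have := (pathPt_mem_strip h).2.2
  exact abs_le.2 ⟨this.1, this.2.trans zero_le_one⟩

/-- Integral along the deformed contour of a kernel, normalised as in the inversion formula. -/
noncomputable def pathIntegral (g : ℂ → ℂ) : ℝ :=
  Real.pi⁻¹ * (∫ τ in Ioi (0 : ℝ), pathDir τ * g (pathPt τ)).re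

/-- Joining the two legs into one integral over `(0, ∞)` means that the domination arguments need to
be made only once; this splits them again for the tail estimates. -/
lemma integral_path_eq {g : ℂ → ℂ}
    (hg : IntegrableOn (fun τ => pathDir τ * g (pathPt τ)) (Ioi 0)) :
    ∫ τ in Ioi (0 : ℝ), pathDir τ * g (pathPt τ) =
      (∫ t in Ioi (0 : ℝ), g (t + (-1 : ℝ) * Complex.I)) +
        ∫ s in (0 : ℝ)..1, -Complex.I * g (-Complex.I * s) := by
  have e1 : ∫ τ in Ioi (1 : ℝ), pathDir τ * g (pathPt τ) =
      ∫ t in Ioi (0 : ℝ), g (t + (-1 : ℝ) * Complex.I) := by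
    have e := (measurePreserving_add_right volume (1 : ℝ)).setIntegral_preimage_emb
      (measurableEmbedding_addRight 1) (fun τ : ℝ => pathDir τ * g (pathPt τ)) (Ioi 1)
    have h0 : (fun t : ℝ => t + 1) ⁻¹' Ioi 1 = Ioi 0 := by ext t; simp
    rw [h0] at e
    rw [← e]
    refine setIntegral_congr_fun measurableSet_Ioi fun t ht => ?_
    have : ¬ t + 1 ≤ 1 := by simpa using ht
    simp [pathDir, pathPt, this]
  have e2 : ∫ τ in Ioc (0 : ℝ) 1, pathDir τ * g (pathPt τ) =
      ∫ s in (0 : ℝ)..1, -Complex.I * g (-Complex.I * s) := by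
    rw [intervalIntegral.integral_of_le zero_le_one]
    refine setIntegral_congr_fun measurableSet_Ioc fun t ht => ?_
    simp [pathDir, pathPt, ht.2]
  rw [← e1, ← e2, ← Ioc_union_Ioi_eq_Ioi zero_le_one, setIntegral_union (Ioc_disjoint_Ioi le_rfl)
    measurableSet_Ioi (hg.mono_set Ioc_subset_Ioi_self)
    (hg.mono_set (Ioi_subset_Ioi zero_le_one)), add_comm]

/-- On the contour `|Im w| ≤ 1`, and near `θ₀` one has `|x - μ| ≤ |x| + K` and `1/σ ≤ K`, so the
`x`-dependent factor is bounded and the decay `1/(1 + τ²)` remains. -/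
lemma exists_integrable_bound {θ₀ : Param} (h : θ₀ ∈ openParams) (x : ℝ) :
    ∃ b : ℝ → ℝ, Integrable b ∧ ∀ᶠ θ in 𝓝 θ₀, ∀ τ, 0 < τ →
      ‖pathDir τ * Complex.exp (phase (pathPt τ) x θ)‖ ≤ b τ ∧
      (∀ i, ‖pathDir τ * kern1 i (pathPt τ) x θ‖ ≤ b τ) ∧
      ∀ i j, ‖pathDir τ * kern2 i j (pathPt τ) x θ‖ ≤ b τ := by
  obtain ⟨K, hK⟩ := exists_eventually_bddBy h
  obtain ⟨C, h0, hC⟩ := exists_norm_kern_le K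
  refine ⟨fun τ => C * (1 + (|x| + K)) ^ 2 * Real.exp ((|x| + K) * K) * (2 * (1 + τ ^ 2)⁻¹),
    (integrable_inv_one_add_sq.const_mul 2).const_mul _, ?_⟩
  filter_upwards [hK] with θ hθ τ hτ
  have hK0 := hθ.pos
  have hxy : |x - θ 0| ≤ |x| + K := (abs_sub _ _).trans (by linarith [hθ.loc_le])
  have hE : Real.exp ((pathPt τ).im * ((x - θ 0) / θ 1)) ≤ Real.exp ((|x| + K) * K) := by
    refine Real.exp_le_exp.2 ((le_abs_self _).trans ?_)
    rw [abs_mul, abs_div, abs_of_pos hθ.scale_pos, div_eq_mul_inv]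
    have := mul_le_mul hxy hθ.inv_scale_le (inv_nonneg.2 hθ.scale_pos.le)
      (by positivity : 0 ≤ |x| + K)
    exact (mul_le_of_le_one_left
      (mul_nonneg (abs_nonneg _) (inv_nonneg.2 hθ.scale_pos.le)) (abs_im_pathPt_le hτ)).trans this
  have hb : C * (1 + |x - θ 0|) ^ 2 * Real.exp ((pathPt τ).im * ((x - θ 0) / θ 1)) *
      ((1 + ‖pathPt τ‖) ^ 2)⁻¹ ≤
      C * (1 + (|x| + K)) ^ 2 * Real.exp ((|x| + K) * K) * (2 * (1 + τ ^ 2)⁻¹) := by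
    have := inv_one_add_norm_pathPt_sq_le hτ
    gcongr
  obtain ⟨c0, c1, c2⟩ := hC θ hθ (pathPt τ) (pathPt_mem_strip hτ) x
  simp only [norm_mul, norm_pathDir, one_mul]
  exact ⟨c0.trans hb, fun i => (c1 i).trans hb, fun i j => (c2 i j).trans hb⟩

lemma aestronglyMeasurable_path {g : ℂ → ℂ} (hg : Measurable g) (μ : Measure ℝ) :
    AEStronglyMeasurable (fun τ => pathDir τ * g (pathPt τ)) μ :=
  (measurable_pathDir.mul (hg.comp measurable_pathPt)).aestronglyMeasurable

lemma integrableOn_path_kern {θ : Param} (h : θ ∈ openParams) (x : ℝ) :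
    IntegrableOn (fun τ => pathDir τ * Complex.exp (phase (pathPt τ) x θ)) (Ioi 0) := by
  obtain ⟨b, hb, H⟩ := exists_integrable_bound h x
  refine hb.integrableOn.mono' (aestronglyMeasurable_path (measurable_kern x θ) _) ?_
  exact (ae_restrict_iff' measurableSet_Ioi).2
    (Eventually.of_forall fun τ hτ => (H.self_of_nhds τ hτ).1)

lemma integrableOn_path_kern1 (i : Fin 4) {θ : Param} (h : θ ∈ openParams) (x : ℝ) :
    IntegrableOn (fun τ => pathDir τ * kern1 i (pathPt τ) x θ) (Ioi 0) := by
  obtain ⟨b, hb, H⟩ := exists_integrable_bound h x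
  refine hb.integrableOn.mono' (aestronglyMeasurable_path (measurable_kern1 i x θ) _) ?_
  exact (ae_restrict_iff' measurableSet_Ioi).2
    (Eventually.of_forall fun τ hτ => (H.self_of_nhds τ hτ).2.1 i)

lemma integrableOn_path_kern2 (i j : Fin 4) {θ : Param} (h : θ ∈ openParams) (x : ℝ) :
    IntegrableOn (fun τ => pathDir τ * kern2 i j (pathPt τ) x θ) (Ioi 0) := by
  obtain ⟨b, hb, H⟩ := exists_integrable_bound h x
  refine hb.integrableOn.mono' (aestronglyMeasurable_path (measurable_kern2 i j x θ) _) ?_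
  exact (ae_restrict_iff' measurableSet_Ioi).2
    (Eventually.of_forall fun τ hτ => (H.self_of_nhds τ hτ).2.2 i j)

lemma density_eq_pathIntegral {θ : Param} (h : θ ∈ openParams) (x : ℝ) :
    density x θ = pathIntegral fun w => Complex.exp (phase w x θ) := by
  rw [density_eq_half_line h, pathIntegral, integral_exp_phase_contour h,
    integral_path_eq (g := fun w => Complex.exp (phase w x θ)) (integrableOn_path_kern h x)]

/-- The first partial derivatives of the density, as contour integrals. -/
noncomputable def dens1 (i : Fin 4) (x : ℝ) (θ : Param) : ℝ := pathIntegral fun w => kern1 i w x θ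

/-- The second partial derivatives of the density, as contour integrals. -/
noncomputable def dens2 (i j : Fin 4) (x : ℝ) (θ : Param) : ℝ :=
  pathIntegral fun w => kern2 i j w x θ

lemma dens2_symm (i j : Fin 4) (x : ℝ) (θ : Param) : dens2 i j x θ = dens2 j i x θ := by
  simp only [dens2, kern2_symm i j]

/-- Differentiation of a contour integral in one parameter. -/
lemma hasDerivAt_pathIntegral {g g' : ℂ → Param → ℂ} (j : Fin 4) {θ : Param} (h : θ ∈ openParams)
    (hg : ∀ θ, Measurable fun w => g w θ) (hg' : ∀ θ, Measurable fun w => g' w θ)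
    {b : ℝ → ℝ} (hb : Integrable b)
    (hi : IntegrableOn (fun τ => pathDir τ * g (pathPt τ) θ) (Ioi 0))
    (H : ∀ᶠ θ in 𝓝 θ, ∀ τ, 0 < τ → ‖pathDir τ * g' (pathPt τ) θ‖ ≤ b τ)
    (hd : ∀ w ≠ 0, ∀ θ ∈ openParams,
      HasDerivAt (fun s => g w (Function.update θ j s)) (g' w θ) (θ j)) :
    HasDerivAt (fun s => pathIntegral fun w => g w (Function.update θ j s))
      (pathIntegral fun w => g' w θ) (θ j) := by
  obtain ⟨U, hU, hUo, hθU⟩ := eventually_nhds_iff.1 H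
  have hs : ∀ᶠ s in 𝓝 (θ j), Function.update θ j s ∈ U ∩ openParams :=
    eventually_update_mem (hUo.inter isOpen_openParams) ⟨hθU, h⟩ j
  have key := (hasDerivAt_integral_of_dominated_loc_of_deriv_le (μ := volume.restrict (Ioi (0 : ℝ)))
    (F := fun s τ => pathDir τ * g (pathPt τ) (Function.update θ j s))
    (F' := fun s τ => pathDir τ * g' (pathPt τ) (Function.update θ j s)) (x₀ := θ j) (bound := b) hs
    (Eventually.of_forall fun s => aestronglyMeasurable_path (hg _) _)
    (by simpa only [Function.update_eq_self, IntegrableOn] using hi)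
    (aestronglyMeasurable_path (hg' _) _)
    ((ae_restrict_iff' measurableSet_Ioi).2 (Eventually.of_forall fun τ hτ s hs => hU _ hs.1 τ hτ))
    hb.integrableOn
    ((ae_restrict_iff' measurableSet_Ioi).2 (Eventually.of_forall fun τ hτ s hs => by
      have := hd (pathPt τ) (strip_ne (pathPt_mem_strip hτ)) _ hs.2
      simp only [Function.update_idem, Function.update_self] at this
      exact this.const_mul _))).2
  have := (Complex.reCLM.hasFDerivAt.comp_hasDerivAt (θ j) key).const_mul Real.pi⁻¹
  simpa only [pathIntegral, Function.update_eq_self, Complex.reCLM_apply, Function.comp_def] using this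

lemma continuousAt_pathIntegral {g : ℂ → Param → ℂ} {θ : Param} (h : θ ∈ openParams)
    (hg : ∀ θ, Measurable fun w => g w θ) {b : ℝ → ℝ} (hb : Integrable b)
    (H : ∀ᶠ θ in 𝓝 θ, ∀ τ, 0 < τ → ‖pathDir τ * g (pathPt τ) θ‖ ≤ b τ)
    (hc : ∀ w ≠ 0, ContinuousOn (g w) openParams) :
    ContinuousAt (fun θ => pathIntegral fun w => g w θ) θ := by
  have key : ContinuousAt (fun θ => ∫ τ in Ioi (0 : ℝ), pathDir τ * g (pathPt τ) θ) θ :=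
    continuousAt_of_dominated (Eventually.of_forall fun θ => aestronglyMeasurable_path (hg θ) _)
      (H.mono fun θ hθ => (ae_restrict_iff' measurableSet_Ioi).2 (Eventually.of_forall hθ))
      hb.integrableOn
      ((ae_restrict_iff' measurableSet_Ioi).2 (Eventually.of_forall fun τ hτ =>
        continuousAt_const.mul ((hc (pathPt τ) (strip_ne (pathPt_mem_strip hτ))).continuousAt
          (isOpen_openParams.mem_nhds h))))
  exact continuousAt_const.mul (Complex.continuous_re.continuousAt.comp key)

lemma hasDerivAt_density (i : Fin 4) (x : ℝ) {θ : Param} (h : θ ∈ openParams) :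
    HasDerivAt (fun s => density x (Function.update θ i s)) (dens1 i x θ) (θ i) := by
  obtain ⟨b, hb, H⟩ := exists_integrable_bound h x
  have := hasDerivAt_pathIntegral (g := fun w θ => Complex.exp (phase w x θ))
    (g' := fun w θ => kern1 i w x θ) i h (measurable_kern x) (measurable_kern1 i x) hb
    (integrableOn_path_kern h x) (H.mono fun θ hθ τ hτ => (hθ τ hτ).2.1 i)
    (fun w hw θ hθ => hasDerivAt_kern i hw x hθ)
  -- The contour formula for the density is available only on `openParams`, hence only for values of
  -- the moving coordinate near `θ i`.
  refine this.congr_of_eventuallyEq ?_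
  filter_upwards [eventually_update_mem isOpen_openParams h i] with s hs
  exact density_eq_pathIntegral hs x

lemma hasDerivAt_dens1 (i j : Fin 4) (x : ℝ) {θ : Param} (h : θ ∈ openParams) :
    HasDerivAt (fun s => dens1 i x (Function.update θ j s)) (dens2 i j x θ) (θ j) := by
  obtain ⟨b, hb, H⟩ := exists_integrable_bound h x
  exact hasDerivAt_pathIntegral (g := fun w θ => kern1 i w x θ)
    (g' := fun w θ => kern2 i j w x θ) j h (measurable_kern1 i x) (measurable_kern2 i j x) hb
    (integrableOn_path_kern1 i h x) (H.mono fun θ hθ τ hτ => (hθ τ hτ).2.2 i j)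
    (fun w hw θ hθ => hasDerivAt_kern1 i j hw x hθ)

lemma continuousOn_density (x : ℝ) : ContinuousOn (density x) openParams := by
  intro θ h
  obtain ⟨b, hb, H⟩ := exists_integrable_bound h x
  have := continuousAt_pathIntegral (g := fun w θ => Complex.exp (phase w x θ)) h
    (measurable_kern x) hb (H.mono fun θ hθ τ hτ => (hθ τ hτ).1)
    (fun w hw => continuousOn_kern hw x)
  refine (this.congr_of_eventuallyEq ?_).continuousWithinAt
  filter_upwards [isOpen_openParams.mem_nhds h] with θ hθ using density_eq_pathIntegral hθ x

lemma continuousOn_dens1 (i : Fin 4) (x : ℝ) : ContinuousOn (dens1 i x) openParams := by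
  intro θ h
  obtain ⟨b, hb, H⟩ := exists_integrable_bound h x
  exact (continuousAt_pathIntegral (g := fun w θ => kern1 i w x θ) h
    (measurable_kern1 i x) hb (H.mono fun θ hθ τ hτ => (hθ τ hτ).2.1 i)
    (fun w hw => continuousOn_kern1 i hw x)).continuousWithinAt

lemma continuousOn_dens2 (i j : Fin 4) (x : ℝ) : ContinuousOn (dens2 i j x) openParams := by
  intro θ h
  obtain ⟨b, hb, H⟩ := exists_integrable_bound h x
  exact (continuousAt_pathIntegral (g := fun w θ => kern2 i j w x θ) h
    (measurable_kern2 i j x) hb (H.mono fun θ hθ τ hτ => (hθ τ hτ).2.2 i j)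
    (fun w hw => continuousOn_kern2 i j hw x)).continuousWithinAt

end StableM0

/-! ### Imaginary parts on the vertical segment w = -is -/

namespace StableM0
open MeasureTheory Filter Topology Set

section Segment

lemma ofReal_sub_mul_I_re (a b : ℝ) : ((a : ℂ) - b * Complex.I).re = a := by simp

lemma ofReal_sub_mul_I_im (a b : ℝ) : ((a : ℂ) - b * Complex.I).im = -b := by simp

lemma log_neg_I_mul {s : ℝ} (hs : 0 < s) :
    Complex.log (-Complex.I * s) = Real.log s - (Real.pi / 2 : ℝ) * Complex.I := by
  rw [mul_comm, Complex.log_ofReal_mul hs (by simp), Complex.log_neg_I]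
  push_cast; ring

lemma neg_I_mul_mem_strip {s : ℝ} (hs : s ∈ Ioc (0 : ℝ) 1) : -Complex.I * s ∈ strip := by
  have := pathPt_mem_strip hs.1
  rwa [pathPt, if_pos hs.2] at this

lemma norm_neg_I_mul {s : ℝ} (hs : 0 < s) : ‖-Complex.I * (s : ℂ)‖ = s := by
  simp [abs_of_pos hs]

lemma logPow_zero_neg_I_mul {α s : ℝ} (hs : 0 < s) : logPow 0 α (-Complex.I * s) =
    (s ^ α * Real.cos (Real.pi * α / 2) : ℝ) - (s ^ α * Real.sin (Real.pi * α / 2) : ℝ) * Complex.I := by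
  have h0 : -Complex.I * (s : ℂ) ≠ 0 := by simp [hs.ne']
  rw [logPow, pow_zero, one_mul, Complex.cpow_def_of_ne_zero h0, log_neg_I_mul hs]
  have e : ((Real.log s : ℂ) - (Real.pi / 2 : ℝ) * Complex.I) * α =
      ((Real.log s * α : ℝ) : ℂ) + ((-(Real.pi * α / 2) : ℝ) : ℂ) * Complex.I := by
    push_cast; ring
  rw [e, Complex.exp_add_mul_I, ← Complex.ofReal_exp, ← Real.rpow_def_of_pos hs,
    ← Complex.ofReal_cos, ← Complex.ofReal_sin, Real.cos_neg, Real.sin_neg]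
  push_cast; ring

/-- The linear term `-is` has no real part, and in the other term `tan * cos = sin` cancels the
singularity of the tangent. So the skewness term adds to the imaginary part of the phase exactly `β`
times what `w^α` contributes. -/
lemma re_drift_neg_I_mul {α s : ℝ} (hα : α ∈ Ioo (0 : ℝ) 2) (hs : 0 < s) :
    (drift α (-Complex.I * s)).re = (logPow 0 α (-Complex.I * s)).im := by
  rw [logPow_zero_neg_I_mul hs]
  rcases eq_or_ne α 1 with rfl | h1
  · rw [drift_one, log_neg_I_mul hs, Complex.re_ofReal_mul, ofReal_sub_mul_I_im]
    simp only [neg_mul, Complex.neg_re, Complex.mul_re, Complex.mul_im, Complex.I_re, Complex.I_im,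
      Complex.ofReal_re, Complex.ofReal_im, Complex.sub_re, Complex.sub_im,
      Real.rpow_one, mul_one, Real.sin_pi_div_two]
    have := Real.pi_ne_zero
    field_simp
    ring
  · have hc : Real.cos (Real.pi * α / 2) ≠ 0 := by
      rcases lt_or_gt_of_ne h1 with hl | hl
      · refine (Real.cos_pos_of_mem_Ioo ⟨?_, ?_⟩).ne' <;> nlinarith [Real.pi_pos, hα.1, hα.2]
      · refine (Real.cos_neg_of_pi_div_two_lt_of_lt ?_ ?_).ne <;>
          nlinarith [Real.pi_pos, hα.1, hα.2]
    have e : (-Complex.I * (s : ℂ)) ^ (α : ℂ) = logPow 0 α (-Complex.I * s) := by simp [logPow]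
    rw [drift_of_ne h1 hα.1.ne', e, logPow_zero_neg_I_mul hs, Complex.re_ofReal_mul,
      Complex.sub_re, ofReal_sub_mul_I_re, ofReal_sub_mul_I_im, Real.tan_eq_sin_div_cos]
    simp
    field_simp

lemma hasDerivAt_re {f : ℝ → ℂ} {f' : ℂ} {a : ℝ} (h : HasDerivAt f f' a) :
    HasDerivAt (fun s => (f s).re) f'.re a := Complex.reCLM.hasFDerivAt.comp_hasDerivAt a h

lemma hasDerivAt_im {f : ℝ → ℂ} {f' : ℂ} {a : ℝ} (h : HasDerivAt f f' a) :
    HasDerivAt (fun s => (f s).im) f'.im a := Complex.imCLM.hasFDerivAt.comp_hasDerivAt a h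

/-- The identity `re_drift_neg_I_mul` holds for all nearby `α`, so it can be differentiated in `α`;
uniqueness of derivatives replaces a computation with derivatives of `kappa`. -/
lemma re_driftA_neg_I_mul {α s : ℝ} (hα : α ∈ Ioo (0 : ℝ) 2) (hs : 0 < s) :
    (driftA α (-Complex.I * s)).re = (logPow 1 α (-Complex.I * s)).im := by
  have h0 : -Complex.I * (s : ℂ) ≠ 0 := by simp [hs.ne']
  refine ((hasDerivAt_re (hasDerivAt_drift hα (-Complex.I * s))).congr_of_eventuallyEq ?_).unique
    (hasDerivAt_im (hasDerivAt_logPow 0 α h0))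
  filter_upwards [isOpen_Ioo.mem_nhds hα] with a ha using (re_drift_neg_I_mul ha hs).symm

lemma re_driftAA_neg_I_mul {α s : ℝ} (hα : α ∈ Ioo (0 : ℝ) 2) (hs : 0 < s) :
    (driftAA α (-Complex.I * s)).re = (logPow 2 α (-Complex.I * s)).im := by
  have h0 : -Complex.I * (s : ℂ) ≠ 0 := by simp [hs.ne']
  refine ((hasDerivAt_re (hasDerivAt_driftA hα (-Complex.I * s))).congr_of_eventuallyEq ?_).unique
    (hasDerivAt_im (hasDerivAt_logPow 1 α h0))
  filter_upwards [isOpen_Ioo.mem_nhds hα] with a ha using (re_driftA_neg_I_mul ha hs).symm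

lemma abs_im_logPow_neg_I_mul_le (k : ℕ) (α : ℝ) {s : ℝ} (hs : s ∈ Ioc (0 : ℝ) 1) :
    |(logPow k α (-Complex.I * s)).im| ≤ s ^ α * (|Real.log s| + 2) ^ k := by
  refine (Complex.abs_im_le_norm _).trans ((norm_logPow k α _).trans ?_)
  have h := norm_log_le (neg_I_mul_mem_strip hs)
  rw [norm_neg_I_mul hs.1] at h ⊢
  have := Real.rpow_nonneg hs.1.le α
  rw [mul_comm]
  gcongr

/-- The term with `x` is real on the segment and drops out. The factor `1 + β` would vanish at `β =
-1`, where the right tail is no longer of order `u^(-1-α)`. -/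
lemma im_phase_neg_I_mul {θ : Param} (h : θ ∈ openParams) (x : ℝ) {s : ℝ} (hs : 0 < s) :
    (phase (-Complex.I * s) x θ).im = (1 + θ 3) * Real.sin (Real.pi * θ 2 / 2) * s ^ θ 2 := by
  have h1 := re_drift_neg_I_mul h.2.1 hs
  have h2 : (logPow 0 (θ 2) (-Complex.I * s)).im = -(s ^ θ 2 * Real.sin (Real.pi * θ 2 / 2)) := by
    rw [logPow_zero_neg_I_mul hs, ofReal_sub_mul_I_im]
  rw [phase]
  simp only [Complex.sub_im, Complex.neg_im, Complex.ofReal_im, h2, Complex.im_mul_ofReal]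
  have e : (Complex.I * (θ 3 : ℂ) * drift (θ 2) (-Complex.I * s)).im =
      θ 3 * (drift (θ 2) (-Complex.I * s)).re := by
    simp
  rw [e, h1, h2]
  simp
  ring

lemma im_phase_nonneg {θ : Param} (h : θ ∈ openParams) (x : ℝ) {s : ℝ} (hs : 0 < s) :
    0 ≤ (phase (-Complex.I * s) x θ).im ∧ (phase (-Complex.I * s) x θ).im ≤ 2 * s ^ θ 2 := by
  have hp := Real.rpow_pos_of_pos hs (θ 2)
  have h3 := h.2.2
  have hsin : 0 ≤ Real.sin (Real.pi * θ 2 / 2) :=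
    Real.sin_nonneg_of_nonneg_of_le_pi (by have := h.2.1.1; positivity)
      (by nlinarith [Real.pi_pos, h.2.1.2])
  have hsin1 := Real.sin_le_one (Real.pi * θ 2 / 2)
  rw [im_phase_neg_I_mul h x hs]
  have h4 : 0 ≤ (1 + θ 3) * Real.sin (Real.pi * θ 2 / 2) := mul_nonneg (by linarith [h3.1]) hsin
  have h5 : (1 + θ 3) * Real.sin (Real.pi * θ 2 / 2) ≤ 2 := by nlinarith [h3.1, h3.2]
  exact ⟨by positivity, by gcongr⟩

/-- The variant of `weight` that accounts for logarithmic singularities at the origin. -/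
noncomputable def logWeight (i : Fin 4) (s y : ℝ) : ℝ := ![s, 1 + s * y, |Real.log s| + 2, 1] i

lemma weight_le_logWeight (i : Fin 4) (s y : ℝ) : weight i s y ≤ logWeight i s y := by
  have := abs_nonneg (Real.log s)
  fin_cases i <;> simp [weight, logWeight]
  linarith

lemma logWeight_nonneg (i : Fin 4) {s y : ℝ} (hs : 0 ≤ s) (hy : 0 ≤ y) : 0 ≤ logWeight i s y :=
  (weight_nonneg i hs hy).trans (weight_le_logWeight i s y)

/-- The location and scale derivatives are real on the segment. For the other two parameters the
identities above reduce the imaginary part to that of `logPow`, which has the factor `s^α`. -/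
lemma abs_im_phase1_le (i : Fin 4) {θ : Param} (h : θ ∈ openParams) (x : ℝ) {s : ℝ}
    (hs : s ∈ Ioc (0 : ℝ) 1) :
    |(phase1 i (-Complex.I * s) x θ).im| ≤ 2 * s ^ θ 2 * logWeight i s |x - θ 0| := by
  have hp := Real.rpow_pos_of_pos hs.1 (θ 2)
  have hβ : |1 + θ 3| ≤ 2 := by rw [abs_le]; constructor <;> linarith [h.2.2.1, h.2.2.2]
  have hw := logWeight_nonneg i hs.1.le (abs_nonneg (x - θ 0))
  fin_cases i
  · have : (phase1 0 (-Complex.I * s) x θ).im = 0 := by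
      simp only [phase1, Matrix.cons_val_zero, Complex.im_mul_ofReal]; simp
    simp only [Fin.zero_eta] at hw ⊢
    rw [this, abs_zero]; positivity
  · have : (phase1 1 (-Complex.I * s) x θ).im = 0 := by
      simp only [phase1, Matrix.cons_val_one, Complex.add_im, Complex.neg_im, Complex.ofReal_im,
        Complex.im_mul_ofReal, Matrix.cons_val_zero]; simp
    simp only [Fin.mk_one] at hw ⊢
    rw [this, abs_zero]; positivity
  · have e : (phase1 2 (-Complex.I * s) x θ).im =
        -((1 + θ 3) * (logPow 1 (θ 2) (-Complex.I * s)).im) := by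
      have e1 : (phase1 2 (-Complex.I * s) x θ).im = -(logPow 1 (θ 2) (-Complex.I * s)).im -
          θ 3 * (driftA (θ 2) (-Complex.I * s)).re := by simp [phase1]
      rw [e1, re_driftA_neg_I_mul h.2.1 hs.1]; ring
    have hb := abs_im_logPow_neg_I_mul_le 1 (θ 2) hs
    simp only [Fin.reduceFinMk]
    rw [e, abs_neg, abs_mul]
    simp only [logWeight, Matrix.cons_val]
    rw [pow_one] at hb
    calc _ ≤ 2 * (s ^ θ 2 * (|Real.log s| + 2)) := by gcongr
      _ = _ := by ring
  · have e : (phase1 3 (-Complex.I * s) x θ).im = -(logPow 0 (θ 2) (-Complex.I * s)).im := by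
      have e1 : (phase1 3 (-Complex.I * s) x θ).im = -(drift (θ 2) (-Complex.I * s)).re := by
        simp [phase1]
      rw [e1, re_drift_neg_I_mul h.2.1 hs.1]
    have hb := abs_im_logPow_neg_I_mul_le 0 (θ 2) hs
    simp only [Fin.reduceFinMk]
    rw [e, abs_neg]
    simp only [logWeight, Matrix.cons_val]
    rw [pow_zero] at hb
    linarith

lemma abs_im_phase2_le (i j : Fin 4) {θ : Param} (h : θ ∈ openParams) (x : ℝ) {s : ℝ}
    (hs : s ∈ Ioc (0 : ℝ) 1) :
    |(phase2 i j (-Complex.I * s) x θ).im| ≤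
      2 * s ^ θ 2 * (logWeight i s |x - θ 0| * logWeight j s |x - θ 0|) := by
  have hp := Real.rpow_pos_of_pos hs.1 (θ 2)
  have hβ : |1 + θ 3| ≤ 2 := by rw [abs_le]; constructor <;> linarith [h.2.2.1, h.2.2.2]
  have hw := mul_nonneg (logWeight_nonneg i hs.1.le (abs_nonneg (x - θ 0)))
    (logWeight_nonneg j hs.1.le (abs_nonneg (x - θ 0)))
  have zero : (phase2 i j (-Complex.I * s) x θ).im = 0 →
      |(phase2 i j (-Complex.I * s) x θ).im| ≤
      2 * s ^ θ 2 * (logWeight i s |x - θ 0| * logWeight j s |x - θ 0|) := by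
    intro h0
    rw [h0, abs_zero]; positivity
  have h23 : |(-Complex.I * driftA (θ 2) (-Complex.I * s)).im| ≤
      2 * s ^ θ 2 * (|Real.log s| + 2) := by
    have hb := abs_im_logPow_neg_I_mul_le 1 (θ 2) hs
    have e : (-Complex.I * driftA (θ 2) (-Complex.I * s)).im =
        -(driftA (θ 2) (-Complex.I * s)).re := by simp
    rw [e, re_driftA_neg_I_mul h.2.1 hs.1, abs_neg]
    rw [pow_one] at hb
    have : 0 ≤ s ^ θ 2 * (|Real.log s| + 2) := by positivity
    linarith
  -- Only the `αα` and the two mixed `αβ` entries have a nonzero imaginary part; the alternatives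
  -- below dispose of all others.
  fin_cases i <;> fin_cases j
  all_goals
    first
    | (refine zero ?_
       simp only [phase2, Fin.zero_eta, Fin.mk_one, Fin.reduceFinMk, Matrix.cons_val,
          Complex.zero_im]
       done)
    | (refine zero ?_
       simp only [phase2, Fin.zero_eta, Fin.mk_one, Fin.reduceFinMk, Matrix.cons_val,
          Complex.sub_im, Complex.ofReal_im, Complex.im_mul_ofReal]
       simp
       done)
    | skip
  · have e : (phase2 2 2 (-Complex.I * s) x θ).im =
        -((1 + θ 3) * (logPow 2 (θ 2) (-Complex.I * s)).im) := by
      have e1 : (phase2 2 2 (-Complex.I * s) x θ).im = -(logPow 2 (θ 2) (-Complex.I * s)).im -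
          θ 3 * (driftAA (θ 2) (-Complex.I * s)).re := by simp [phase2]
      rw [e1, re_driftAA_neg_I_mul h.2.1 hs.1]; ring
    have hb := abs_im_logPow_neg_I_mul_le 2 (θ 2) hs
    simp only [Fin.reduceFinMk]
    rw [e, abs_neg, abs_mul]
    simp only [logWeight, Matrix.cons_val]
    calc _ ≤ 2 * (s ^ θ 2 * (|Real.log s| + 2) ^ 2) := by gcongr
      _ = _ := by ring
  · simpa only [phase2, logWeight, Fin.reduceFinMk, Matrix.cons_val, mul_one] using h23
  · simpa only [phase2, logWeight, Fin.reduceFinMk, Matrix.cons_val, one_mul] using h23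

lemma abs_im_exp_phase_le {θ : Param} (h : θ ∈ openParams) (x : ℝ) {s : ℝ} (hs : 0 < s) :
    |(Complex.exp (phase (-Complex.I * s) x θ)).im| ≤
      2 * s ^ θ 2 * ‖Complex.exp (phase (-Complex.I * s) x θ)‖ := by
  obtain ⟨h0, h1⟩ := im_phase_nonneg h x hs
  rw [Complex.exp_im, Complex.norm_exp, abs_mul, abs_of_pos (Real.exp_pos _), mul_comm]
  gcongr
  refine (Real.abs_sin_le_abs).trans ?_
  rwa [abs_of_nonneg h0]

lemma abs_im_mul_le (a b : ℂ) : |(a * b).im| ≤ |a.im| * ‖b‖ + ‖a‖ * |b.im| := by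
  rw [Complex.mul_im]
  refine (abs_add_le _ _).trans ?_
  rw [abs_mul, abs_mul]
  have h1 := Complex.abs_re_le_norm a
  have h2 := Complex.abs_re_le_norm b
  nlinarith [abs_nonneg a.im, abs_nonneg b.im]

/-- On the vertical segment the imaginary parts of the kernels gain a factor `s ^ α`. -/
lemma exists_abs_im_kern_le {θ : Param} (h : θ ∈ openParams) : ∃ C, 0 ≤ C ∧
    ∀ s ∈ Ioc (0 : ℝ) 1, ∀ x,
    (∀ i, |(kern1 i (-Complex.I * s) x θ).im| ≤
      C * (s ^ θ 2 * (logWeight i s |x - θ 0| * logWeight 3 s |x - θ 0|) *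
        Real.exp (-(s * ((x - θ 0) / θ 1))))) ∧
    ∀ i j, |(kern2 i j (-Complex.I * s) x θ).im| ≤
      C * (s ^ θ 2 * (logWeight i s |x - θ 0| * logWeight j s |x - θ 0|) *
        Real.exp (-(s * ((x - θ 0) / θ 1)))) := by
  obtain ⟨K, hK⟩ := exists_eventually_bddBy h
  have hK := hK.self_of_nhds
  obtain ⟨C₁, h₁, H₁⟩ := exists_norm_phase1_le K
  obtain ⟨C₂, h₂, H₂⟩ := exists_norm_phase2_le K
  obtain ⟨C, h0, hC⟩ := exists_norm_exp_phase_le K 0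
  -- Here `8` bounds `(1 + s)^3` for `s ≤ 1`, and the sum dominates the constant `c + 2c'` required
  -- by both uses of `fin` below.
  refine ⟨((2 + 4 * (8 * C₁)) + 2 * ((8 * C₂) + (8 * C₁) ^ 2) + 2 * (8 * C₁)) * C, by positivity,
    fun s hs x => ?_⟩
  have hw := neg_I_mul_mem_strip hs
  have hn := norm_neg_I_mul hs.1
  have hs0 := hs.1
  have hE := hC θ hK _ hw x
  rw [pow_zero, mul_one] at hE
  have him : (-Complex.I * (s : ℂ)).im = -s := by simp
  rw [him, neg_mul s] at hE
  have hEim := abs_im_exp_phase_le h x hs.1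
  have p1 : ∀ i, ‖phase1 i (-Complex.I * s) x θ‖ ≤ 8 * C₁ * logWeight i s |x - θ 0| := by
    intro i
    refine (H₁ θ hK _ hw x i).trans ?_
    rw [hn]
    have a := weight_nonneg i hs0.le (abs_nonneg (x - θ 0))
    have b := weight_le_logWeight i s |x - θ 0|
    have c : (1 + s) ^ 3 ≤ 8 := by
      calc (1 + s) ^ 3 ≤ (1 + 1) ^ 3 := by gcongr; exact hs.2
        _ = 8 := by norm_num
    calc _ ≤ C₁ * 8 * logWeight i s |x - θ 0| := by gcongr
      _ = _ := by ring
  have p2 : ∀ i j, ‖phase2 i j (-Complex.I * s) x θ‖ ≤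
      8 * C₂ * (logWeight i s |x - θ 0| * logWeight j s |x - θ 0|) := by
    intro i j
    refine (H₂ θ hK _ hw x i j).trans ?_
    rw [hn]
    have a := weight_nonneg i hs0.le (abs_nonneg (x - θ 0))
    have a' := weight_nonneg j hs0.le (abs_nonneg (x - θ 0))
    have b := weight_le_logWeight i s |x - θ 0|
    have b' := weight_le_logWeight j s |x - θ 0|
    have c : (1 + s) ^ 3 ≤ 8 := by
      calc (1 + s) ^ 3 ≤ (1 + 1) ^ 3 := by gcongr; exact hs.2
        _ = 8 := by norm_num
    have : weight i s |x - θ 0| * weight j s |x - θ 0| ≤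
      logWeight i s |x - θ 0| * logWeight j s |x - θ 0| := by
      exact mul_le_mul b b' a' (a.trans b)
    calc _ ≤ C₂ * 8 * (logWeight i s |x - θ 0| * logWeight j s |x - θ 0|) := by gcongr
      _ = _ := by ring
  have hw0 : ∀ i, 0 ≤ logWeight i s |x - θ 0| := fun i =>
    logWeight_nonneg i hs0.le (abs_nonneg (x - θ 0))
  have hsα := Real.rpow_pos_of_pos hs0 (θ 2)
  set A := s ^ θ 2
  set E := Complex.exp (phase (-Complex.I * s) x θ) with hEdef
  set e := Real.exp (-(s * ((x - θ 0) / θ 1)))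
  set D := (2 + 4 * (8 * C₁)) + 2 * ((8 * C₂) + (8 * C₁) ^ 2) + 2 * (8 * C₁) with hD
  have hD0 : 0 ≤ D := by positivity
  -- In `Im (q E)` either the imaginary part of `q` or that of `E` occurs, and each of them supplies
  -- the factor `A = s^α`.
  have fin : ∀ (q : ℂ) (c c' W : ℝ), 0 ≤ c → 0 ≤ c' → 0 ≤ W → c + 2 * c' ≤ D →
      |q.im| ≤ c * A * W → ‖q‖ ≤ c' * W → |(q * E).im| ≤ D * C * (A * W * e) := by
    intro q c c' W hc hc' hW hle h1 h2
    calc _ ≤ |q.im| * ‖E‖ + ‖q‖ * |E.im| := abs_im_mul_le q E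
      _ ≤ c * A * W * ‖E‖ + c' * W * (2 * A * ‖E‖) := by gcongr
      _ = (c + 2 * c') * (A * W) * ‖E‖ := by ring
      _ ≤ D * (A * W) * (C * e) := by gcongr
      _ = _ := by ring
  refine ⟨fun i => ?_, fun i j => ?_⟩
  · have h3 : logWeight 3 s |x - θ 0| = 1 := by simp [logWeight]
    rw [h3, mul_one, kern1]
    exact fin _ 2 (8 * C₁) _ (by norm_num) (by positivity) (hw0 i)
      (by rw [hD]; nlinarith [sq_nonneg C₁]) (abs_im_phase1_le i h x hs) (p1 i)
  · rw [kern2]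
    have hW := mul_nonneg (hw0 i) (hw0 j)
    refine fin _ (2 + 4 * (8 * C₁)) (8 * C₂ + (8 * C₁) ^ 2) _ (by positivity) (by positivity)
      hW (by rw [hD]; linarith) ?_ ?_
    · rw [Complex.add_im]
      have a := abs_im_phase2_le i j h x hs
      have b := abs_im_mul_le (phase1 i (-Complex.I * s) x θ) (phase1 j (-Complex.I * s) x θ)
      have b1 := abs_im_phase1_le i h x hs
      have b2 := abs_im_phase1_le j h x hs
      have wi := hw0 i
      have wj := hw0 j
      calc _ ≤ 2 * A * (logWeight i s |x - θ 0| * logWeight j s |x - θ 0|) +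
            ((2 * A * logWeight i s |x - θ 0|) * (8 * C₁ * logWeight j s |x - θ 0|) +
              (8 * C₁ * logWeight i s |x - θ 0|) * (2 * A * logWeight j s |x - θ 0|)) := by
            refine (abs_add_le _ _).trans (add_le_add a (b.trans ?_))
            have q1 := p1 i
            have q2 := p1 j
            gcongr
        _ = _ := by ring
    · calc _ ≤ 8 * C₂ * (logWeight i s |x - θ 0| * logWeight j s |x - θ 0|) +
            (8 * C₁ * logWeight i s |x - θ 0|) * (8 * C₁ * logWeight j s |x - θ 0|) := by
            refine norm_add_le_of_le (p2 i j) ?_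
            rw [norm_mul]
            have := hw0 i
            exact mul_le_mul (p1 i) (p1 j) (norm_nonneg _) (by positivity)
        _ = _ := by ring

end Segment

end StableM0

/-! ### Upper and lower bounds in the right tail -/

namespace StableM0
open MeasureTheory Filter Topology Set

lemma intervalIntegrable_im_segment {g : ℂ → ℂ}
    (hg : IntegrableOn (fun τ => pathDir τ * g (pathPt τ)) (Ioi 0)) :
    IntervalIntegrable (fun s : ℝ => (g (-Complex.I * s)).im) volume 0 1 := by
  rw [intervalIntegrable_iff_integrableOn_Ioc_of_le zero_le_one]
  have h := (hg.mono_set (Ioc_subset_Ioi_self : Ioc (0 : ℝ) 1 ⊆ Ioi 0)).re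
  refine IntegrableOn.congr_fun (f := fun τ => RCLike.re (pathDir τ * g (pathPt τ))) h ?_
    measurableSet_Ioc
  intro τ hτ
  simp [pathDir, pathPt, hτ.2]

/-- On the vertical leg the tangent is `-i` and `Re (-i g) = Im g`, so the density sees only
imaginary parts there. -/
lemma pathIntegral_eq {g : ℂ → ℂ}
    (hg : IntegrableOn (fun τ => pathDir τ * g (pathPt τ)) (Ioi 0)) :
    pathIntegral g = Real.pi⁻¹ * ((∫ t in Ioi (0 : ℝ), g (t + (-1 : ℝ) * Complex.I)).re +
      ∫ s in (0 : ℝ)..1, (g (-Complex.I * s)).im) := by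
  rw [pathIntegral, integral_path_eq hg, Complex.add_re]
  congr 2
  have hi : IntervalIntegrable (fun s : ℝ => -Complex.I * g (-Complex.I * s)) volume 0 1 := by
    rw [intervalIntegrable_iff_integrableOn_Ioc_of_le zero_le_one]
    refine (hg.mono_set (Ioc_subset_Ioi_self : Ioc (0 : ℝ) 1 ⊆ Ioi 0)).congr_fun ?_ measurableSet_Ioc
    intro τ hτ
    simp [pathDir, pathPt, hτ.2]
  have := Complex.reCLM.intervalIntegral_comp_comm hi
  simp only [Complex.reCLM_apply] at this
  rw [← this]
  congr 1
  ext s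
  simp

lemma abs_re_line_integral_le {g : ℂ → ℂ} {B : ℝ}
    (hB : ∀ w ∈ strip, w.im = -1 → ‖g w‖ ≤ B * ((1 + ‖w‖) ^ 2)⁻¹) (hB0 : 0 ≤ B) :
    |(∫ t in Ioi (0 : ℝ), g (t + (-1 : ℝ) * Complex.I)).re| ≤
      B * ∫ t in Ioi (0 : ℝ), (1 + t ^ 2)⁻¹ := by
  refine (Complex.abs_re_le_norm _).trans ?_
  rw [← integral_const_mul]
  refine norm_integral_le_of_norm_le ((integrable_inv_one_add_sq.const_mul B).integrableOn) ?_
  refine (ae_restrict_iff' measurableSet_Ioi).2 (Eventually.of_forall fun t ht => ?_)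
  refine (hB _ (mem_strip_of_pos_re ht ⟨le_rfl, by norm_num⟩) (by simp)).trans ?_
  gcongr
  refine one_add_sq_le (le_of_lt ht) ((le_abs_self t).trans ?_)
  have := Complex.abs_re_le_norm ((t : ℂ) + (-1 : ℝ) * Complex.I)
  simpa only [Complex.add_re, Complex.ofReal_re, Complex.re_ofReal_mul, Complex.I_re, mul_zero,
    add_zero] using this

/-- The profile of the tail integrals after rescaling. -/
noncomputable def tailProfile (α v : ℝ) : ℝ :=
  v ^ α * ((1 + v) * (|Real.log v| + 2)) ^ 2 * Real.exp (-v)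

lemma integrableOn_tailProfile {α : ℝ} (hα : α ∈ Ioo (0 : ℝ) 2) :
    IntegrableOn (tailProfile α) (Ioi 0) := by
  obtain ⟨C, h0, hC⟩ := rpow_mul_abs_log_le hα.1 2
  -- Three powers come from the bound on `v^α` times squared logarithms and two from the explicit
  -- `(1 + v)²`. The rate `1/2` uses up half of the exponential decay.
  obtain ⟨C', h0', hC'⟩ := add_two_pow_le_exp (a := 1 / 2) (by norm_num) 5
  have hi : IntegrableOn (fun v : ℝ => C * C' * Real.exp (-(1 / 2) * v)) (Ioi 0) :=
    (integrableOn_exp_mul_Ioi (by norm_num) 0).const_mul _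
  refine Integrable.mono' hi ?_ ?_
  · refine Measurable.aestronglyMeasurable ?_
    unfold tailProfile
    have : Measurable fun v : ℝ => v ^ α := measurable_id.pow_const α
    have : Measurable fun v : ℝ => |Real.log v| := Real.measurable_log.abs
    fun_prop
  · refine (ae_restrict_iff' measurableSet_Ioi).2 (Eventually.of_forall fun v hv => ?_)
    have hv : 0 < v := hv
    have hp := Real.rpow_pos_of_pos hv α
    rw [Real.norm_of_nonneg (by unfold tailProfile; positivity), tailProfile]
    have h1 := hC v hv α le_rfl hα.2.le
    have h2 := hC' v hv.le
    have h3 : (1 + v) ^ 5 ≤ (v + 2) ^ 5 := by gcongr ?_ ^ 5; linarith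
    calc _ = (1 + v) ^ 2 * (v ^ α * (|Real.log v| + 2) ^ 2) * Real.exp (-v) := by ring
      _ ≤ (1 + v) ^ 2 * (C * (1 + v) ^ 3) * Real.exp (-v) := by gcongr
      _ = C * (1 + v) ^ 5 * Real.exp (-v) := by ring
      _ ≤ C * (C' * Real.exp (1 / 2 * v)) * Real.exp (-v) := by gcongr; exact h3.trans h2
      _ = C * C' * (Real.exp (1 / 2 * v) * Real.exp (-v)) := by ring
      _ = _ := by rw [← Real.exp_add]; ring_nf

lemma tailProfile_nonneg {α v : ℝ} (hv : 0 ≤ v) : 0 ≤ tailProfile α v := by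
  unfold tailProfile; positivity

/-- The growth rate at infinity gained by differentiation in the `i`-th parameter. -/
noncomputable def rate (i : Fin 4) (u : ℝ) : ℝ := ![u⁻¹, 1, Real.log u + 1, 1] i

lemma inv_le_rate (i : Fin 4) {u : ℝ} (hu : 1 ≤ u) : u⁻¹ ≤ rate i u := by
  have h1 : u⁻¹ ≤ 1 := inv_le_one_of_one_le₀ hu
  have h2 := Real.log_nonneg hu
  fin_cases i <;> simp [rate] <;> linarith

lemma rate_pos (i : Fin 4) {u : ℝ} (hu : 1 ≤ u) : 0 < rate i u :=
  (inv_pos.2 (by linarith)).trans_le (inv_le_rate i hu)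

/-- With `s = v/u`, a factor `s` is worth `u⁻¹`, the product `s * σu = σv` is free of `u`, and `|log
s| ≤ |log v| + log u`. What depends on `v` goes into a common factor, whose square appears in
`tailProfile`. -/
lemma logWeight_le_rate (i : Fin 4) {s u σ : ℝ} (hs : 0 < s) (hu : 1 ≤ u) (hσ : 0 < σ) :
    logWeight i s (σ * u) ≤ (1 + σ) * rate i u * ((1 + u * s) * (|Real.log (u * s)| + 2)) := by
  have hu0 : 0 < u := by linarith
  set v := u * s with hv
  have hv0 : 0 < v := mul_pos hu0 hs
  have hl : 0 ≤ |Real.log v| := abs_nonneg _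
  have hlu := Real.log_nonneg hu
  have hB1 : 1 ≤ |Real.log v| + 2 := by linarith
  have hB : 1 + v ≤ (1 + v) * (|Real.log v| + 2) := le_mul_of_one_le_right (by linarith) hB1
  have hs' : s = v / u := by rw [hv]; field_simp
  have hr := rate_pos i hu
  have h1σ : (1 : ℝ) ≤ 1 + σ := by linarith
  have step : logWeight i s (σ * u) ≤ (1 + σ) * (rate i u * ((1 + v) * (|Real.log v| + 2))) := by
    fin_cases i
    · simp only [Fin.zero_eta, logWeight, rate, Matrix.cons_val]
      rw [hs', div_eq_inv_mul]
      have : u⁻¹ * v ≤ u⁻¹ * ((1 + v) * (|Real.log v| + 2)) := by gcongr; linarith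
      exact this.trans (le_mul_of_one_le_left (by positivity) h1σ)
    · simp only [Fin.mk_one, logWeight, rate, Matrix.cons_val]
      have e : s * (σ * u) = σ * v := by rw [hv]; ring
      rw [e, one_mul]
      calc 1 + σ * v ≤ (1 + σ) * (1 + v) := by nlinarith
        _ ≤ _ := by gcongr
    · simp only [Fin.reduceFinMk, logWeight, rate, Matrix.cons_val]
      have e : |Real.log s| ≤ |Real.log v| + Real.log u := by
        rw [hs', Real.log_div hv0.ne' hu0.ne']
        exact (abs_sub _ _).trans (by rw [abs_of_nonneg hlu])
      calc |Real.log s| + 2 ≤ (Real.log u + 1) * (1 * (|Real.log v| + 2)) := by nlinarith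
        _ ≤ (Real.log u + 1) * ((1 + v) * (|Real.log v| + 2)) := by gcongr; linarith
        _ ≤ _ := le_mul_of_one_le_left (by positivity) h1σ
    · simp only [Fin.reduceFinMk, logWeight, rate, Matrix.cons_val]
      nlinarith
  rw [mul_assoc]
  exact step

/-- Six inverse powers suffice for the horizontal leg to be negligible: every tail order below is at
least `u^(-3) * u^(-2)`, and the lower bound uses the spare `u⁻¹`. -/
lemma exists_sq_mul_exp_neg_le (σ : ℝ) (hσ : 0 < σ) :
    ∃ C, 0 ≤ C ∧ ∀ u, 1 ≤ u → (1 + σ * u) ^ 2 * Real.exp (-u) ≤ C * u⁻¹ ^ 6 := by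
  obtain ⟨C, h0, hC⟩ := add_two_pow_le_exp one_pos 8
  refine ⟨(1 + σ) ^ 2 * C, by positivity, fun u hu => ?_⟩
  have hu0 : 0 < u := by linarith
  have h1 := hC u hu0.le
  have h2 : u ^ 8 ≤ (u + 2) ^ 8 := by gcongr; linarith
  have h3 : (1 + σ * u) ^ 2 ≤ (1 + σ) ^ 2 * u ^ 2 := by
    rw [← mul_pow]; gcongr; nlinarith
  rw [one_mul] at h1
  rw [inv_pow, ← div_eq_mul_inv, le_div_iff₀ (by positivity), Real.exp_neg]
  calc _ ≤ (1 + σ) ^ 2 * u ^ 2 * (Real.exp u)⁻¹ * u ^ 6 := by gcongr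
    _ = (1 + σ) ^ 2 * (u ^ 8 / Real.exp u) := by field_simp
    _ ≤ (1 + σ) ^ 2 * C := by
      gcongr
      rw [div_le_iff₀ (Real.exp_pos _)]
      exact h2.trans h1

lemma inv_pow_three_le {α u : ℝ} (hα : α ≤ 2) (hu : 1 ≤ u) : u⁻¹ ^ 3 ≤ u ^ (-1 - α) := by
  have : u⁻¹ ^ 3 = u ^ (-3 : ℝ) := by
    rw [Real.rpow_neg (by linarith), inv_pow]; norm_cast
  rw [this]
  exact Real.rpow_le_rpow_of_exponent_le hu (by linarith)

/-- Upper bound for a contour integral in the right tail. -/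
lemma exists_abs_pathIntegral_le {θ : Param} (h : θ ∈ openParams) (g : ℝ → ℂ → ℂ) (i j : Fin 4)
    {C : ℝ} (hC0 : 0 ≤ C)
    (hg : ∀ x, IntegrableOn (fun τ => pathDir τ * g x (pathPt τ)) (Ioi 0))
    (hline : ∀ x, ∀ w ∈ strip, w.im = -1 → ‖g x w‖ ≤
      C * (1 + |x - θ 0|) ^ 2 * Real.exp (-((x - θ 0) / θ 1)) * ((1 + ‖w‖) ^ 2)⁻¹)
    (hseg : ∀ s ∈ Ioc (0 : ℝ) 1, ∀ x, |(g x (-Complex.I * s)).im| ≤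
      C * (s ^ θ 2 * (logWeight i s |x - θ 0| * logWeight j s |x - θ 0|) *
        Real.exp (-(s * ((x - θ 0) / θ 1))))) :
    ∃ C', 0 ≤ C' ∧ ∀ x, 1 ≤ (x - θ 0) / θ 1 → |pathIntegral (g x)| ≤
      C' * (((x - θ 0) / θ 1) ^ (-1 - θ 2) *
        (rate i ((x - θ 0) / θ 1) * rate j ((x - θ 0) / θ 1))) := by
  obtain ⟨C₁, h₁, H₁⟩ := exists_sq_mul_exp_neg_le (θ 1) h.1
  set J := ∫ t in Ioi (0 : ℝ), (1 + t ^ 2)⁻¹ with hJ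
  have hJ0 : 0 ≤ J := integral_nonneg fun t => by positivity
  set M := ∫ v in Ioi (0 : ℝ), tailProfile (θ 2) v with hM
  have hM0 : 0 ≤ M := setIntegral_nonneg measurableSet_Ioi fun v hv => tailProfile_nonneg (le_of_lt hv)
  refine ⟨Real.pi⁻¹ * (C * C₁ * J + C * (1 + θ 1) ^ 2 * M), by have := Real.pi_pos; positivity,
    fun x hx => ?_⟩
  set u := (x - θ 0) / θ 1 with hu
  have hu0 : 0 < u := by linarith
  have hy : |x - θ 0| = θ 1 * u := by
    have e : x - θ 0 = θ 1 * u := by rw [hu]; field_simp [h.1.ne']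
    rw [e, abs_of_pos (mul_pos h.1 hu0)]
  have hri := rate_pos i hx
  have hrj := rate_pos j hx
  have hpow : u ^ (-1 - θ 2) = u⁻¹ * u ^ (-θ 2) := by
    rw [sub_eq_add_neg, Real.rpow_add hu0, Real.rpow_neg_one]
  have hpu := Real.rpow_pos_of_pos hu0 (-1 - θ 2)
  have line := abs_re_line_integral_le (hline x) (by positivity)
  have hline2 : C * (1 + |x - θ 0|) ^ 2 * Real.exp (-u) * J ≤
      C * C₁ * J * (u ^ (-1 - θ 2) * (rate i u * rate j u)) := by
    rw [hy]
    have a := H₁ u hx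
    have b : u⁻¹ ^ 6 ≤ u ^ (-1 - θ 2) * (rate i u * rate j u) := by
      calc u⁻¹ ^ 6 = u⁻¹ ^ 3 * (u⁻¹ * u⁻¹) * u⁻¹ := by ring
        _ ≤ u⁻¹ ^ 3 * (u⁻¹ * u⁻¹) * 1 := by gcongr; exact inv_le_one_of_one_le₀ hx
        _ ≤ u ^ (-1 - θ 2) * (rate i u * rate j u) := by
          rw [mul_one]
          have := inv_le_rate i hx
          have := inv_le_rate j hx
          have := inv_pow_three_le h.2.1.2.le hx
          gcongr
    calc _ = C * J * ((1 + θ 1 * u) ^ 2 * Real.exp (-u)) := by ring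
      _ ≤ C * J * (C₁ * (u ^ (-1 - θ 2) * (rate i u * rate j u))) :=
        mul_le_mul_of_nonneg_left (a.trans (by gcongr)) (by positivity)
      _ = _ := by ring
  have hprof : ∀ s ∈ Ioc (0 : ℝ) 1, |(g x (-Complex.I * s)).im| ≤
      C * (1 + θ 1) ^ 2 * (u ^ (-θ 2) * (rate i u * rate j u)) * tailProfile (θ 2) (u * s) := by
    intro s hs
    have hs0 := hs.1
    refine (hseg s hs x).trans ?_
    rw [hy]
    have a := logWeight_le_rate i hs.1 hx h.1
    have b := logWeight_le_rate j hs.1 hx h.1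
    have a0 := logWeight_nonneg i hs.1.le (mul_pos h.1 hu0).le
    have b0 := logWeight_nonneg j hs.1.le (mul_pos h.1 hu0).le
    have hsp : s ^ θ 2 = u ^ (-θ 2) * (u * s) ^ θ 2 := by
      rw [Real.mul_rpow hu0.le hs.1.le, ← mul_assoc, ← Real.rpow_add hu0, neg_add_cancel,
        Real.rpow_zero, one_mul]
    have hus := Real.rpow_pos_of_pos (mul_pos hu0 hs.1) (θ 2)
    have hum := Real.rpow_pos_of_pos hu0 (-θ 2)
    rw [hsp, tailProfile, mul_comm s u]
    set B := (1 + u * s) * (|Real.log (u * s)| + 2)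
    have hW : logWeight i s (θ 1 * u) * logWeight j s (θ 1 * u) ≤
        ((1 + θ 1) * rate i u * B) * ((1 + θ 1) * rate j u * B) :=
      mul_le_mul a b b0 (a0.trans a)
    calc _ ≤ C * (u ^ (-θ 2) * (u * s) ^ θ 2 *
          (((1 + θ 1) * rate i u * B) * ((1 + θ 1) * rate j u * B)) * Real.exp (-(u * s))) := by
          gcongr
      _ = _ := by ring
  -- The pointwise bound gives `u^(-α)`; the substitution `v = us` supplies the remaining `u⁻¹`.
  have scale := integral_comp_mul_left_Ioi (tailProfile (θ 2)) 0 hu0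
  rw [mul_zero, smul_eq_mul, ← hM] at scale
  have iscale : IntegrableOn (fun s => tailProfile (θ 2) (u * s)) (Ioi 0) :=
    (integrableOn_Ioi_comp_mul_left_iff (tailProfile (θ 2)) 0 hu0).2
      (by rw [mul_zero]; exact integrableOn_tailProfile h.2.1)
  have seg : |∫ s in (0 : ℝ)..1, (g x (-Complex.I * s)).im| ≤
      C * (1 + θ 1) ^ 2 * M * (u ^ (-1 - θ 2) * (rate i u * rate j u)) := by
    set A := C * (1 + θ 1) ^ 2 * (u ^ (-θ 2) * (rate i u * rate j u)) with hA
    have hA0 : 0 ≤ A := by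
      have := Real.rpow_pos_of_pos hu0 (-θ 2)
      positivity
    rw [intervalIntegral.integral_of_le zero_le_one]
    have l1 : ‖∫ s in Ioc (0 : ℝ) 1, (g x (-Complex.I * s)).im‖ ≤
        ∫ s in Ioc (0 : ℝ) 1, A * tailProfile (θ 2) (u * s) :=
      norm_integral_le_of_norm_le ((iscale.mono_set Ioc_subset_Ioi_self).const_mul A)
        ((ae_restrict_iff' measurableSet_Ioc).2 (Eventually.of_forall hprof))
    have l2 : ∫ s in Ioc (0 : ℝ) 1, A * tailProfile (θ 2) (u * s) ≤
        ∫ s in Ioi (0 : ℝ), A * tailProfile (θ 2) (u * s) :=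
      setIntegral_mono_set (iscale.const_mul A)
        ((ae_restrict_iff' measurableSet_Ioi).2 (Eventually.of_forall fun s hs =>
          mul_nonneg hA0 (tailProfile_nonneg (mul_pos hu0 hs).le)))
        (Ioc_subset_Ioi_self).eventuallyLE
    have l3 := l1.trans l2
    rw [integral_const_mul, scale] at l3
    refine l3.trans (le_of_eq ?_)
    rw [hA, hpow]; ring
  rw [pathIntegral_eq (hg x), abs_mul, abs_of_pos (inv_pos.2 Real.pi_pos), mul_assoc]
  have hpi := inv_pos.2 Real.pi_pos
  gcongr
  refine (abs_add_le _ _).trans ?_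
  rw [add_mul]
  exact add_le_add (line.trans hline2) seg

lemma exists_kern_line_bound {θ : Param} (h : θ ∈ openParams) : ∃ C, 0 ≤ C ∧
    ∀ x, ∀ w ∈ strip, w.im = -1 →
    ‖Complex.exp (phase w x θ)‖ ≤
      C * (1 + |x - θ 0|) ^ 2 * Real.exp (-((x - θ 0) / θ 1)) * ((1 + ‖w‖) ^ 2)⁻¹ ∧
    (∀ i, ‖kern1 i w x θ‖ ≤
      C * (1 + |x - θ 0|) ^ 2 * Real.exp (-((x - θ 0) / θ 1)) * ((1 + ‖w‖) ^ 2)⁻¹) ∧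
    ∀ i j, ‖kern2 i j w x θ‖ ≤
      C * (1 + |x - θ 0|) ^ 2 * Real.exp (-((x - θ 0) / θ 1)) * ((1 + ‖w‖) ^ 2)⁻¹ := by
  obtain ⟨K, hK⟩ := exists_eventually_bddBy h
  obtain ⟨C, h0, hC⟩ := exists_norm_kern_le K
  refine ⟨C, h0, fun x w hw hi => ?_⟩
  have := hC θ hK.self_of_nhds w hw x
  rwa [hi, neg_one_mul] at this

/-- The second index is filled with the dummy value 3, whose weight and rate are both 1. -/
lemma exists_abs_dens1_le {θ : Param} (h : θ ∈ openParams) (i : Fin 4) :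
    ∃ C, 0 ≤ C ∧ ∀ x, 1 ≤ (x - θ 0) / θ 1 → |dens1 i x θ| ≤
      C * (((x - θ 0) / θ 1) ^ (-1 - θ 2) * rate i ((x - θ 0) / θ 1)) := by
  obtain ⟨C₁, h₁, H₁⟩ := exists_kern_line_bound h
  obtain ⟨C₂, h₂, H₂⟩ := exists_abs_im_kern_le h
  obtain ⟨C, h0, hC⟩ := exists_abs_pathIntegral_le h (fun x w => kern1 i w x θ) i 3
    (C := C₁ + C₂) (by positivity) (fun x => integrableOn_path_kern1 i h x)
    (fun x w hw hi => (((H₁ x w hw hi).2.1 i).trans (by gcongr; linarith)))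
    (fun s hs x => ((H₂ s hs x).1 i).trans (by
      have := logWeight_nonneg i hs.1.le (abs_nonneg (x - θ 0))
      have := logWeight_nonneg 3 hs.1.le (abs_nonneg (x - θ 0))
      have := Real.rpow_nonneg hs.1.le (θ 2)
      gcongr; linarith))
  refine ⟨C, h0, fun x hx => ?_⟩
  have h3 : rate 3 ((x - θ 0) / θ 1) = 1 := by simp [rate]
  have := hC x hx
  rwa [h3, mul_one] at this

lemma exists_abs_dens2_le {θ : Param} (h : θ ∈ openParams) (i j : Fin 4) :
    ∃ C, 0 ≤ C ∧ ∀ x, 1 ≤ (x - θ 0) / θ 1 → |dens2 i j x θ| ≤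
      C * (((x - θ 0) / θ 1) ^ (-1 - θ 2) *
        (rate i ((x - θ 0) / θ 1) * rate j ((x - θ 0) / θ 1))) := by
  obtain ⟨C₁, h₁, H₁⟩ := exists_kern_line_bound h
  obtain ⟨C₂, h₂, H₂⟩ := exists_abs_im_kern_le h
  exact exists_abs_pathIntegral_le h (fun x w => kern2 i j w x θ) i j
    (C := C₁ + C₂) (by positivity) (fun x => integrableOn_path_kern2 i j h x)
    (fun x w hw hi => (((H₁ x w hw hi).2.2 i j).trans (by gcongr; linarith)))
    (fun s hs x => ((H₂ s hs x).2 i j).trans (by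
      have := logWeight_nonneg i hs.1.le (abs_nonneg (x - θ 0))
      have := logWeight_nonneg j hs.1.le (abs_nonneg (x - θ 0))
      have := Real.rpow_nonneg hs.1.le (θ 2)
      gcongr; linarith))

lemma exists_abs_density_le {θ : Param} (h : θ ∈ openParams) :
    ∃ C, 0 ≤ C ∧ ∀ x, 1 ≤ (x - θ 0) / θ 1 → |density x θ| ≤
      C * ((x - θ 0) / θ 1) ^ (-1 - θ 2) := by
  obtain ⟨C₁, h₁, H₁⟩ := exists_kern_line_bound h
  obtain ⟨K, hK⟩ := exists_eventually_bddBy h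
  obtain ⟨C₂, h₂, H₂⟩ := exists_norm_exp_phase_le K 0
  obtain ⟨C, h0, hC⟩ := exists_abs_pathIntegral_le h (fun x w => Complex.exp (phase w x θ)) 3 3
    (C := C₁ + 2 * C₂) (by positivity) (fun x => integrableOn_path_kern h x)
    (fun x w hw hi => ((H₁ x w hw hi).1.trans (by gcongr; linarith)))
    (fun s hs x => (abs_im_exp_phase_le h x hs.1).trans (by
      have a := H₂ θ hK.self_of_nhds _ (neg_I_mul_mem_strip hs) x
      have him : (-Complex.I * (s : ℂ)).im = -s := by simp
      rw [pow_zero, mul_one, him, neg_mul s] at a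
      have b := Real.rpow_nonneg hs.1.le (θ 2)
      have e : ∀ y, logWeight 3 s y = 1 := fun y => by simp [logWeight]
      rw [e]
      calc _ ≤ 2 * s ^ θ 2 * (C₂ * Real.exp (-(s * ((x - θ 0) / θ 1)))) := by gcongr
        _ = 2 * C₂ * (s ^ θ 2 * (1 * 1) * Real.exp (-(s * ((x - θ 0) / θ 1)))) := by ring
        _ ≤ _ := by gcongr; linarith))
  refine ⟨C, h0, fun x hx => ?_⟩
  have h3 : rate 3 ((x - θ 0) / θ 1) = 1 := by simp [rate]
  have := hC x hx
  rwa [h3, mul_one, mul_one, ← density_eq_pathIntegral h] at this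

/-- Lower bound for the density in the right tail. -/
lemma exists_le_density {θ : Param} (h : θ ∈ openParams) : ∃ c U : ℝ, 0 < c ∧ 1 ≤ U ∧
    ∀ x, U ≤ (x - θ 0) / θ 1 → c * ((x - θ 0) / θ 1) ^ (-1 - θ 2) ≤ density x θ := by
  obtain ⟨C₁, h₁, H₁⟩ := exists_kern_line_bound h
  obtain ⟨K, hK⟩ := exists_eventually_bddBy h
  obtain ⟨C₂, h₂, H₂⟩ := exists_norm_levyExp_le K
  obtain ⟨C₃, h₃, H₃⟩ := exists_sq_mul_exp_neg_le (θ 1) h.1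
  have hα := h.2.1
  set b := (1 + θ 3) * Real.sin (Real.pi * θ 2 / 2) with hb
  have hb0 : 0 < b := by
    refine mul_pos (by linarith [h.2.2.1]) (Real.sin_pos_of_pos_of_lt_pi ?_ ?_)
    · have := Real.pi_pos; have := hα.1; positivity
    · nlinarith [Real.pi_pos, hα.2]
  -- The factors are the prefactor `1/σ`, the bound `exp (-su) ≥ exp (-1)` for `s ≤ 1/u`, the bound
  -- `C₂ (1 + s)^3 ≤ 8 C₂` on `levyExp`, and Jordan's inequality for the sine of the phase.
  set c₀ := (θ 1)⁻¹ * Real.exp (-1) * Real.exp (-(C₂ * 8)) * (2 / Real.pi * b) with hc₀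
  have hc₀0 : 0 < c₀ := by have := Real.pi_pos; have := h.1; positivity
  set J := ∫ t in Ioi (0 : ℝ), (1 + t ^ 2)⁻¹ with hJ
  have hJ0 : 0 ≤ J := integral_nonneg fun t => by positivity
  -- This is the constant produced by integrating `c₀ s^α` over `[0, 1/u]`.
  set c₁ := c₀ / (θ 2 + 1) with hc₁
  have hc₁0 : 0 < c₁ := div_pos hc₀0 (by linarith [hα.1])
  -- The condition `2 ≤ u^α` keeps the imaginary phase at most 1 on `[0, 1/u]`, within the range of
  -- Jordan's inequality. The last condition makes the horizontal leg at most half of the main term.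
  have ev : ∀ᶠ u : ℝ in atTop, 1 ≤ u ∧ 2 ≤ u ^ θ 2 ∧ C₁ * C₃ * J * u⁻¹ ≤ c₁ / 2 := by
    refine (eventually_ge_atTop 1).and (((tendsto_rpow_atTop hα.1).eventually_ge_atTop 2).and ?_)
    have : Tendsto (fun u : ℝ => C₁ * C₃ * J * u⁻¹) atTop (𝓝 0) := by
      simpa using tendsto_inv_atTop_zero.const_mul (C₁ * C₃ * J)
    exact (this.eventually_lt_const (half_pos hc₁0)).mono fun _ h => h.le
  obtain ⟨U, hU⟩ := eventually_atTop.1 ev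
  refine ⟨Real.pi⁻¹ * (c₁ / 2), max U 1, by have := Real.pi_pos; positivity, le_max_right _ _,
    fun x hx => ?_⟩
  set u := (x - θ 0) / θ 1 with hu
  obtain ⟨hu1, hu2, hu3⟩ := hU u ((le_max_left _ _).trans hx)
  have hu0 : 0 < u := by linarith
  have hy : |x - θ 0| = θ 1 * u := by
    have e : x - θ 0 = θ 1 * u := by rw [hu]; field_simp [h.1.ne']
    rw [e, abs_of_pos (mul_pos h.1 hu0)]
  set P := u ^ (-1 - θ 2) with hP
  have hP0 : 0 < P := Real.rpow_pos_of_pos hu0 _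
  have line := abs_re_line_integral_le (g := fun w => Complex.exp (phase w x θ))
    (fun w hw hi => (H₁ x w hw hi).1) (by positivity)
  have line2 : C₁ * (1 + |x - θ 0|) ^ 2 * Real.exp (-u) * J ≤ c₁ / 2 * P := by
    rw [hy]
    have a := H₃ u hu1
    calc _ = C₁ * J * ((1 + θ 1 * u) ^ 2 * Real.exp (-u)) := by ring
      _ ≤ C₁ * J * (C₃ * u⁻¹ ^ 6) := by gcongr
      _ = C₁ * C₃ * J * u⁻¹ * u⁻¹ ^ 3 * u⁻¹ ^ 2 := by ring
      _ ≤ C₁ * C₃ * J * u⁻¹ * u⁻¹ ^ 3 * 1 := by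
        gcongr
        exact pow_le_one₀ (by positivity) (inv_le_one_of_one_le₀ hu1)
      _ ≤ c₁ / 2 * P := by
        rw [mul_one]
        have := inv_pow_three_le hα.2.le hu1
        gcongr
  have hu_inv : u⁻¹ ≤ 1 := inv_le_one_of_one_le₀ hu1
  have iseg := intervalIntegrable_im_segment (g := fun w => Complex.exp (phase w x θ))
    (integrableOn_path_kern h x)
  -- On the whole segment the imaginary phase lies in `[0, 2]`, inside `[0, π]`, so the part with `s
  -- > 1/u` can be discarded.
  have nonneg : ∀ s ∈ Ioc (0 : ℝ) 1, 0 ≤ (Complex.exp (phase (-Complex.I * s) x θ)).im := by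
    intro s hs
    obtain ⟨a, b⟩ := im_phase_nonneg h x hs.1
    rw [Complex.exp_im]
    have : s ^ θ 2 ≤ 1 := Real.rpow_le_one hs.1.le hs.2 hα.1.le
    exact mul_nonneg (Real.exp_pos _).le
      (Real.sin_nonneg_of_nonneg_of_le_pi a (by linarith [Real.pi_gt_three]))
  have lower : ∀ s ∈ Icc (0 : ℝ) u⁻¹, c₀ * s ^ θ 2 ≤
      (Complex.exp (phase (-Complex.I * s) x θ)).im := by
    intro s hs
    rcases eq_or_lt_of_le hs.1 with rfl | hs0
    · rw [Real.zero_rpow hα.1.ne', mul_zero]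
      have e : (phase (-Complex.I * (0 : ℝ)) x θ).im = 0 := by
        simp [phase, logPow, drift, driftCore, hα.1.ne']
      rw [Complex.exp_im, e, Real.sin_zero, mul_zero]
    have hs1 : s ∈ Ioc (0 : ℝ) 1 := ⟨hs0, hs.2.trans hu_inv⟩
    have hw := neg_I_mul_mem_strip hs1
    obtain ⟨a, b'⟩ := im_phase_nonneg h x hs0
    have hsα : s ^ θ 2 ≤ 1 / 2 := by
      calc s ^ θ 2 ≤ u⁻¹ ^ θ 2 := Real.rpow_le_rpow hs0.le hs.2 hα.1.le
        _ = (u ^ θ 2)⁻¹ := Real.inv_rpow hu0.le _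
        _ ≤ 1 / 2 := by rw [inv_eq_one_div]; gcongr
    have hsin := Real.mul_le_sin a (by linarith [Real.pi_gt_three])
    rw [im_phase_neg_I_mul h x hs0, ← hb] at hsin
    have hnorm : (θ 1)⁻¹ * Real.exp (-1) * Real.exp (-(C₂ * 8)) ≤
        ‖Complex.exp (phase (-Complex.I * s) x θ)‖ := by
      rw [norm_exp_phase h.1]
      have hσ := h.1
      gcongr
      · have him : (-Complex.I * (s : ℂ)).im = -s := by simp
        rw [him, ← hu, neg_mul, neg_le_neg_iff]
        calc s * u ≤ u⁻¹ * u := by gcongr; exact hs.2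
          _ = 1 := inv_mul_cancel₀ hu0.ne'
      · have a1 := H₂ θ hK.self_of_nhds _ hw
        rw [norm_neg_I_mul hs0] at a1
        have c : (1 + s) ^ 3 ≤ 8 := by
          calc (1 + s) ^ 3 ≤ (1 + 1) ^ 3 := by gcongr; exact hs1.2
            _ = 8 := by norm_num
        exact (Complex.re_le_norm _).trans (a1.trans (by gcongr))
    rw [Complex.exp_im, ← Complex.norm_exp, im_phase_neg_I_mul h x hs0, ← hb, hc₀, mul_assoc]
    have hsp := Real.rpow_nonneg hs0.le (θ 2)
    have hpi := Real.pi_pos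
    have hσ := h.1
    refine mul_le_mul hnorm (by linarith) (by positivity) (norm_nonneg _)
  have int1 : ∫ s in (0 : ℝ)..u⁻¹, c₀ * s ^ θ 2 = c₁ * P := by
    rw [intervalIntegral.integral_const_mul, integral_rpow (Or.inl (by linarith [hα.1])),
      Real.zero_rpow (by linarith [hα.1]), sub_zero, Real.inv_rpow hu0.le, ← Real.rpow_neg hu0.le,
      hc₁, hP]
    ring_nf
  have hsub : uIcc (0 : ℝ) u⁻¹ ⊆ uIcc 0 1 := by
    rw [uIcc_of_le (inv_pos.2 hu0).le, uIcc_of_le zero_le_one]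
    exact Icc_subset_Icc_right hu_inv
  have seg1 : c₁ * P ≤ ∫ s in (0 : ℝ)..u⁻¹, (Complex.exp (phase (-Complex.I * s) x θ)).im := by
    rw [← int1]
    refine intervalIntegral.integral_mono_on (inv_pos.2 hu0).le ?_ (iseg.mono_set hsub) lower
    exact (intervalIntegral.intervalIntegrable_rpow' (by linarith [hα.1])).const_mul c₀
  have seg2 : ∫ s in (0 : ℝ)..u⁻¹, (Complex.exp (phase (-Complex.I * s) x θ)).im ≤
      ∫ s in (0 : ℝ)..1, (Complex.exp (phase (-Complex.I * s) x θ)).im := by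
    refine intervalIntegral.integral_mono_interval le_rfl (inv_pos.2 hu0).le hu_inv ?_ iseg
    exact (ae_restrict_iff' measurableSet_Ioc).2 (Eventually.of_forall nonneg)
  rw [density_eq_pathIntegral h, pathIntegral_eq (integrableOn_path_kern h x), mul_assoc]
  have hpi := inv_pos.2 Real.pi_pos
  gcongr
  have := (abs_le.1 (line.trans line2)).1
  linarith

end StableM0

/-! ### Multipliers preserving nonnegative Fourier transforms -/

namespace StableM0
open MeasureTheory Filter Topology Set

/-- Functions whose inverse Fourier transform has nonnegative real part. -/
def NonnegFT (G : ℝ → ℂ) : Prop :=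
  Integrable G ∧ ∀ x : ℝ, 0 ≤ (∫ t : ℝ, Complex.exp (-(Complex.I * ((t * x : ℝ) : ℂ))) * G t).re

lemma norm_exp_neg_I_mul (t x : ℝ) : ‖Complex.exp (-(Complex.I * ((t * x : ℝ) : ℂ)))‖ = 1 := by
  rw [Complex.norm_exp]; simp

lemma measurable_exp_neg_I_mul (x : ℝ) :
    Measurable fun t : ℝ => Complex.exp (-(Complex.I * ((t * x : ℝ) : ℂ))) := by fun_prop

lemma Integrable.exp_neg_I_mul {G : ℝ → ℂ} (h : Integrable G) (x : ℝ) :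
    Integrable fun t : ℝ => Complex.exp (-(Complex.I * ((t * x : ℝ) : ℂ))) * G t :=
  h.bdd_mul (c := 1) (measurable_exp_neg_I_mul x).aestronglyMeasurable
    (Eventually.of_forall fun t => (norm_exp_neg_I_mul t x).le)

lemma NonnegFT.of_tendsto {G : ℕ → ℝ → ℂ} {H : ℝ → ℂ} {b : ℝ → ℝ} (hG : ∀ n, NonnegFT (G n))
    (hH : AEStronglyMeasurable H volume) (hb : Integrable b) (hle : ∀ n t, ‖G n t‖ ≤ b t)
    (hlim : ∀ t, Tendsto (fun n => G n t) atTop (𝓝 (H t))) : NonnegFT H := by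
  refine ⟨hb.mono' hH (Eventually.of_forall fun t =>
    le_of_tendsto (hlim t).norm (Eventually.of_forall fun n => hle n t)), fun x => ?_⟩
  have key : Tendsto (fun n => ∫ t : ℝ, Complex.exp (-(Complex.I * ((t * x : ℝ) : ℂ))) * G n t) atTop
      (𝓝 (∫ t : ℝ, Complex.exp (-(Complex.I * ((t * x : ℝ) : ℂ))) * H t)) := by
    refine tendsto_integral_of_dominated_convergence b
      (fun n => (Integrable.exp_neg_I_mul (hG n).1 x).aestronglyMeasurable) hb
      (fun n => Eventually.of_forall fun t => ?_)
      (Eventually.of_forall fun t => (hlim t).const_mul _)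
    rw [norm_mul, norm_exp_neg_I_mul, one_mul]
    exact hle n t
  exact ge_of_tendsto ((Complex.continuous_re.tendsto _).comp key)
    (Eventually.of_forall fun n => (hG n).2 x)

/-- Bounded functions that preserve `NonnegFT` under multiplication. -/
structure PosMult (F : ℝ → ℂ) : Prop where
  measurable : Measurable F
  bounded : ∃ M : ℝ, ∀ t, ‖F t‖ ≤ M
  mul_mem : ∀ G, NonnegFT G → NonnegFT fun t => F t * G t

/-- For a multiplier property closure under products is mere composition; no convolution or Bochner
theorem is involved. -/
lemma PosMult.mul {F F' : ℝ → ℂ} (h : PosMult F) (h' : PosMult F') :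
    PosMult fun t => F t * F' t := by
  obtain ⟨M, hM⟩ := h.bounded
  obtain ⟨M', hM'⟩ := h'.bounded
  refine ⟨h.measurable.mul h'.measurable, ⟨M * M', fun t => ?_⟩, fun G hG => ?_⟩
  · rw [norm_mul]
    exact mul_le_mul (hM t) (hM' t) (norm_nonneg _) ((norm_nonneg _).trans (hM t))
  · simpa only [mul_assoc] using h.mul_mem _ (h'.mul_mem G hG)

lemma PosMult.add {F F' : ℝ → ℂ} (h : PosMult F) (h' : PosMult F') :
    PosMult fun t => F t + F' t := by
  obtain ⟨M, hM⟩ := h.bounded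
  obtain ⟨M', hM'⟩ := h'.bounded
  refine ⟨h.measurable.add h'.measurable, ⟨M + M', fun t => norm_add_le_of_le (hM t) (hM' t)⟩,
    fun G hG => ?_⟩
  obtain ⟨i1, p1⟩ := h.mul_mem G hG
  obtain ⟨i2, p2⟩ := h'.mul_mem G hG
  simp only [add_mul]
  refine ⟨i1.add i2, fun x => ?_⟩
  simp only [mul_add]
  rw [integral_add (Integrable.exp_neg_I_mul i1 x) (Integrable.exp_neg_I_mul i2 x), Complex.add_re]
  exact add_nonneg (p1 x) (p2 x)

lemma PosMult.const {c : ℝ} (hc : 0 ≤ c) : PosMult fun _ => (c : ℂ) := by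
  refine ⟨measurable_const, ⟨|c|, fun t => by rw [Complex.norm_real, Real.norm_eq_abs]⟩, fun G hG => ?_⟩
  refine ⟨hG.1.const_mul _, fun x => ?_⟩
  simp only [mul_left_comm _ (c : ℂ)]
  rw [integral_const_mul, Complex.re_ofReal_mul]
  exact mul_nonneg hc (hG.2 x)

/-- Multiplication by a character translates the transform by `b`. -/
lemma PosMult.exp_I (b : ℝ) : PosMult fun t => Complex.exp (Complex.I * ((b * t : ℝ) : ℂ)) := by
  have hn : ∀ t : ℝ, ‖Complex.exp (Complex.I * ((b * t : ℝ) : ℂ))‖ = 1 := fun t => by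
    rw [Complex.norm_exp]; simp
  refine ⟨by fun_prop, ⟨1, fun t => (hn t).le⟩, fun G hG => ?_⟩
  refine ⟨hG.1.bdd_mul (c := 1) (by fun_prop) (Eventually.of_forall fun t => (hn t).le), fun x => ?_⟩
  have := hG.2 (x - b)
  convert this using 4 with t
  rw [← mul_assoc, ← Complex.exp_add]
  congr 2
  push_cast; ring

lemma PosMult.of_tendsto {F : ℕ → ℝ → ℂ} {F' : ℝ → ℂ} {M : ℝ} (hF : ∀ n, PosMult (F n))
    (hM : ∀ n t, ‖F n t‖ ≤ M) (hlim : ∀ t, Tendsto (fun n => F n t) atTop (𝓝 (F' t))) :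
    PosMult F' := by
  have hmeas : Measurable F' :=
    measurable_of_tendsto_metrizable (fun n => (hF n).measurable) (tendsto_pi_nhds.2 hlim)
  refine ⟨hmeas, ⟨M, fun t => le_of_tendsto (hlim t).norm (Eventually.of_forall fun n => hM n t)⟩,
    fun G hG => ?_⟩
  refine NonnegFT.of_tendsto (b := fun t => M * ‖G t‖) (fun n => (hF n).mul_mem G hG)
    (hmeas.aestronglyMeasurable.mul hG.1.aestronglyMeasurable) (hG.1.norm.const_mul M)
    (fun n t => ?_) (fun t => (hlim t).mul_const _)
  rw [norm_mul]
  have := hM n t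
  gcongr

lemma PosMult.pow {F : ℝ → ℂ} (h : PosMult F) (n : ℕ) : PosMult fun t => F t ^ n := by
  induction n with
  | zero => simpa using PosMult.const zero_le_one
  | succ n ih => simpa only [pow_succ] using ih.mul h

lemma PosMult.sum_range {F : ℕ → ℝ → ℂ} (h : ∀ k, PosMult (F k)) (n : ℕ) :
    PosMult fun t => ∑ k ∈ Finset.range n, F k t := by
  induction n with
  | zero => simpa using PosMult.const le_rfl
  | succ n ih => simpa only [Finset.sum_range_succ] using ih.add (h n)

/-- Power series with nonnegative coefficients preserve `PosMult`. -/
lemma PosMult.of_hasSum {F F' : ℝ → ℂ} {c : ℕ → ℝ} {r S : ℝ} (hF : PosMult F)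
    (hr : ∀ t, ‖F t‖ ≤ r) (hc : ∀ k, 0 ≤ c k) (hS : HasSum (fun k => c k * r ^ k) S)
    (hF' : ∀ t, HasSum (fun k => (c k : ℂ) * F t ^ k) (F' t)) :
    PosMult F' ∧ ∀ t, ‖F' t‖ ≤ S := by
  have hr0 : 0 ≤ r := (norm_nonneg _).trans (hr 0)
  have hterm : ∀ k t, ‖(c k : ℂ) * F t ^ k‖ ≤ c k * r ^ k := fun k t => by
    rw [norm_mul, norm_pow, Complex.norm_real, Real.norm_of_nonneg (hc k)]
    have := hr t
    have := hc k
    gcongr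
  refine ⟨PosMult.of_tendsto (M := S)
    (F := fun n t => ∑ k ∈ Finset.range n, (c k : ℂ) * F t ^ k)
    (PosMult.sum_range fun k => (PosMult.const (hc k)).mul (hF.pow k)) (fun n t => ?_)
    (fun t => (hF' t).tendsto_sum_nat), fun t => (hF' t).norm_le_of_bounded hS (hterm · t)⟩
  refine (norm_sum_le_of_le _ fun k _ => hterm k t).trans ?_
  exact sum_le_hasSum _ (fun k _ => mul_nonneg (hc k) (pow_nonneg hr0 k)) hS

lemma PosMult.exp {F : ℝ → ℂ} (h : PosMult F) : PosMult fun t => Complex.exp (F t) := by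
  obtain ⟨M, hM⟩ := h.bounded
  refine (PosMult.of_hasSum (c := fun k => ((k.factorial : ℝ))⁻¹) (S := Real.exp M) h hM
    (fun k => by positivity) ?_ fun t => ?_).1
  · have := NormedSpace.expSeries_div_hasSum_exp M
    rw [← Real.exp_eq_exp_ℝ] at this
    simpa only [div_eq_inv_mul] using this
  · have := NormedSpace.expSeries_div_hasSum_exp (F t)
    rw [← Complex.exp_eq_exp_ℂ] at this
    simpa only [div_eq_inv_mul, Complex.ofReal_inv, Complex.ofReal_natCast] using this

/-! ### Signs of the binomial coefficients of (1 - z)^α -/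

/-- The coefficients of `(1 - z) ^ α`. -/
noncomputable def binomCoeff (α : ℝ) (k : ℕ) : ℝ := (-1) ^ k * Ring.choose α k

lemma hasSum_binomCoeff (α : ℝ) {z : ℂ} (hz : ‖z‖ < 1) :
    HasSum (fun k => (binomCoeff α k : ℂ) * z ^ k) ((1 - z) ^ (α : ℂ)) := by
  have h := (Complex.one_add_cpow_hasFPowerSeriesOnBall_zero (a := (α : ℂ))).hasSum (y := -z) (by
    rw [← ENNReal.ofReal_one, Metric.eball_ofReal]; simpa using hz)
  simp only [← sub_eq_add_neg, binomialSeries_apply, List.ofFn_const, List.prod_replicate,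
    smul_eq_mul] at h
  rw [zero_sub, ← sub_eq_add_neg] at h
  refine h.congr_fun fun k => ?_
  rw [binomCoeff, ← Complex.ofReal_choose, neg_pow z]
  push_cast; ring

lemma hasSum_binomCoeff_real (α : ℝ) {r : ℝ} (h0 : 0 ≤ r) (h1 : r < 1) :
    HasSum (fun k => binomCoeff α k * r ^ k) ((1 - r) ^ α) := by
  have h := hasSum_binomCoeff α (z := (r : ℂ)) (by rwa [Complex.norm_real, Real.norm_of_nonneg h0])
  have e : (1 - (r : ℂ)) ^ (α : ℂ) = (((1 - r) ^ α : ℝ) : ℂ) := by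
    rw [Complex.ofReal_cpow (by linarith)]; push_cast; rfl
  rw [e] at h
  exact_mod_cast h

lemma binomCoeff_zero (α : ℝ) : binomCoeff α 0 = 1 := by simp [binomCoeff]

lemma binomCoeff_succ (α : ℝ) (k : ℕ) :
    binomCoeff α (k + 1) = binomCoeff α k * ((k - α) / (k + 1)) := by
  have h := Ring.choose_smul_choose α (n := k + 1) (k := k) (Nat.le_succ k)
  rw [Nat.choose_succ_self_right, Nat.add_sub_cancel_left, Ring.choose_one_right, nsmul_eq_mul] at h
  have hk : (k : ℝ) + 1 ≠ 0 := by positivity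
  rw [binomCoeff, binomCoeff, pow_succ]
  field_simp
  push_cast at h
  linear_combination -h

lemma binomCoeff_one (α : ℝ) : binomCoeff α 1 = -α := by
  have := binomCoeff_succ α 0
  simpa [binomCoeff_zero] using this

lemma binomCoeff_succ_nonpos {α : ℝ} (h0 : 0 < α) (h1 : α < 1) (k : ℕ) :
    binomCoeff α (k + 1) ≤ 0 := by
  induction k with
  | zero => rw [zero_add, binomCoeff_one]; linarith
  | succ k ih =>
    rw [binomCoeff_succ]
    refine mul_nonpos_of_nonpos_of_nonneg ih (div_nonneg ?_ (by positivity))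
    push_cast
    linarith [(Nat.cast_nonneg k : (0 : ℝ) ≤ k)]

lemma binomCoeff_add_two_nonneg {α : ℝ} (h1 : 1 < α) (h2 : α < 2) (k : ℕ) :
    0 ≤ binomCoeff α (k + 2) := by
  induction k with
  | zero =>
    rw [binomCoeff_succ, binomCoeff_one]
    refine mul_nonneg_of_nonpos_of_nonpos (by linarith) (div_nonpos_of_nonpos_of_nonneg ?_ ?_) <;>
      push_cast <;> linarith
  | succ k ih =>
    rw [binomCoeff_succ]
    refine mul_nonneg ih (div_nonneg ?_ (by positivity))
    push_cast
    linarith [(Nat.cast_nonneg k : (0 : ℝ) ≤ k)]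

/-- For `0 < α < 1` every coefficient of `(1 - z)^α` after the constant 1 is nonpositive. The bound
1 is independent of `r`, which the limit `r → 1` will need. -/
lemma PosMult.one_sub_cpow {α r : ℝ} (h0 : 0 < α) (h1 : α < 1) {F : ℝ → ℂ} (hF : PosMult F)
    (hr : ∀ t, ‖F t‖ ≤ r) (hr1 : r < 1) :
    PosMult (fun t => 1 - (1 - F t) ^ (α : ℂ)) ∧ ∀ t, ‖1 - (1 - F t) ^ (α : ℂ)‖ ≤ 1 := by
  have hr0 : 0 ≤ r := (norm_nonneg _).trans (hr 0)
  set c : ℕ → ℝ := fun k => if k = 0 then 0 else -binomCoeff α k with hcdef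
  have hc : ∀ k, 0 ≤ c k := by
    intro k
    rcases k with _ | k
    · simp [hcdef]
    · simpa [hcdef] using binomCoeff_succ_nonpos h0 h1 k
  have hS : HasSum (fun k => c k * r ^ k) (1 - (1 - r) ^ α) := by
    have a := (hasSum_ite_eq (0 : ℕ) (1 : ℝ)).sub (hasSum_binomCoeff_real α hr0 hr1)
    refine a.congr_fun fun k => ?_
    rcases k with _ | k <;> simp [hcdef, binomCoeff_zero]
  have hS' : ∀ t, HasSum (fun k => (c k : ℂ) * F t ^ k) (1 - (1 - F t) ^ (α : ℂ)) := by
    intro t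
    have a := (hasSum_ite_eq (0 : ℕ) (1 : ℂ)).sub (hasSum_binomCoeff α ((hr t).trans_lt hr1))
    refine a.congr_fun fun k => ?_
    rcases k with _ | k <;> simp [hcdef, binomCoeff_zero]
  obtain ⟨p, q⟩ := PosMult.of_hasSum hF hr hc hS hS'
  refine ⟨p, fun t => (q t).trans ?_⟩
  have : 0 ≤ (1 - r) ^ α := Real.rpow_nonneg (by linarith) _
  linarith

/-- For `1 < α < 2` the only negative coefficient of `(1 - z)^α` is `-α`, at `z`. Dividing by `z`
moves it to the constant term, where adding `α` cancels it; the pole `z⁻¹` has coefficient 1 and is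
handled by the hypothesis on the inverse. -/
lemma PosMult.add_cpow_div {α r : ℝ} (h1 : 1 < α) (h2 : α < 2) {F : ℝ → ℂ} (hF : PosMult F)
    (hFi : PosMult fun t => (F t)⁻¹) (hr : ∀ t, ‖F t‖ = r) (hr0 : 0 < r) (hr1 : r < 1) :
    PosMult (fun t => α + (1 - F t) ^ (α : ℂ) / F t) ∧
      ∀ t, ‖α + (1 - F t) ^ (α : ℂ) / F t‖ ≤ α + (1 - r) ^ α / r := by
  set c : ℕ → ℝ := fun k => if k = 0 then 0 else binomCoeff α (k + 1) with hcdef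
  have hc : ∀ k, 0 ≤ c k := by
    intro k
    rcases k with _ | k
    · simp [hcdef]
    · simpa [hcdef] using binomCoeff_add_two_nonneg h1 h2 k
  have hS : HasSum (fun k => c k * r ^ k) (α + (1 - r) ^ α / r - r⁻¹) := by
    have a := (hasSum_nat_add_iff' 1).2 (hasSum_binomCoeff_real α hr0.le hr1)
    have b := (hasSum_ite_eq (0 : ℕ) α).add (a.mul_right r⁻¹)
    simp only [Finset.sum_range_one, binomCoeff_zero, pow_zero, mul_one] at b
    have e : α + ((1 - r) ^ α - 1) * r⁻¹ = α + (1 - r) ^ α / r - r⁻¹ := by ring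
    rw [e] at b
    refine b.congr_fun fun k => ?_
    rcases k with _ | k
    · simp [hcdef, binomCoeff_one, hr0.ne']
    · simp [hcdef]; field_simp; ring
  have hS' : ∀ t, HasSum (fun k => (c k : ℂ) * F t ^ k)
      (α + (1 - F t) ^ (α : ℂ) / F t - (F t)⁻¹) := by
    intro t
    have hF0 : F t ≠ 0 := norm_pos_iff.1 (by rw [hr]; exact hr0)
    have a := (hasSum_nat_add_iff' 1).2 (hasSum_binomCoeff α (z := F t) (by rw [hr]; exact hr1))
    have b := (hasSum_ite_eq (0 : ℕ) (α : ℂ)).add (a.mul_right (F t)⁻¹)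
    simp only [Finset.sum_range_one, binomCoeff_zero, pow_zero, mul_one] at b
    have e : (α : ℂ) + ((1 - F t) ^ (α : ℂ) - ((1 : ℝ) : ℂ)) * (F t)⁻¹ =
      α + (1 - F t) ^ (α : ℂ) / F t - (F t)⁻¹ := by push_cast; ring
    rw [e] at b
    refine b.congr_fun fun k => ?_
    rcases k with _ | k
    · simp [hcdef, binomCoeff_one, hF0]
    · simp [hcdef]; field_simp; ring
  obtain ⟨p, q⟩ := PosMult.of_hasSum hF (fun t => (hr t).le) hc hS hS'
  refine ⟨?_, fun t => ?_⟩
  · have := p.add hFi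
    simpa only [sub_add_cancel] using this
  · have h3 : ‖(F t)⁻¹‖ ≤ r⁻¹ := by rw [norm_inv, hr]
    have := norm_add_le_of_le (q t) h3
    simpa only [sub_add_cancel] using this

end StableM0

/-! ### One-sided stable exponents as limits of compound Poisson exponents -/

namespace StableM0
open MeasureTheory Filter Topology Set

/-- Damped exponentials, whose slopes at `h = 0` approximate `I * b * t`. -/
noncomputable def dampedExp (b h t : ℝ) : ℂ :=
  ((Real.exp (-h ^ 2) : ℝ) : ℂ) * Complex.exp (Complex.I * ((b * h * t : ℝ) : ℂ))

lemma norm_dampedExp (b h t : ℝ) : ‖dampedExp b h t‖ = Real.exp (-h ^ 2) := by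
  rw [dampedExp, norm_mul, Complex.norm_real, Real.norm_of_nonneg (Real.exp_nonneg _),
    Complex.norm_exp]
  simp

lemma posMult_dampedExp (b h : ℝ) : PosMult (dampedExp b h) :=
  (PosMult.const (Real.exp_nonneg _)).mul (PosMult.exp_I _)

lemma posMult_dampedExp_inv (b h : ℝ) : PosMult fun t => (dampedExp b h t)⁻¹ := by
  have := (PosMult.const (Real.exp_nonneg (h ^ 2))).mul (PosMult.exp_I (-(b * h)))
  convert this using 2 with t
  rw [dampedExp, mul_inv, ← Complex.exp_neg, ← Complex.ofReal_inv, ← Real.exp_neg, neg_neg]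
  congr 2
  push_cast; ring

lemma ofReal_mul_cpow {a : ℝ} (ha : 0 < a) {z : ℂ} (hz : z ≠ 0) (α : ℝ) :
    ((a : ℂ) * z) ^ (α : ℂ) = ((a ^ α : ℝ) : ℂ) * z ^ (α : ℂ) := by
  have ha' : (a : ℂ) ≠ 0 := by exact_mod_cast ha.ne'
  rw [Complex.ofReal_cpow ha.le, Complex.cpow_def_of_ne_zero (mul_ne_zero ha' hz),
    Complex.cpow_def_of_ne_zero ha', Complex.cpow_def_of_ne_zero hz, Complex.log_ofReal_mul ha hz,
    Complex.ofReal_log ha.le, ← Complex.exp_add]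
  ring_nf

/-- The damping `exp (-h²)` makes the binomial series converge, yet has zero derivative at `h = 0`
and so leaves the slope unchanged. -/
lemma tendsto_slope_dampedExp (b t : ℝ) :
    Tendsto (fun h : ℝ => ((h⁻¹ : ℝ) : ℂ) * (1 - dampedExp b h t)) (𝓝[>] 0)
      (𝓝 (-(Complex.I * ((b * t : ℝ) : ℂ)))) := by
  have h1 : HasDerivAt (fun h : ℝ => dampedExp b h t) (Complex.I * ((b * t : ℝ) : ℂ)) 0 := by
    have a : HasDerivAt (fun h : ℝ => Real.exp (-h ^ 2)) 0 0 := by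
      simpa using ((hasDerivAt_pow 2 (0 : ℝ)).neg).exp
    have c : HasDerivAt (fun h : ℝ => Complex.exp (Complex.I * ((b * h * t : ℝ) : ℂ)))
        (Complex.I * ((b * t : ℝ) : ℂ)) 0 := by
      have d : HasDerivAt (fun h : ℝ => b * h * t) (b * t) 0 := by
        simpa using ((hasDerivAt_id (0 : ℝ)).const_mul b).mul_const t
      simpa using (d.ofReal_comp.const_mul Complex.I).cexp
    refine (a.ofReal_comp.mul c).congr_deriv ?_
    simp
  have h2 := (hasDerivAt_iff_tendsto_slope_zero.1 h1).neg
  refine (h2.mono_left (nhdsWithin_mono _ fun x hx => ne_of_gt hx)).congr fun h => ?_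
  have e : dampedExp b 0 t = 1 := by simp [dampedExp]
  rw [zero_add, e, Complex.real_smul]
  ring

lemma one_sub_dampedExp_re_pos (b t : ℝ) {h : ℝ} (hh : 0 < h) : 0 < (1 - dampedExp b h t).re := by
  have a := (Complex.re_le_norm (dampedExp b h t)).trans_eq (norm_dampedExp b h t)
  have c : Real.exp (-h ^ 2) < 1 := Real.exp_lt_one_iff.2 (by nlinarith)
  rw [Complex.sub_re, Complex.one_re]; linarith

lemma continuousAt_cpow_I_mul {α : ℝ} (hα : 0 < α) (s : ℝ) :
    ContinuousAt (fun z : ℂ => z ^ (α : ℂ)) (-(Complex.I * (s : ℂ))) := by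
  exact Complex.continuousAt_cpow_const_of_re_pos (Or.inl (by simp)) (by simpa using hα)

/-- The left side is `((1 - dampedExp) / h)^α`, a power of a convergent slope. The limit lies on the
imaginary axis, possibly at 0, where the power is still continuous because `α > 0`. -/
lemma tendsto_cpow_dampedExp {α : ℝ} (hα : 0 < α) (b t : ℝ) :
    Tendsto (fun h : ℝ => ((h⁻¹ ^ α : ℝ) : ℂ) * (1 - dampedExp b h t) ^ (α : ℂ)) (𝓝[>] 0)
      (𝓝 ((-(Complex.I * ((b * t : ℝ) : ℂ))) ^ (α : ℂ))) := by
  refine ((continuousAt_cpow_I_mul hα (b * t)).tendsto.comp (tendsto_slope_dampedExp b t)).congr' ?_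
  filter_upwards [self_mem_nhdsWithin] with h hh
  have hh : 0 < h := hh
  refine ofReal_mul_cpow (inv_pos.2 hh) (fun h0 => ?_) α
  have := one_sub_dampedExp_re_pos b t hh
  rw [h0] at this
  simp at this

lemma tendsto_stepSize : Tendsto (fun n : ℕ => 1 / ((n : ℝ) + 1)) atTop (𝓝[>] 0) :=
  tendsto_nhdsWithin_iff.2 ⟨tendsto_one_div_add_atTop_nhds_zero_nat,
    Eventually.of_forall fun n => by simp only [mem_Ioi]; positivity⟩

/-- With `k = c h^(-α)`, the function `exp (-k (1 - F)^α)` equals `exp (-k) exp (k (1 - (1 -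
F)^α))`, a positive constant times the exponential of a multiplier, of modulus at most 1. -/
lemma posMult_exp_neg_cpow {α c : ℝ} (h0 : 0 < α) (h1 : α < 1) (hc : 0 ≤ c) (b : ℝ) :
    PosMult fun t => Complex.exp (-(c * (-(Complex.I * ((b * t : ℝ) : ℂ))) ^ (α : ℂ))) := by
  set h : ℕ → ℝ := fun n => 1 / ((n : ℝ) + 1)
  have hh : ∀ n, 0 < h n := fun n => by positivity
  have hlt : ∀ n, Real.exp (-h n ^ 2) < 1 := fun n => Real.exp_lt_one_iff.2 (by nlinarith [hh n])
  have key := fun n => PosMult.one_sub_cpow h0 h1 (posMult_dampedExp b (h n))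
    (fun t => (norm_dampedExp b (h n) t).le) (hlt n)
  have hk : ∀ n, 0 ≤ c * (h n)⁻¹ ^ α := fun n =>
    mul_nonneg hc (Real.rpow_nonneg (inv_nonneg.2 (hh n).le) _)
  refine PosMult.of_tendsto (M := 1)
    (F := fun n t => ((Real.exp (-(c * (h n)⁻¹ ^ α)) : ℝ) : ℂ) *
      Complex.exp (((c * (h n)⁻¹ ^ α : ℝ) : ℂ) * (1 - (1 - dampedExp b (h n) t) ^ (α : ℂ))))
    (fun n => (PosMult.const (Real.exp_nonneg _)).mul
      ((PosMult.const (hk n)).mul (key n).1).exp) (fun n t => ?_) fun t => ?_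
  · rw [norm_mul, Complex.norm_real, Real.norm_of_nonneg (Real.exp_nonneg _), Complex.norm_exp,
      Complex.re_ofReal_mul, ← Real.exp_add, Real.exp_le_one_iff]
    have := mul_le_mul_of_nonneg_left ((Complex.re_le_norm _).trans ((key n).2 t)) (hk n)
    linarith
  · have l := ((tendsto_cpow_dampedExp h0 b t).comp tendsto_stepSize).const_mul (c : ℂ)
    refine ((Complex.continuous_exp.tendsto _).comp l.neg).congr fun n => ?_
    simp only [Function.comp_apply, Complex.ofReal_exp]
    rw [← Complex.exp_add]
    congr 1
    simp only [h]
    push_cast; ring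

/-- Since `1 - exp (-h²) ≤ h²`, the product of the two powers is at most `h^α ≤ 1`. This bounds the
approximants for `α > 1` uniformly in the step size. -/
lemma inv_rpow_mul_one_sub_exp_le {α h : ℝ} (h1 : 1 < α) (hh : 0 < h) (hh1 : h ≤ 1) :
    h⁻¹ ^ α * ((1 - Real.exp (-h ^ 2)) ^ α / Real.exp (-h ^ 2)) ≤ Real.exp 1 := by
  have e1 : 1 - Real.exp (-h ^ 2) ≤ h ^ 2 := by linarith [Real.add_one_le_exp (-h ^ 2)]
  have e0 : 0 ≤ 1 - Real.exp (-h ^ 2) := by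
    linarith [Real.exp_le_one_iff.2 (show -h ^ 2 ≤ 0 by nlinarith)]
  have e2 : h⁻¹ ^ α * (1 - Real.exp (-h ^ 2)) ^ α ≤ 1 := by
    rw [← Real.mul_rpow (by positivity) e0]
    refine Real.rpow_le_one (by positivity) ?_ (by linarith)
    rw [inv_mul_le_iff₀ hh]
    nlinarith
  rw [← mul_div_assoc, div_eq_mul_inv, ← Real.exp_neg, neg_neg]
  have e3 : Real.exp (h ^ 2) ≤ Real.exp 1 := Real.exp_le_exp.2 (by nlinarith)
  nlinarith [Real.exp_pos (h ^ 2)]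

/-- For `α > 1` the exponent has the opposite sign. Dividing `(1 - F)^α` by `F` is harmless in the
limit, since `F → 1`, and makes `add_cpow_div` applicable. -/
lemma posMult_exp_cpow {α c : ℝ} (h1 : 1 < α) (h2 : α < 2) (hc : 0 ≤ c) (b : ℝ) :
    PosMult fun t => Complex.exp (c * (-(Complex.I * ((b * t : ℝ) : ℂ))) ^ (α : ℂ)) := by
  set h : ℕ → ℝ := fun n => 1 / ((n : ℝ) + 1)
  have hh : ∀ n, 0 < h n := fun n => by positivity
  have hle : ∀ n, h n ≤ 1 := fun n => by
    rw [div_le_one (by positivity)]; linarith [(Nat.cast_nonneg n : (0 : ℝ) ≤ n)]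
  have hlt : ∀ n, Real.exp (-h n ^ 2) < 1 := fun n => Real.exp_lt_one_iff.2 (by nlinarith [hh n])
  have key := fun n => PosMult.add_cpow_div h1 h2 (posMult_dampedExp b (h n))
    (posMult_dampedExp_inv b (h n)) (norm_dampedExp b (h n)) (Real.exp_pos _) (hlt n)
  have hk : ∀ n, 0 ≤ c * (h n)⁻¹ ^ α := fun n =>
    mul_nonneg hc (Real.rpow_nonneg (inv_nonneg.2 (hh n).le) _)
  refine PosMult.of_tendsto (M := Real.exp (c * Real.exp 1))
    (F := fun n t => ((Real.exp (-(c * (h n)⁻¹ ^ α * α)) : ℝ) : ℂ) *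
      Complex.exp (((c * (h n)⁻¹ ^ α : ℝ) : ℂ) *
        (α + (1 - dampedExp b (h n) t) ^ (α : ℂ) / dampedExp b (h n) t)))
    (fun n => (PosMult.const (Real.exp_nonneg _)).mul
      ((PosMult.const (hk n)).mul (key n).1).exp) (fun n t => ?_) fun t => ?_
  · rw [norm_mul, Complex.norm_real, Real.norm_of_nonneg (Real.exp_nonneg _), Complex.norm_exp,
      Complex.re_ofReal_mul, ← Real.exp_add, Real.exp_le_exp]
    have a := mul_le_mul_of_nonneg_left ((Complex.re_le_norm _).trans ((key n).2 t)) (hk n)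
    have d := mul_le_mul_of_nonneg_left (inv_rpow_mul_one_sub_exp_le h1 (hh n) (hle n)) hc
    linarith
  · have l := ((tendsto_cpow_dampedExp (by linarith : 0 < α) b t).comp
      tendsto_stepSize).const_mul (c : ℂ)
    have cd : Continuous fun h : ℝ => dampedExp b h t := by unfold dampedExp; fun_prop
    have z : Tendsto (fun n : ℕ => dampedExp b (1 / ((n : ℝ) + 1)) t) atTop (𝓝 1) := by
      have e : dampedExp b 0 t = 1 := by simp [dampedExp]
      exact e ▸ (cd.tendsto 0).comp tendsto_one_div_add_atTop_nhds_zero_nat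
    have l' := l.div z one_ne_zero
    rw [div_one] at l'
    refine ((Complex.continuous_exp.tendsto _).comp l').congr fun n => ?_
    simp only [Function.comp_apply, Pi.div_apply, Complex.ofReal_exp]
    rw [← Complex.exp_add]
    congr 1
    simp only [h]
    push_cast; ring

end StableM0

/-! ### Nonnegativity of the density -/

namespace StableM0
open MeasureTheory Filter Topology Set
open scoped ComplexConjugate

/-- The cosine is positive for `α < 1` and negative for `α > 1`, which is exactly the change of sign
between the two preceding cases. -/
lemma posMult_exp_neg_div_cos_cpow {α a : ℝ} (hα : α ∈ Ioo (0 : ℝ) 2) (hα1 : α ≠ 1) (ha : 0 ≤ a)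
    (b : ℝ) : PosMult fun t => Complex.exp
      (-(((a / Real.cos (Real.pi * α / 2) : ℝ) : ℂ) *
        (-(Complex.I * ((b * t : ℝ) : ℂ))) ^ (α : ℂ))) := by
  have hπ := Real.pi_pos
  rcases lt_or_gt_of_ne hα1 with h | h
  · refine posMult_exp_neg_cpow hα.1 h (div_nonneg ha (Real.cos_nonneg_of_mem_Icc ⟨?_, ?_⟩)) b <;>
      nlinarith [hα.1]
  · have hc : Real.cos (Real.pi * α / 2) ≤ 0 :=
      Real.cos_nonpos_of_pi_div_two_le_of_le (by nlinarith) (by nlinarith [hα.2])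
    have := posMult_exp_cpow h hα.2 (neg_nonneg.2 (div_nonpos_of_nonneg_of_nonpos ha hc)) b
    simpa only [Complex.ofReal_neg, neg_mul] using this

lemma cos_pi_mul_div_two_ne_zero {α : ℝ} (hα : α ∈ Ioo (0 : ℝ) 2) (hα1 : α ≠ 1) :
    Real.cos (Real.pi * α / 2) ≠ 0 := by
  have hπ := Real.pi_pos
  rcases lt_or_gt_of_ne hα1 with h | h
  · exact (Real.cos_pos_of_mem_Ioo ⟨by nlinarith [hα.1], by nlinarith⟩).ne'
  · exact (Real.cos_neg_of_pi_div_two_lt_of_lt (by nlinarith) (by nlinarith [hα.2])).ne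

lemma neg_I_mul_cpow {α t : ℝ} (ht : 0 < t) : (-(Complex.I * (t : ℂ))) ^ (α : ℂ) =
    (t ^ α * Real.cos (Real.pi * α / 2) : ℝ) - (t ^ α * Real.sin (Real.pi * α / 2) : ℝ) * Complex.I := by
  have := logPow_zero_neg_I_mul (α := α) ht
  rwa [logPow, pow_zero, one_mul, neg_mul] at this

lemma conj_neg_I_mul_cpow {α t : ℝ} (ht : t ≠ 0) :
    (-(Complex.I * ((-t : ℝ) : ℂ))) ^ (α : ℂ) = conj ((-(Complex.I * (t : ℂ))) ^ (α : ℂ)) := by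
  have e : -(Complex.I * ((-t : ℝ) : ℂ)) = conj (-(Complex.I * (t : ℂ))) := by simp
  have harg : (-(Complex.I * (t : ℂ))).arg ≠ Real.pi := fun h => by
    have := (Complex.arg_eq_pi_iff.1 h).2
    simp at this
    exact ht this
  rw [e, Complex.conj_cpow _ _ harg, Complex.conj_ofReal]

/-- A stable law is a shift of the sum of two independent totally skewed ones, with weights `(1 ±
β)/2` on the jumps to the right and to the left. For `t > 0` this compares real and imaginary parts
of `(∓it)^α`; negative `t` follows by conjugation. -/
lemma charFn_eq_mul {σ α : ℝ} (hσ : 0 < σ) (hα : α ∈ Ioo (0 : ℝ) 2) (hα1 : α ≠ 1) (μ β t : ℝ) :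
    charFn μ σ α β t =
      Complex.exp (Complex.I * (((μ - β * Real.tan (Real.pi * α / 2) * σ) * t : ℝ) : ℂ)) *
      (Complex.exp (-(((σ ^ α * (1 + β) / 2 / Real.cos (Real.pi * α / 2) : ℝ) : ℂ) *
        (-(Complex.I * ((1 * t : ℝ) : ℂ))) ^ (α : ℂ))) *
      Complex.exp (-(((σ ^ α * (1 - β) / 2 / Real.cos (Real.pi * α / 2) : ℝ) : ℂ) *
        (-(Complex.I * ((-1 * t : ℝ) : ℂ))) ^ (α : ℂ)))) := by
  have hpos : ∀ t : ℝ, 0 < t → charFn μ σ α β t =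
      Complex.exp (Complex.I * (((μ - β * Real.tan (Real.pi * α / 2) * σ) * t : ℝ) : ℂ)) *
      (Complex.exp (-(((σ ^ α * (1 + β) / 2 / Real.cos (Real.pi * α / 2) : ℝ) : ℂ) *
        (-(Complex.I * (t : ℂ))) ^ (α : ℂ))) *
      Complex.exp (-(((σ ^ α * (1 - β) / 2 / Real.cos (Real.pi * α / 2) : ℝ) : ℂ) *
        conj ((-(Complex.I * (t : ℂ))) ^ (α : ℂ))))) := by
    intro t ht
    have hc := cos_pi_mul_div_two_ne_zero hα hα1
    have hc' : ((Real.cos (Real.pi * α / 2) : ℝ) : ℂ) ≠ 0 := by exact_mod_cast hc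
    rw [charFn_of_pos hσ hα.1 ht, levyExp, drift_of_ne hα1 hα.1.ne', logPow, pow_zero, one_mul,
      neg_I_mul_cpow ht, ← Complex.exp_add, ← Complex.exp_add, ← Complex.ofReal_cpow (by positivity),
      Real.mul_rpow hσ.le ht.le, Real.tan_eq_sin_div_cos]
    congr 1
    simp only [map_sub, map_mul, Complex.conj_ofReal, Complex.conj_I]
    push_cast [-Complex.ofReal_cos, -Complex.ofReal_sin]
    field_simp
    ring
  rcases lt_trichotomy t 0 with ht | rfl | ht
  · have h := congrArg conj (hpos (-t) (neg_pos.2 ht))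
    rw [← charFn_neg, neg_neg] at h
    rw [h]
    simp only [map_mul, ← Complex.exp_conj, map_neg, Complex.conj_ofReal, Complex.conj_I,
      Complex.conj_conj]
    rw [← conj_neg_I_mul_cpow (neg_ne_zero.2 ht.ne), neg_neg, one_mul, neg_one_mul]
    congr 2
    push_cast; ring
  · simp [charFn, hα.1.ne', Complex.zero_cpow, Real.zero_rpow]
  · rw [hpos t ht, ← conj_neg_I_mul_cpow ht.ne', one_mul, neg_one_mul]

lemma posMult_charFn {σ α β : ℝ} (hσ : 0 < σ) (hα : α ∈ Ioo (0 : ℝ) 2) (hα1 : α ≠ 1)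
    (hβ : β ∈ Ioo (-1 : ℝ) 1) (μ : ℝ) : PosMult (charFn μ σ α β) := by
  have hs := Real.rpow_nonneg hσ.le α
  have h1 : 0 ≤ σ ^ α * (1 + β) / 2 := by have := hβ.1; have : 0 ≤ 1 + β := by linarith
                                          positivity
  have h2 : 0 ≤ σ ^ α * (1 - β) / 2 := by have := hβ.2; have : 0 ≤ 1 - β := by linarith
                                          positivity
  have := (PosMult.exp_I (μ - β * Real.tan (Real.pi * α / 2) * σ)).mul
    ((posMult_exp_neg_div_cos_cpow hα hα1 h1 1).mul (posMult_exp_neg_div_cos_cpow hα hα1 h2 (-1)))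
  exact (funext fun t => (charFn_eq_mul hσ hα hα1 μ β t)) ▸ this

lemma nonnegFT_gaussian {ε : ℝ} (hε : 0 < ε) :
    NonnegFT fun t : ℝ => Complex.exp (-(ε : ℂ) * (t : ℂ) ^ 2) := by
  refine ⟨integrable_cexp_neg_mul_sq (by simpa using hε), fun x => ?_⟩
  have h := fourierIntegral_gaussian (b := (ε : ℂ)) (by simpa using hε) (-(x : ℂ))
  have e : ∀ t : ℝ, Complex.exp (-(Complex.I * ((t * x : ℝ) : ℂ))) =
    Complex.exp (Complex.I * -(x : ℂ) * t) := fun t => by congr 1; push_cast; ring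
  simp only [e]
  rw [h]
  have e2 : ((Real.pi : ℂ) / ε) ^ (1 / 2 : ℂ) * Complex.exp (-(-(x : ℂ)) ^ 2 / (4 * ε)) =
      (((Real.pi / ε) ^ (1 / 2 : ℝ) * Real.exp (-(-x) ^ 2 / (4 * ε)) : ℝ) : ℂ) := by
    rw [Complex.ofReal_mul, Complex.ofReal_cpow (by positivity)]
    push_cast; rfl
  rw [e2, Complex.ofReal_re]
  positivity

/-- Being a multiplier needs a function to act on: Gaussians `exp (-εt²)` have positive transforms
and tend to 1 as `ε → 0`. -/
lemma nonnegFT_charFn {θ : Param} (h : θ ∈ openParams) (h1 : θ 2 ≠ 1) :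
    NonnegFT (charFn (θ 0) (θ 1) (θ 2) (θ 3)) := by
  have hp := posMult_charFn h.1 h.2.1 h1 h.2.2 (θ 0)
  have hi : Integrable (charFn (θ 0) (θ 1) (θ 2) (θ 3)) := by
    refine (integrable_invKernel h 0).congr (Eventually.of_forall fun t => ?_)
    simp [invKernel]
  refine NonnegFT.of_tendsto (G := fun n t => charFn (θ 0) (θ 1) (θ 2) (θ 3) t *
      Complex.exp (-((1 / ((n : ℝ) + 1) : ℝ) : ℂ) * (t : ℂ) ^ 2))
    (fun n => hp.mul_mem _ (nonnegFT_gaussian (by positivity))) hi.aestronglyMeasurable hi.norm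
    (fun n t => ?_) fun t => ?_
  · rw [norm_mul]
    refine mul_le_of_le_one_right (norm_nonneg _) ?_
    have e : -((1 / ((n : ℝ) + 1) : ℝ) : ℂ) * (t : ℂ) ^ 2 = ((-(1 / ((n : ℝ) + 1)) * t ^ 2 : ℝ) : ℂ) := by
      push_cast; ring
    rw [e, Complex.norm_exp_ofReal, Real.exp_le_one_iff]
    have : 0 ≤ 1 / ((n : ℝ) + 1) * t ^ 2 := by positivity
    linarith
  · have c : Continuous fun s : ℝ => charFn (θ 0) (θ 1) (θ 2) (θ 3) t *
      Complex.exp (-(s : ℂ) * (t : ℂ) ^ 2) := by fun_prop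
    have l := (c.tendsto 0).comp tendsto_one_div_add_atTop_nhds_zero_nat
    rw [Complex.ofReal_zero, neg_zero, zero_mul, Complex.exp_zero, mul_one] at l
    exact l

/-- The factorisation breaks down at `α = 1`, but the density is continuous in `α` and nonnegative
for nearby `α ≠ 1`. -/
lemma density_nonneg {θ : Param} (h : θ ∈ openParams) (x : ℝ) : 0 ≤ density x θ := by
  have key : ∀ η ∈ openParams, η 2 ≠ 1 → 0 ≤ density x η := fun η hη h1 => by
    rw [density_eq]
    exact mul_nonneg (by positivity) ((nonnegFT_charFn hη h1).2 x)
  by_cases h1 : θ 2 = 1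
  · have hc : Tendsto (fun s => density x (Function.update θ 2 s)) (𝓝[≠] (θ 2)) (𝓝 (density x θ)) := by
      have := (hasDerivAt_density 2 x h).continuousAt.tendsto
      rw [Function.update_eq_self] at this
      exact this.mono_left nhdsWithin_le_nhds
    refine ge_of_tendsto hc ?_
    filter_upwards [self_mem_nhdsWithin,
      nhdsWithin_le_nhds (eventually_update_mem isOpen_openParams h 2)] with s hs hm
    exact key _ hm (by simpa [h1] using hs)
  · exact key θ h h1

end StableM0

/-! ### Reflection and two-sided tail bounds -/

namespace StableM0
open MeasureTheory Filter Topology Set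
open scoped ComplexConjugate

/-- The parameter of the law of `-X` when `X` has parameter `θ`. -/
def reflect (θ : Param) : Param := ![-θ 0, θ 1, θ 2, -θ 3]

/-- The action of `reflect` on the `i`-th coordinate. -/
def reflectSign (i : Fin 4) : ℝ := ![-1, 1, 1, -1] i

lemma reflect_apply (θ : Param) (i : Fin 4) : reflect θ i = reflectSign i * θ i := by
  fin_cases i <;> simp [reflect, reflectSign]

lemma abs_reflectSign (i : Fin 4) : |reflectSign i| = 1 := by
  fin_cases i <;> simp [reflectSign]

lemma reflect_mem {θ : Param} (h : θ ∈ openParams) : reflect θ ∈ openParams := by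
  obtain ⟨h1, h2, h3, h4⟩ := h
  have e : reflect θ 3 = -θ 3 := rfl
  exact ⟨h1, h2, by rw [e]; linarith, by rw [e]; linarith⟩

lemma reflect_update (θ : Param) (i : Fin 4) (s : ℝ) :
    reflect (Function.update θ i s) = Function.update (reflect θ) i (reflectSign i * s) := by
  ext j
  rcases eq_or_ne j i with rfl | hj
  · simp [reflect_apply]
  · simp [reflect_apply, hj]

lemma charFn_reflect (μ σ α β t : ℝ) : charFn (-μ) σ α (-β) t = charFn μ σ α β (-t) := by
  unfold charFn
  split_ifs
  · congr 1
    simp only [mul_neg, abs_neg]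
    push_cast; ring
  · congr 1
    simp only [mul_neg, abs_neg, Real.sign_neg]
    push_cast; ring

lemma density_reflect (x : ℝ) (θ : Param) : density (-x) (reflect θ) = density x θ := by
  rw [density_eq, density_eq, ← integral_neg_eq_self (invKernel x θ)]
  congr 4
  ext t
  rw [invKernel, invKernel]
  have : charFn (reflect θ 0) (reflect θ 1) (reflect θ 2) (reflect θ 3) t =
    charFn (θ 0) (θ 1) (θ 2) (θ 3) (-t) := charFn_reflect _ _ _ _ _
  rw [this, mul_neg, neg_mul]

/-- The contour is adapted to the right tail and is not symmetric, so the symmetry of the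
derivatives is obtained from that of the density by the chain rule. -/
lemma dens1_reflect (i : Fin 4) (x : ℝ) {θ : Param} (h : θ ∈ openParams) :
    dens1 i x θ = reflectSign i * dens1 i (-x) (reflect θ) := by
  have a := hasDerivAt_density i x h
  have b := hasDerivAt_density i (-x) (reflect_mem h)
  rw [reflect_apply] at b
  have c := HasDerivAt.comp (θ i) (h := fun s => reflectSign i * s) b
    ((hasDerivAt_id (θ i)).const_mul (reflectSign i))
  have d : (fun s => density (-x) (Function.update (reflect θ) i s)) ∘ (fun s => reflectSign i * s) =
      fun s => density x (Function.update θ i s) := by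
    ext s
    rw [Function.comp_apply, ← reflect_update, density_reflect]
  rw [d] at c
  rw [a.unique c]; ring

lemma dens2_reflect (i j : Fin 4) (x : ℝ) {θ : Param} (h : θ ∈ openParams) :
    dens2 i j x θ = reflectSign i * reflectSign j * dens2 i j (-x) (reflect θ) := by
  have a := hasDerivAt_dens1 i j x h
  have b := hasDerivAt_dens1 i j (-x) (reflect_mem h)
  rw [reflect_apply] at b
  have c := (HasDerivAt.comp (θ j) (h := fun s => reflectSign j * s) b
    ((hasDerivAt_id (θ j)).const_mul (reflectSign j))).const_mul (reflectSign i)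
  have d : (fun s => dens1 i x (Function.update θ j s)) =ᶠ[𝓝 (θ j)] fun s => reflectSign i *
      ((fun s => dens1 i (-x) (Function.update (reflect θ) j s)) ∘ fun s => reflectSign j * s) s := by
    filter_upwards [eventually_update_mem isOpen_openParams h j] with s hs
    rw [dens1_reflect i x hs, reflect_update, Function.comp_apply]
  rw [a.unique (c.congr_of_eventuallyEq d)]; ring

/-- The distance of `x` to the location parameter in units of the scale parameter. -/
noncomputable def scaledDist (x : ℝ) (θ : Param) : ℝ := |x - θ 0| / θ 1

/-- Either `x` lies to the right of the location for `θ`, or `-x` does for `reflect θ`; each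
two-sided bound follows from two right-tail bounds. -/
lemma scaledDist_cases (x : ℝ) (θ : Param) :
    scaledDist x θ = (x - θ 0) / θ 1 ∨ scaledDist x θ = (-x - reflect θ 0) / reflect θ 1 := by
  have e : (-x - reflect θ 0) / reflect θ 1 = -(x - θ 0) / θ 1 := by
    have h0 : reflect θ 0 = -θ 0 := rfl
    have h1 : reflect θ 1 = θ 1 := rfl
    rw [h0, h1]; ring
  rw [e, scaledDist]
  rcases abs_choice (x - θ 0) with h | h <;> simp [h]

lemma exists_abs_density_le_two_sided {θ : Param} (h : θ ∈ openParams) : ∃ C, 0 ≤ C ∧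
    ∀ x, 1 ≤ scaledDist x θ → |density x θ| ≤ C * scaledDist x θ ^ (-1 - θ 2) := by
  obtain ⟨C, hC, H⟩ := exists_abs_density_le h
  obtain ⟨C', hC', H'⟩ := exists_abs_density_le (reflect_mem h)
  refine ⟨max C C', le_max_of_le_left hC, fun x hx => ?_⟩
  have hp : 0 ≤ scaledDist x θ ^ (-1 - θ 2) := Real.rpow_nonneg (by linarith) _
  rcases scaledDist_cases x θ with e | e
  · exact (e ▸ H x (e ▸ hx)).trans (mul_le_mul_of_nonneg_right (le_max_left _ _) hp)
  · rw [← density_reflect]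
    exact (e ▸ H' (-x) (e ▸ hx)).trans (mul_le_mul_of_nonneg_right (le_max_right _ _) hp)

lemma exists_abs_dens1_le_two_sided {θ : Param} (h : θ ∈ openParams) (i : Fin 4) : ∃ C, 0 ≤ C ∧
    ∀ x, 1 ≤ scaledDist x θ →
      |dens1 i x θ| ≤ C * (scaledDist x θ ^ (-1 - θ 2) * rate i (scaledDist x θ)) := by
  obtain ⟨C, hC, H⟩ := exists_abs_dens1_le h i
  obtain ⟨C', hC', H'⟩ := exists_abs_dens1_le (reflect_mem h) i
  refine ⟨max C C', le_max_of_le_left hC, fun x hx => ?_⟩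
  have hp : 0 ≤ scaledDist x θ ^ (-1 - θ 2) * rate i (scaledDist x θ) :=
    mul_nonneg (Real.rpow_nonneg (by linarith) _) (rate_pos i hx).le
  rcases scaledDist_cases x θ with e | e
  · exact (e ▸ H x (e ▸ hx)).trans (mul_le_mul_of_nonneg_right (le_max_left _ _) hp)
  · rw [dens1_reflect i x h, abs_mul, abs_reflectSign, one_mul]
    exact (e ▸ H' (-x) (e ▸ hx)).trans (mul_le_mul_of_nonneg_right (le_max_right _ _) hp)

lemma exists_abs_dens2_le_two_sided {θ : Param} (h : θ ∈ openParams) (i j : Fin 4) : ∃ C, 0 ≤ C ∧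
    ∀ x, 1 ≤ scaledDist x θ → |dens2 i j x θ| ≤
      C * (scaledDist x θ ^ (-1 - θ 2) * (rate i (scaledDist x θ) * rate j (scaledDist x θ))) := by
  obtain ⟨C, hC, H⟩ := exists_abs_dens2_le h i j
  obtain ⟨C', hC', H'⟩ := exists_abs_dens2_le (reflect_mem h) i j
  refine ⟨max C C', le_max_of_le_left hC, fun x hx => ?_⟩
  have hp : 0 ≤ scaledDist x θ ^ (-1 - θ 2) * (rate i (scaledDist x θ) * rate j (scaledDist x θ)) :=
    mul_nonneg (Real.rpow_nonneg (by linarith) _) (mul_pos (rate_pos i hx) (rate_pos j hx)).le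
  rcases scaledDist_cases x θ with e | e
  · exact (e ▸ H x (e ▸ hx)).trans (mul_le_mul_of_nonneg_right (le_max_left _ _) hp)
  · rw [dens2_reflect i j x h, abs_mul, abs_mul, abs_reflectSign, abs_reflectSign, one_mul, one_mul]
    exact (e ▸ H' (-x) (e ▸ hx)).trans (mul_le_mul_of_nonneg_right (le_max_right _ _) hp)

lemma exists_le_density_two_sided {θ : Param} (h : θ ∈ openParams) : ∃ c U, 0 < c ∧ 1 ≤ U ∧
    ∀ x, U ≤ scaledDist x θ → c * scaledDist x θ ^ (-1 - θ 2) ≤ density x θ := by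
  obtain ⟨c, U, hc, hU, H⟩ := exists_le_density h
  obtain ⟨c', U', hc', hU', H'⟩ := exists_le_density (reflect_mem h)
  refine ⟨min c c', max U U', lt_min hc hc', hU.trans (le_max_left _ _), fun x hx => ?_⟩
  have h1 := (le_max_left U U').trans hx
  have h2 := (le_max_right U U').trans hx
  have hp : 0 ≤ scaledDist x θ ^ (-1 - θ 2) := Real.rpow_nonneg (by linarith) _
  rcases scaledDist_cases x θ with e | e
  · exact (mul_le_mul_of_nonneg_right (min_le_left _ _) hp).trans (e ▸ H x (e ▸ h1))
  · rw [← density_reflect]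
    exact (mul_le_mul_of_nonneg_right (min_le_right _ _) hp).trans (e ▸ H' (-x) (e ▸ h2))

end StableM0

/-! ### The location parameter: derivatives in x and joint continuity -/

namespace StableM0
open MeasureTheory Filter Topology Set

/-- A family of functions for which the zeroth parameter is a location parameter. -/
def IsLocationFamily (g : ℝ → Param → ℝ) : Prop :=
  ∀ x h θ, g (x + h) θ = g x (Function.update θ 0 (θ 0 - h))

lemma charFn_sub (μ h σ α β t : ℝ) : charFn (μ - h) σ α β t =
    Complex.exp (-(Complex.I * ((t * h : ℝ) : ℂ))) * charFn μ σ α β t := by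
  unfold charFn
  split_ifs <;>
  · rw [← Complex.exp_add]
    congr 1
    push_cast; ring

lemma isLocationFamily_density : IsLocationFamily density := by
  intro x h θ
  rw [density_eq, density_eq]
  congr 4
  ext t
  rw [invKernel, invKernel]
  have e : charFn (Function.update θ 0 (θ 0 - h) 0) (Function.update θ 0 (θ 0 - h) 1)
      (Function.update θ 0 (θ 0 - h) 2) (Function.update θ 0 (θ 0 - h) 3) t =
      charFn (θ 0 - h) (θ 1) (θ 2) (θ 3) t := by simp
  rw [e, charFn_sub, ← mul_assoc, ← Complex.exp_add]
  congr 2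
  push_cast; ring

lemma phase_add (w : ℂ) (x h : ℝ) (θ : Param) :
    phase w (x + h) θ = phase w x (Function.update θ 0 (θ 0 - h)) := by
  have e : x + h - θ 0 = x - (θ 0 - h) := by ring
  simp [phase, e]

lemma phase1_add (i : Fin 4) (w : ℂ) (x h : ℝ) (θ : Param) :
    phase1 i w (x + h) θ = phase1 i w x (Function.update θ 0 (θ 0 - h)) := by
  have e : x + h - θ 0 = x - (θ 0 - h) := by ring
  fin_cases i <;> simp [phase1, e]

lemma phase2_add (i j : Fin 4) (w : ℂ) (x h : ℝ) (θ : Param) :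
    phase2 i j w (x + h) θ = phase2 i j w x (Function.update θ 0 (θ 0 - h)) := by
  have e : x + h - θ 0 = x - (θ 0 - h) := by ring
  fin_cases i <;> fin_cases j <;> simp [phase2, e]

lemma isLocationFamily_dens1 (i : Fin 4) : IsLocationFamily (dens1 i) := fun x h θ => by
  simp only [dens1, kern1, phase_add _ x h, phase1_add _ _ x h]

lemma isLocationFamily_dens2 (i j : Fin 4) : IsLocationFamily (dens2 i j) := fun x h θ => by
  simp only [dens2, kern2, phase_add _ x h, phase1_add _ _ x h, phase2_add _ _ _ x h]

/-- Moving `x` forward is the same as moving `μ` backward, so `∂/∂x = -∂/∂μ`. -/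
lemma IsLocationFamily.hasDerivAt {g : ℝ → Param → ℝ} (hg : IsLocationFamily g) {x : ℝ} {θ : Param}
    {g' : ℝ} (h : HasDerivAt (fun s => g x (Function.update θ 0 s)) g' (θ 0)) :
    HasDerivAt (fun y => g y θ) (-g') x := by
  have e : (fun y => g y θ) = (fun s => g x (Function.update θ 0 s)) ∘ fun y => θ 0 - (y - x) := by
    ext y
    rw [Function.comp_apply, ← hg, add_sub_cancel]
  have d : HasDerivAt (fun y : ℝ => θ 0 - (y - x)) (-1) x :=
    ((hasDerivAt_id x).sub_const x).const_sub (θ 0)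
  rw [e, ← mul_neg_one]
  refine HasDerivAt.comp x ?_ d
  rwa [sub_self, sub_zero]

/-- A shift of `μ` moves every `x` to 0 and stays in the open parameter set, because `μ` is
unconstrained. -/
lemma IsLocationFamily.continuousOn {g : ℝ → Param → ℝ} (hg : IsLocationFamily g)
    (h : ContinuousOn (g 0) openParams) :
    ContinuousOn (fun p : ℝ × Param => g p.1 p.2) (univ ×ˢ openParams) := by
  have e : (fun p : ℝ × Param => g p.1 p.2) =
      (g 0) ∘ fun p : ℝ × Param => Function.update p.2 0 (p.2 0 - p.1) := by
    ext p
    rw [Function.comp_apply, ← hg, zero_add]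
  rw [e]
  refine h.comp (Continuous.continuousOn ?_) fun p hp => ?_
  · exact continuous_snd.update 0 (by fun_prop)
  · simpa [openParams] using hp.2

lemma IsLocationFamily.continuous {g : ℝ → Param → ℝ} (hg : IsLocationFamily g)
    (h : ContinuousOn (g 0) openParams) {θ : Param} (hθ : θ ∈ openParams) :
    Continuous fun x => g x θ := by
  rw [← continuousOn_univ]
  exact (hg.continuousOn h).comp (f := fun x : ℝ => (x, θ)) (by fun_prop) fun x _ => ⟨mem_univ _, hθ⟩

end StableM0

/-! ### Strict positivity by self-convolution -/

namespace StableM0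
open MeasureTheory Filter Topology Set
open scoped ComplexConjugate FourierTransform

lemma norm_invKernel (x : ℝ) (θ : Param) (t : ℝ) :
    ‖invKernel x θ t‖ = ‖charFn (θ 0) (θ 1) (θ 2) (θ 3) t‖ := by
  rw [invKernel, norm_mul, norm_exp_neg_I_mul, one_mul]

lemma integrable_charFn {θ : Param} (h : θ ∈ openParams) :
    Integrable (charFn (θ 0) (θ 1) (θ 2) (θ 3)) := by
  refine (integrable_invKernel h 0).congr (Eventually.of_forall fun t => ?_)
  simp [invKernel]

lemma ofReal_density (x : ℝ) (θ : Param) :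
    ((2 * Real.pi * density x θ : ℝ) : ℂ) = ∫ t, invKernel x θ t := by
  have hπ := Real.pi_pos
  have e : conj (∫ t, invKernel x θ t) = ∫ t, invKernel x θ t := by
    rw [← integral_conj, ← integral_neg_eq_self (invKernel x θ)]
    simp only [invKernel_neg]
  rw [density_eq, mul_inv_cancel_left₀ (by positivity)]
  exact Complex.conj_eq_iff_re.1 e

lemma abs_density_le (x : ℝ) (θ : Param) :
    |density x θ| ≤ (2 * Real.pi)⁻¹ * ∫ t, ‖charFn (θ 0) (θ 1) (θ 2) (θ 3) t‖ := by
  have hπ := Real.pi_pos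
  rw [density_eq, abs_mul, abs_of_pos (by positivity)]
  refine mul_le_mul_of_nonneg_left ?_ (by positivity)
  refine (Complex.abs_re_le_norm _).trans ((norm_integral_le_integral_norm _).trans_eq ?_)
  simp only [norm_invKernel]

lemma fourier_charFn (θ : Param) (w : ℝ) : 𝓕 (charFn (θ 0) (θ 1) (θ 2) (θ 3)) w =
    ((2 * Real.pi * density (2 * Real.pi * w) θ : ℝ) : ℂ) := by
  rw [ofReal_density, Real.fourier_real_eq_integral_exp_smul]
  congr 1
  ext t
  rw [invKernel, smul_eq_mul]
  congr 2
  push_cast; ring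

lemma integrable_density {θ : Param} (h : θ ∈ openParams) : Integrable fun x => density x θ := by
  have hσ := h.1
  have hα := h.2.1.1
  obtain ⟨C, hC, H⟩ := exists_abs_density_le_two_sided h
  set B := (2 * Real.pi)⁻¹ * ∫ t, ‖charFn (θ 0) (θ 1) (θ 2) (θ 3) t‖
  have hB : 0 ≤ B := (abs_nonneg _).trans (abs_density_le 0 θ)
  have hint : Integrable fun x : ℝ => (1 + ‖(x - θ 0) / θ 1‖) ^ (-(1 + θ 2)) :=
    ((integrable_one_add_norm (r := 1 + θ 2) (by simpa using hα)).comp_div hσ.ne').comp_sub_right (θ 0)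
  refine (hint.const_mul ((B + C) * 2 ^ (1 + θ 2))).mono'
    (isLocationFamily_density.continuous (continuousOn_density 0) h).aestronglyMeasurable
    (Eventually.of_forall fun x => ?_)
  have e : ‖(x - θ 0) / θ 1‖ = scaledDist x θ := by
    rw [norm_div, Real.norm_eq_abs, Real.norm_of_nonneg hσ.le, scaledDist]
  rw [e, Real.norm_eq_abs]
  have h0 : 0 ≤ scaledDist x θ := by rw [← e]; exact norm_nonneg _
  -- The factor `2^(1+α)` replaces `1 + d` by `(1 + d)/2`, for the scaled distance `d`. That mean is
  -- at most `d` when `d ≥ 1` and at most 1 when `d ≤ 1`, so one majorant covers tail and centre.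
  have e2 : (B + C) * 2 ^ (1 + θ 2) * (1 + scaledDist x θ) ^ (-(1 + θ 2)) =
      (B + C) * ((1 + scaledDist x θ) / 2) ^ (-(1 + θ 2)) := by
    rw [Real.div_rpow (by positivity) two_pos.le, Real.rpow_neg two_pos.le, div_inv_eq_mul]
    ring
  rw [e2]
  rcases le_total 1 (scaledDist x θ) with h1 | h1
  · have m : scaledDist x θ ^ (-(1 + θ 2)) ≤ ((1 + scaledDist x θ) / 2) ^ (-(1 + θ 2)) :=
      Real.rpow_le_rpow_of_nonpos (by positivity) (by linarith) (by linarith)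
    have := H x h1
    rw [show -1 - θ 2 = -(1 + θ 2) by ring] at this
    have p : 0 ≤ scaledDist x θ ^ (-(1 + θ 2)) := Real.rpow_nonneg h0 _
    refine this.trans (mul_le_mul (by linarith) m p (by linarith))
  · have m : 1 ≤ ((1 + scaledDist x θ) / 2) ^ (-(1 + θ 2)) :=
      Real.one_le_rpow_of_pos_of_le_one_of_nonpos (by positivity) (by linarith) (by linarith)
    have := abs_density_le x θ
    nlinarith

/-- A stable law is the law of the sum of two independent copies of a stable variable. -/
lemma exists_charFn_eq_sq {θ : Param} (h : θ ∈ openParams) : ∃ η ∈ openParams, ∀ t,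
    charFn (θ 0) (θ 1) (θ 2) (θ 3) t =
      charFn (η 0) (η 1) (η 2) (η 3) t * charFn (η 0) (η 1) (η 2) (η 3) t := by
  obtain ⟨hσ, hα, hβ⟩ := h
  -- Chosen so that `q^α = 1/2`: each of the two copies carries half of the `w^α` term.
  set q : ℝ := (1 / 2) ^ (1 / θ 2) with hq
  have hq0 : 0 < q := by positivity
  have hqα : q ^ θ 2 = 1 / 2 := by
    rw [hq, ← Real.rpow_mul (by norm_num), one_div_mul_cancel hα.1.ne', Real.rpow_one]
  -- Rescaling also changes the term linear in `t`, through `log 2` when `α = 1`; `m` records this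
  -- change, and the location of the copies compensates for it.
  obtain ⟨m, hm⟩ : ∃ m : ℝ, ∀ t : ℝ, 0 < t → levyExp (θ 2) (θ 3) ((θ 1 * t : ℝ) : ℂ) =
      2 * levyExp (θ 2) (θ 3) ((q * θ 1 * t : ℝ) : ℂ) + Complex.I * ((m * t : ℝ) : ℂ) := by
    by_cases h1 : θ 2 = 1
    · have hq2 : q = 1 / 2 := by rw [h1, Real.rpow_one] at hqα; exact hqα
      refine ⟨θ 3 * (2 / Real.pi) * θ 1 * Real.log 2, fun t ht => ?_⟩
      have p1 : 0 < θ 1 * t := by positivity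
      have e : Real.log (1 / 2 * θ 1 * t) = Real.log (θ 1 * t) - Real.log 2 := by
        rw [show 1 / 2 * θ 1 * t = θ 1 * t / 2 by ring, Real.log_div p1.ne' two_ne_zero]
      rw [levyExp, levyExp, h1, drift_one, drift_one, logPow, logPow, pow_zero, pow_zero,
        Complex.ofReal_one, Complex.cpow_one, Complex.cpow_one, hq2, ← Complex.ofReal_log p1.le,
        ← Complex.ofReal_log (by positivity), e]
      push_cast; ring
    · refine ⟨θ 3 * Real.tan (Real.pi * θ 2 / 2) * θ 1 * (1 - 2 * q), fun t ht => ?_⟩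
      rw [levyExp, levyExp, drift_of_ne h1 hα.1.ne', drift_of_ne h1 hα.1.ne', logPow, logPow,
        pow_zero, pow_zero, ← Complex.ofReal_cpow (by positivity),
        ← Complex.ofReal_cpow (by positivity), show q * θ 1 * t = q * (θ 1 * t) by ring,
        Real.mul_rpow hq0.le (by positivity), hqα]
      push_cast [-Complex.ofReal_tan]; ring
  refine ⟨![(θ 0 - m) / 2, q * θ 1, θ 2, θ 3], ⟨mul_pos hq0 hσ, hα, hβ⟩, fun t => ?_⟩
  have hpos : ∀ t : ℝ, 0 < t → charFn (θ 0) (θ 1) (θ 2) (θ 3) t =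
      charFn ((θ 0 - m) / 2) (q * θ 1) (θ 2) (θ 3) t *
        charFn ((θ 0 - m) / 2) (q * θ 1) (θ 2) (θ 3) t := fun t ht => by
    rw [charFn_of_pos hσ hα.1 ht, charFn_of_pos (mul_pos hq0 hσ) hα.1 ht, ← Complex.exp_add, hm t ht]
    congr 1
    push_cast; ring
  change _ = charFn ((θ 0 - m) / 2) (q * θ 1) (θ 2) (θ 3) t *
        charFn ((θ 0 - m) / 2) (q * θ 1) (θ 2) (θ 3) t
  rcases lt_trichotomy t 0 with ht | rfl | ht
  · have h := congrArg conj (hpos (-t) (neg_pos.2 ht))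
    rwa [map_mul, ← charFn_neg, ← charFn_neg, neg_neg] at h
  · simp [charFn, hα.1.ne', Real.zero_rpow]
  · exact hpos t ht

lemma continuous_charFn {θ : Param} (h : θ ∈ openParams) :
    Continuous (charFn (θ 0) (θ 1) (θ 2) (θ 3)) := by
  obtain ⟨hσ, hα, hβ⟩ := h
  by_cases h1 : θ 2 = 1
  · have e : charFn (θ 0) (θ 1) (θ 2) (θ 3) = fun t => Complex.exp (-((|θ 1 * t| : ℝ) : ℂ)
        - Complex.I * (((θ 1 * t) * Real.log (θ 1 * t) * (2 * θ 3 / Real.pi) : ℝ) : ℂ)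
        + Complex.I * ((θ 0 * t : ℝ) : ℂ)) := by
      ext t
      rw [charFn, if_pos h1, Real.log_abs]
      congr 4
      push_cast; ring
    rw [e]
    have c : Continuous fun t : ℝ => (θ 1 * t) * Real.log (θ 1 * t) :=
      Real.continuous_mul_log.comp (continuous_const.mul continuous_id)
    fun_prop
  · have c : ∀ b : ℝ, Continuous fun t : ℝ =>
        (-(Complex.I * ((b * t : ℝ) : ℂ))) ^ ((θ 2 : ℝ) : ℂ) := fun b =>
      continuous_iff_continuousAt.2 fun t =>
        ContinuousAt.comp (f := fun t : ℝ => -(Complex.I * ((b * t : ℝ) : ℂ)))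
          (continuousAt_cpow_I_mul hα.1 (b * t)) (by fun_prop)
    rw [funext (charFn_eq_mul hσ hα h1 (θ 0) (θ 3))]
    have c1 := c 1
    have c2 := c (-1)
    fun_prop

/-- One factor `φ v` is replaced by its Fourier inversion integral and Fubini exchanges the order of
integration. -/
lemma fourier_mul_self {φ : ℝ → ℂ} (hc : Continuous φ) (hi : Integrable φ) (hF : Integrable (𝓕 φ))
    (x : ℝ) : 𝓕 (fun v => φ v * φ v) x = ∫ w, 𝓕 φ w * 𝓕 φ (x - w) := by
  have inv : ∀ v, φ v = ∫ w : ℝ, Complex.exp ((2 * Real.pi * (w * v) : ℝ) * Complex.I) * 𝓕 φ w := by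
    intro v
    conv_lhs => rw [← hc.fourierInv_fourier_eq hi hF, Real.fourierInv_eq']
    simp [mul_comm]
  have hprod : Integrable (fun p : ℝ × ℝ => Complex.exp ((-2 * Real.pi * p.1 * x : ℝ) * Complex.I) *
      Complex.exp ((2 * Real.pi * (p.2 * p.1) : ℝ) * Complex.I) * (φ p.1 * 𝓕 φ p.2))
      (volume.prod volume) := by
    refine (hi.mul_prod hF).bdd_mul (c := 1) (by fun_prop) (Eventually.of_forall fun p => ?_)
    rw [norm_mul, Complex.norm_exp_ofReal_mul_I, Complex.norm_exp_ofReal_mul_I, one_mul]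
  calc 𝓕 (fun v => φ v * φ v) x
      = ∫ v : ℝ, ∫ w : ℝ, Complex.exp ((-2 * Real.pi * v * x : ℝ) * Complex.I) *
          Complex.exp ((2 * Real.pi * (w * v) : ℝ) * Complex.I) * (φ v * 𝓕 φ w) := by
        rw [Real.fourier_real_eq_integral_exp_smul]
        congr 1
        ext v
        conv_lhs => rw [smul_eq_mul, inv v, ← inv v, ← mul_assoc]
        nth_rewrite 2 [inv v]
        rw [← integral_const_mul]
        congr 1
        ext w
        ring
    _ = ∫ w : ℝ, ∫ v : ℝ, Complex.exp ((-2 * Real.pi * v * x : ℝ) * Complex.I) *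
          Complex.exp ((2 * Real.pi * (w * v) : ℝ) * Complex.I) * (φ v * 𝓕 φ w) :=
        integral_integral_swap hprod
    _ = ∫ w, 𝓕 φ w * 𝓕 φ (x - w) := by
        congr 1
        ext w
        rw [Real.fourier_real_eq_integral_exp_smul φ (x - w), ← integral_const_mul]
        congr 1
        ext v
        rw [← Complex.exp_add, smul_eq_mul]
        have : ((-2 * Real.pi * v * x : ℝ) : ℂ) * Complex.I + (2 * Real.pi * (w * v) : ℝ) * Complex.I
          = ((-2 * Real.pi * v * (x - w) : ℝ) : ℂ) * Complex.I := by push_cast; ring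
        rw [this]; ring

lemma tendsto_scaledDist {θ : Param} (h : θ ∈ openParams) :
    Tendsto (fun x => scaledDist x θ) (Bornology.cobounded ℝ) atTop :=
  (Metric.tendsto_dist_right_cobounded_atTop (θ 0)).atTop_div_const h.1

lemma eventually_density_pos {θ : Param} (h : θ ∈ openParams) :
    ∀ᶠ x in Bornology.cobounded ℝ, 0 < density x θ := by
  obtain ⟨c, U, hc, hU, H⟩ := exists_le_density_two_sided h
  filter_upwards [(tendsto_scaledDist h).eventually_ge_atTop U] with x hx
  exact (mul_pos hc (Real.rpow_pos_of_pos (by linarith) _)).trans_le (H x hx)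

/-- Stable densities are strictly positive. -/
lemma density_pos {θ : Param} (h : θ ∈ openParams) (x : ℝ) : 0 < density x θ := by
  have hπ := Real.pi_pos
  obtain ⟨η, hη, hsq⟩ := exists_charFn_eq_sq h
  set φ := charFn (η 0) (η 1) (η 2) (η 3)
  set g : ℝ → ℝ := fun w => 2 * Real.pi * density (2 * Real.pi * w) η with hg
  have hgc : Continuous g := continuous_const.mul
    ((isLocationFamily_density.continuous (continuousOn_density 0) hη).comp
      (continuous_const.mul continuous_id))
  have hgi : Integrable g := ((integrable_density hη).comp_mul_left' (by positivity)).const_mul _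
  have hg0 : ∀ w, 0 ≤ g w := fun w => mul_nonneg (by positivity) (density_nonneg hη _)
  have hF : ∀ w, 𝓕 φ w = (g w : ℂ) := fourier_charFn η
  have hFi : Integrable (𝓕 φ) := by rw [funext hF]; exact hgi.ofReal
  set y := (2 * Real.pi)⁻¹ * x with hy
  have hxy : 2 * Real.pi * y = x := mul_inv_cancel_left₀ (by positivity) x
  have hconv : 2 * Real.pi * density x θ = ∫ w, g w * g (y - w) := by
    have a := fourier_charFn θ y
    have b : (fun w => 𝓕 φ w * 𝓕 φ (y - w)) = fun w => ((g w * g (y - w) : ℝ) : ℂ) := by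
      ext w
      rw [hF, hF]
      exact (Complex.ofReal_mul _ _).symm
    rw [hxy, funext hsq, fourier_mul_self (continuous_charFn hη) (integrable_charFn hη) hFi, b,
      integral_complex_ofReal] at a
    exact_mod_cast a.symm
  have hbdd : ∀ w, ‖g w‖ ≤ ∫ t, ‖φ t‖ := fun w => by
    have := mul_le_mul_of_nonneg_left (abs_density_le (2 * Real.pi * w) η)
      (by positivity : 0 ≤ 2 * Real.pi)
    rw [mul_inv_cancel_left₀ (by positivity)] at this
    rwa [Real.norm_eq_abs, abs_mul, abs_of_pos (by positivity : 0 < 2 * Real.pi)]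
  have hgc' : Continuous fun w => g (y - w) := hgc.comp (continuous_const.sub continuous_id)
  have hint : Integrable fun w => g w * g (y - w) :=
    hgi.mul_bdd (c := ∫ t, ‖φ t‖) hgc'.aestronglyMeasurable (Eventually.of_forall fun w => hbdd _)
  have hpos : 0 < ∫ w, g w * g (y - w) := by
    rw [integral_pos_iff_support_of_nonneg (fun w => mul_nonneg (hg0 _) (hg0 _)) hint]
    refine (hgc.mul hgc').isOpen_support.measure_pos volume ?_
    -- The integrand is continuous and nonnegative, so one point of positivity is enough: as `w →
    -- +∞` the two arguments go to opposite ends, where the density of `η` is positive.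
    have e := eventually_density_pos hη
    rw [IsOrderBornology.cobounded_eq] at e
    have e1 := e.filter_mono le_sup_right
    have e2 := e.filter_mono le_sup_left
    have t1 : Tendsto (fun w : ℝ => 2 * Real.pi * w) atTop atTop :=
      tendsto_id.const_mul_atTop (by positivity)
    have t2 : Tendsto (fun w : ℝ => 2 * Real.pi * (y - w)) atTop atBot :=
      (tendsto_atBot_add_const_left _ y tendsto_neg_atTop_atBot).const_mul_atBot (by positivity)
    obtain ⟨w, h1, h2⟩ := ((t1.eventually e1).and (t2.eventually e2)).exists
    exact ⟨w, (mul_pos (mul_pos (by positivity) h1) (mul_pos (by positivity) h2)).ne'⟩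
  rw [← hconv] at hpos
  exact (mul_pos_iff_of_pos_left (by positivity)).1 hpos

end StableM0

/-! ### Derivatives of the log-likelihood and their growth -/

namespace StableM0
open MeasureTheory Filter Topology Set

lemma hasDerivAt_logLik (i : Fin 4) (x : ℝ) {θ : Param} (h : θ ∈ openParams) :
    HasDerivAt (fun s => logLik x (Function.update θ i s)) (dens1 i x θ / density x θ) (θ i) := by
  have := (hasDerivAt_density i x h).log (by
    rw [Function.update_eq_self]; exact (density_pos h x).ne')
  rwa [Function.update_eq_self] at this

lemma densityP_eq (i : Fin 4) (x : ℝ) {θ : Param} (h : θ ∈ openParams) :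
    densityP i x θ = dens1 i x θ :=
  (hasDerivAt_density i x h).deriv

lemma score_eq (i : Fin 4) (x : ℝ) {θ : Param} (h : θ ∈ openParams) :
    score i x θ = dens1 i x θ / density x θ :=
  (hasDerivAt_logLik i x h).deriv

lemma hasDerivAt_densityP (i j : Fin 4) (x : ℝ) {θ : Param} (h : θ ∈ openParams) :
    HasDerivAt (fun s => densityP i x (Function.update θ j s)) (dens2 i j x θ) (θ j) :=
  (hasDerivAt_dens1 i j x h).congr_of_eventuallyEq (by
    filter_upwards [eventually_update_mem isOpen_openParams h j] with s hs using densityP_eq i x hs)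

/-- The quotient formula for the second derivatives of the log-likelihood. -/
noncomputable def hess (i j : Fin 4) (x : ℝ) (θ : Param) : ℝ :=
  (dens2 i j x θ * density x θ - dens1 i x θ * dens1 j x θ) / density x θ ^ 2

lemma hess_symm (i j : Fin 4) (x : ℝ) (θ : Param) : hess i j x θ = hess j i x θ := by
  rw [hess, hess, dens2_symm, mul_comm (dens1 i x θ)]

lemma hasDerivAt_quotient (i j : Fin 4) (x : ℝ) {θ : Param} (h : θ ∈ openParams) :
    HasDerivAt (fun s => dens1 i x (Function.update θ j s) / density x (Function.update θ j s))
      (hess i j x θ) (θ j) := by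
  have := (hasDerivAt_dens1 i j x h).fun_div (hasDerivAt_density j x h) (by
    rw [Function.update_eq_self]; exact (density_pos h x).ne')
  rwa [Function.update_eq_self] at this

lemma hasDerivAt_score (i j : Fin 4) (x : ℝ) {θ : Param} (h : θ ∈ openParams) :
    HasDerivAt (fun s => score i x (Function.update θ j s)) (hess i j x θ) (θ j) :=
  (hasDerivAt_quotient i j x h).congr_of_eventuallyEq (by
    filter_upwards [eventually_update_mem isOpen_openParams h j] with s hs using score_eq i x hs)

lemma score2_eq (i j : Fin 4) (x : ℝ) {θ : Param} (h : θ ∈ openParams) :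
    score2 i j x θ = hess i j x θ :=
  (hasDerivAt_score i j x h).deriv

lemma isLocationFamily_logLik : IsLocationFamily logLik := fun x h θ => by
  rw [logLik, logLik, isLocationFamily_density x h]

lemma isLocationFamily_quotient (i : Fin 4) :
    IsLocationFamily fun x θ => dens1 i x θ / density x θ := fun x h θ => by
  simp only [isLocationFamily_density x h, isLocationFamily_dens1 i x h]

lemma isLocationFamily_hess (i j : Fin 4) : IsLocationFamily (hess i j) := fun x h θ => by
  simp only [hess, isLocationFamily_density x h, isLocationFamily_dens1 _ x h,
    isLocationFamily_dens2 _ _ x h]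

lemma hasDerivAt_score_space (i : Fin 4) (x : ℝ) {θ : Param} (h : θ ∈ openParams) :
    HasDerivAt (fun y => score i y θ) (-hess i 0 x θ) x := by
  have e : (fun y => score i y θ) = fun y => dens1 i y θ / density y θ :=
    funext fun y => score_eq i y h
  rw [e]
  exact (isLocationFamily_quotient i).hasDerivAt (hasDerivAt_quotient i 0 x h)

lemma scoreX_eq (i : Fin 4) (x : ℝ) {θ : Param} (h : θ ∈ openParams) :
    scoreX i x θ = -hess i 0 x θ :=
  (hasDerivAt_score_space i x h).deriv

lemma hasDerivAt_logLik_space (x : ℝ) {θ : Param} (h : θ ∈ openParams) :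
    HasDerivAt (fun y => logLik y θ) (-(dens1 0 x θ / density x θ)) x :=
  isLocationFamily_logLik.hasDerivAt (hasDerivAt_logLik 0 x h)

lemma hasDerivAt_deriv_logLik_space (i : Fin 4) (x : ℝ) {θ : Param} (h : θ ∈ openParams) :
    HasDerivAt (fun s => deriv (fun y => logLik y (Function.update θ i s)) x) (-hess 0 i x θ) (θ i) :=
  (hasDerivAt_quotient 0 i x h).fun_neg.congr_of_eventuallyEq (by
    filter_upwards [eventually_update_mem isOpen_openParams h i] with s hs
    exact (hasDerivAt_logLik_space x hs).deriv)

lemma deriv_density_space (x : ℝ) {θ : Param} (h : θ ∈ openParams) :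
    deriv (fun y => density y θ) x = -dens1 0 x θ :=
  (isLocationFamily_density.hasDerivAt (hasDerivAt_density 0 x h)).deriv

lemma deriv_densityP_space (i : Fin 4) (x : ℝ) {θ : Param} (h : θ ∈ openParams) :
    deriv (fun y => densityP i y θ) x = -dens2 i 0 x θ := by
  have e : (fun y => densityP i y θ) = fun y => dens1 i y θ := funext fun y => densityP_eq i y h
  rw [e]
  exact ((isLocationFamily_dens1 i).hasDerivAt (hasDerivAt_dens1 i 0 x h)).deriv

lemma continuousOn_quotient (i : Fin 4) :
    ContinuousOn (fun p : ℝ × Param => dens1 i p.1 p.2 / density p.1 p.2) (univ ×ˢ openParams) :=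
  (isLocationFamily_quotient i).continuousOn
    ((continuousOn_dens1 i 0).div (continuousOn_density 0) fun _ h => (density_pos h 0).ne')

lemma continuousOn_hess (i j : Fin 4) :
    ContinuousOn (fun p : ℝ × Param => hess i j p.1 p.2) (univ ×ˢ openParams) :=
  (isLocationFamily_hess i j).continuousOn
    ((((continuousOn_dens2 i j 0).mul (continuousOn_density 0)).sub
      ((continuousOn_dens1 i 0).mul (continuousOn_dens1 j 0))).div ((continuousOn_density 0).pow 2)
        fun _ h => (pow_pos (density_pos h 0) 2).ne')

lemma continuousOn_score (i : Fin 4) :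
    ContinuousOn (fun p : ℝ × Param => score i p.1 p.2) (univ ×ˢ openParams) :=
  (continuousOn_quotient i).congr fun p hp => score_eq i p.1 hp.2

lemma continuousOn_scoreX (i : Fin 4) :
    ContinuousOn (fun p : ℝ × Param => scoreX i p.1 p.2) (univ ×ˢ openParams) :=
  (continuousOn_hess i 0).neg.congr fun p hp => scoreX_eq i p.1 hp.2

lemma continuousOn_score2 (i j : Fin 4) :
    ContinuousOn (fun p : ℝ × Param => score2 i j p.1 p.2) (univ ×ˢ openParams) :=
  (continuousOn_hess i j).congr fun p hp => score2_eq i j p.1 hp.2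

lemma continuousOn_of_prod {g : ℝ → Param → ℝ}
    (h : ContinuousOn (fun p : ℝ × Param => g p.1 p.2) (univ ×ˢ openParams)) (x : ℝ) :
    ContinuousOn (g x) openParams :=
  h.comp (f := fun θ : Param => (x, θ)) (by fun_prop) fun _ hθ => ⟨mem_univ _, hθ⟩

/-- The order of growth of the score in the `i`-th parameter. -/
noncomputable def growth (i : Fin 4) (x : ℝ) : ℝ := ![|x|⁻¹, 1, Real.log |x|, 1] i

/-- The location and scale of a fixed `θ` only affect constants, so the scaled distance may be
replaced by `|x|`. -/
lemma rate_isBigO_growth {θ : Param} (h : θ ∈ openParams) (i : Fin 4) :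
    (fun x => rate i (scaledDist x θ)) =O[Bornology.cobounded ℝ] growth i := by
  have hσ := h.1
  have tabs : Tendsto (fun x : ℝ => |x|) (Bornology.cobounded ℝ) atTop := tendsto_norm_cobounded_atTop
  have h0 : (fun x => (scaledDist x θ)⁻¹) =O[Bornology.cobounded ℝ] fun x : ℝ => |x|⁻¹ := by
    refine Asymptotics.IsBigO.of_bound (θ 1 + |θ 0|) ?_
    filter_upwards [(tendsto_scaledDist h).eventually_ge_atTop 1, tabs.eventually_gt_atTop 0]
      with x h1 hx
    rw [norm_inv, norm_inv, Real.norm_eq_abs, Real.norm_eq_abs, abs_abs, abs_of_pos (by linarith),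
      ← div_eq_mul_inv, le_div_iff₀ hx, inv_mul_le_iff₀ (by linarith)]
    have a : |x - θ 0| = scaledDist x θ * θ 1 := by rw [scaledDist]; field_simp
    have b : |x| ≤ |x - θ 0| + |θ 0| := by simpa using abs_add_le (x - θ 0) (θ 0)
    nlinarith [abs_nonneg (θ 0)]
  have h2 : (fun x => Real.log (scaledDist x θ) + 1) =O[Bornology.cobounded ℝ]
      fun x : ℝ => Real.log |x| := by
    set K := Real.log ((1 + |θ 0|) / θ 1)
    -- The left side is at most `log |x| + K + 1`, and `1 + |K| ≤ log |x|` eventually.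
    refine Asymptotics.IsBigO.of_bound 2 ?_
    filter_upwards [(tendsto_scaledDist h).eventually_ge_atTop 1, tabs.eventually_ge_atTop 1,
      (Real.tendsto_log_atTop.comp tabs).eventually_ge_atTop (1 + |K|)] with x h1 hx hl
    have hl' : 1 + |K| ≤ Real.log |x| := hl
    have a : scaledDist x θ ≤ (1 + |θ 0|) / θ 1 * |x| := by
      rw [scaledDist, div_mul_eq_mul_div]
      refine div_le_div_of_nonneg_right ?_ hσ.le
      have := abs_sub x (θ 0)
      nlinarith [abs_nonneg (θ 0)]
    have b := Real.log_le_log (by linarith) a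
    rw [Real.log_mul (by positivity) (by positivity)] at b
    have c := Real.log_nonneg h1
    rw [Real.norm_of_nonneg (by linarith), Real.norm_of_nonneg (by linarith [abs_nonneg K])]
    linarith [le_abs_self K]
  fin_cases i
  · exact h0
  · exact Asymptotics.isBigO_refl _ _
  · exact h2
  · exact Asymptotics.isBigO_refl _ _

/-- Numerator and denominator share the power `u^(-1-α)`; only the rate of the differentiated
parameter survives in the quotient. -/
lemma score_isBigO {θ : Param} (h : θ ∈ openParams) (i : Fin 4) :
    (fun x => score i x θ) =O[Bornology.cobounded ℝ] growth i := by
  obtain ⟨c, U, hc, hU, L⟩ := exists_le_density_two_sided h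
  obtain ⟨C, hC, B⟩ := exists_abs_dens1_le_two_sided h i
  refine (Asymptotics.IsBigO.of_bound (C / c) ?_).trans (rate_isBigO_growth h i)
  filter_upwards [(tendsto_scaledDist h).eventually_ge_atTop U] with x hx
  have h1 := hU.trans hx
  have hp : 0 < scaledDist x θ ^ (-1 - θ 2) := Real.rpow_pos_of_pos (by linarith) _
  have hr := rate_pos i h1
  have hf := density_pos h x
  rw [score_eq i x h, norm_div, Real.norm_of_nonneg hf.le, Real.norm_of_nonneg hr.le,
    Real.norm_eq_abs]
  calc |dens1 i x θ| / density x θ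
      ≤ C * (scaledDist x θ ^ (-1 - θ 2) * rate i (scaledDist x θ)) /
          (c * scaledDist x θ ^ (-1 - θ 2)) :=
        div_le_div₀ (by positivity) (B x h1) (by positivity) (L x hx)
    _ = C / c * rate i (scaledDist x θ) := by field_simp

/-- Here `ℓ_ij = f_ij / f - ℓ_i ℓ_j`, and both terms have the product order. -/
lemma score2_isBigO {θ : Param} (h : θ ∈ openParams) (i j : Fin 4) :
    (fun x => score2 i j x θ) =O[Bornology.cobounded ℝ] fun x => growth i x * growth j x := by
  have key : (fun x => dens2 i j x θ / density x θ) =O[Bornology.cobounded ℝ]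
      fun x => growth i x * growth j x := by
    obtain ⟨c, U, hc, hU, L⟩ := exists_le_density_two_sided h
    obtain ⟨C, hC, B⟩ := exists_abs_dens2_le_two_sided h i j
    refine (Asymptotics.IsBigO.of_bound (C / c) ?_).trans
      ((rate_isBigO_growth h i).mul (rate_isBigO_growth h j))
    filter_upwards [(tendsto_scaledDist h).eventually_ge_atTop U] with x hx
    have h1 := hU.trans hx
    have hp : 0 < scaledDist x θ ^ (-1 - θ 2) := Real.rpow_pos_of_pos (by linarith) _
    have hr := mul_pos (rate_pos i h1) (rate_pos j h1)
    have hf := density_pos h x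
    rw [norm_div, Real.norm_of_nonneg hf.le, Real.norm_of_nonneg hr.le, Real.norm_eq_abs]
    calc |dens2 i j x θ| / density x θ
        ≤ C * (scaledDist x θ ^ (-1 - θ 2) * (rate i (scaledDist x θ) * rate j (scaledDist x θ))) /
            (c * scaledDist x θ ^ (-1 - θ 2)) :=
          div_le_div₀ (by positivity) (B x h1) (by positivity) (L x hx)
      _ = C / c * (rate i (scaledDist x θ) * rate j (scaledDist x θ)) := by field_simp
  refine (key.sub ((score_isBigO h i).mul (score_isBigO h j))).congr_left fun x => ?_
  have hf := (density_pos h x).ne'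
  rw [score2_eq i j x h, score_eq i x h, score_eq j x h, hess]
  field_simp

end StableM0

/-! ### Assembly of the statement -/

theorem proposition2 :
    -- the density is positive and all the derivatives exist, with the usual quotient
    -- formulas and independently of the order of differentiation
    (∀ θ ∈ interior StableM0.paramSpace, ∀ x : ℝ,
      0 < StableM0.density x θ ∧
      DifferentiableAt ℝ (fun y : ℝ => StableM0.logLik y θ) x ∧
      (∀ i : Fin 4,
        StableM0.HasPartial i (StableM0.logLik x) θ ∧
        StableM0.score i x θ = StableM0.densityP i x θ / StableM0.density x θ ∧
        DifferentiableAt ℝ (fun y : ℝ => StableM0.score i y θ) x ∧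
        StableM0.scoreX i x θ =
          (deriv (fun y : ℝ => StableM0.densityP i y θ) x * StableM0.density x θ
            - StableM0.densityP i x θ * deriv (fun y : ℝ => StableM0.density y θ) x)
            / StableM0.density x θ ^ 2 ∧
        StableM0.HasPartial i
          (fun η => deriv (fun y : ℝ => StableM0.logLik y η) x) θ ∧
        StableM0.scoreX i x θ =
          StableM0.pderiv i (fun η => deriv (fun y : ℝ => StableM0.logLik y η) x) θ) ∧
      (∀ i j : Fin 4,
        StableM0.HasPartial j (StableM0.score i x) θ ∧
        StableM0.score2 i j x θ =
          (StableM0.pderiv j (StableM0.densityP i x) θ * StableM0.density x θ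
            - StableM0.densityP i x θ * StableM0.densityP j x θ)
            / StableM0.density x θ ^ 2 ∧
        StableM0.score2 i j x θ = StableM0.score2 j i x θ)) ∧
    -- continuity in the parameter for every fixed `x`
    (∀ x : ℝ,
      (∀ i : Fin 4,
        ContinuousOn (StableM0.score i x) (interior StableM0.paramSpace) ∧
        ContinuousOn (StableM0.scoreX i x) (interior StableM0.paramSpace)) ∧
      (∀ i j : Fin 4,
        ContinuousOn (StableM0.score2 i j x) (interior StableM0.paramSpace))) ∧
    -- joint continuity in `(x, θ)`
    ((∀ i : Fin 4,
        ContinuousOn (fun p : ℝ × StableM0.Param => StableM0.score i p.1 p.2)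
          (Set.univ ×ˢ interior StableM0.paramSpace) ∧
        ContinuousOn (fun p : ℝ × StableM0.Param => StableM0.scoreX i p.1 p.2)
          (Set.univ ×ˢ interior StableM0.paramSpace)) ∧
      (∀ i j : Fin 4,
        ContinuousOn (fun p : ℝ × StableM0.Param => StableM0.score2 i j p.1 p.2)
          (Set.univ ×ˢ interior StableM0.paramSpace))) ∧
    -- tails as `|x| → ∞`; the indices 0, 1, 2, 3 are `μ, σ, α, β`
    (∀ θ ∈ interior StableM0.paramSpace,
      (fun x : ℝ => StableM0.score 0 x θ) =O[Bornology.cobounded ℝ] (fun x : ℝ => |x|⁻¹) ∧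
      (fun x : ℝ => StableM0.score 1 x θ) =O[Bornology.cobounded ℝ] (fun _ : ℝ => (1 : ℝ)) ∧
      (fun x : ℝ => StableM0.score 2 x θ) =O[Bornology.cobounded ℝ]
        (fun x : ℝ => Real.log |x|) ∧
      (fun x : ℝ => StableM0.score 3 x θ) =O[Bornology.cobounded ℝ] (fun _ : ℝ => (1 : ℝ)) ∧
      (∀ (i : Fin 4) (x : ℝ), StableM0.score2 0 i x θ = -StableM0.scoreX i x θ) ∧
      (fun x : ℝ => StableM0.score2 0 0 x θ) =O[Bornology.cobounded ℝ]
        (fun x : ℝ => (|x| ^ 2)⁻¹) ∧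
      (fun x : ℝ => StableM0.score2 0 1 x θ) =O[Bornology.cobounded ℝ]
        (fun x : ℝ => |x|⁻¹) ∧
      (fun x : ℝ => StableM0.score2 0 2 x θ) =O[Bornology.cobounded ℝ]
        (fun x : ℝ => |x|⁻¹ * Real.log |x|) ∧
      (fun x : ℝ => StableM0.score2 0 3 x θ) =O[Bornology.cobounded ℝ]
        (fun x : ℝ => |x|⁻¹) ∧
      (fun x : ℝ => StableM0.score2 1 1 x θ) =O[Bornology.cobounded ℝ]
        (fun _ : ℝ => (1 : ℝ)) ∧
      (fun x : ℝ => StableM0.score2 1 2 x θ) =O[Bornology.cobounded ℝ]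
        (fun x : ℝ => Real.log |x|) ∧
      (fun x : ℝ => StableM0.score2 1 3 x θ) =O[Bornology.cobounded ℝ]
        (fun _ : ℝ => (1 : ℝ)) ∧
      (fun x : ℝ => StableM0.score2 2 2 x θ) =O[Bornology.cobounded ℝ]
        (fun x : ℝ => Real.log |x| ^ 2) ∧
      (fun x : ℝ => StableM0.score2 2 3 x θ) =O[Bornology.cobounded ℝ]
        (fun x : ℝ => Real.log |x|) ∧
      (fun x : ℝ => StableM0.score2 3 3 x θ) =O[Bornology.cobounded ℝ]
        (fun _ : ℝ => (1 : ℝ))) := by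
  rw [StableM0.interior_paramSpace]
  refine ⟨fun θ h x => ⟨StableM0.density_pos h x,
    (StableM0.hasDerivAt_logLik_space x h).differentiableAt, fun i => ⟨?_, ?_, ?_, ?_, ?_, ?_⟩,
    fun i j => ⟨?_, ?_, ?_⟩⟩, fun x => ⟨fun i => ⟨?_, ?_⟩, fun i j => ?_⟩,
    ⟨fun i => ⟨StableM0.continuousOn_score i, StableM0.continuousOn_scoreX i⟩,
      StableM0.continuousOn_score2⟩, fun θ h => ?_⟩
  · exact (StableM0.hasDerivAt_logLik i x h).differentiableAt
  · rw [StableM0.score_eq i x h, StableM0.densityP_eq i x h]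
  · exact (StableM0.hasDerivAt_score_space i x h).differentiableAt
  · rw [StableM0.scoreX_eq i x h, StableM0.densityP_eq i x h, StableM0.deriv_density_space x h,
      StableM0.deriv_densityP_space i x h, StableM0.hess]
    ring
  · exact (StableM0.hasDerivAt_deriv_logLik_space i x h).differentiableAt
  -- Differentiating `∂ℓ/∂x = -ℓ_μ` in `θ_i` gives the Hessian entry with `μ` first, whereas
  -- `ℓ'_{θ_i}` gives it with `μ` last; symmetry identifies the two.
  · rw [StableM0.scoreX_eq i x h, StableM0.hess_symm]
    exact (StableM0.hasDerivAt_deriv_logLik_space i x h).deriv.symm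
  · exact (StableM0.hasDerivAt_score i j x h).differentiableAt
  · rw [StableM0.score2_eq i j x h, StableM0.densityP_eq i x h, StableM0.densityP_eq j x h,
      StableM0.pderiv, (StableM0.hasDerivAt_densityP i j x h).deriv, StableM0.hess]
  · rw [StableM0.score2_eq i j x h, StableM0.score2_eq j i x h, StableM0.hess_symm]
  · exact StableM0.continuousOn_of_prod (StableM0.continuousOn_score i) x
  · exact StableM0.continuousOn_of_prod (StableM0.continuousOn_scoreX i) x
  · exact StableM0.continuousOn_of_prod (StableM0.continuousOn_score2 i j) x
  · have s1 := StableM0.score_isBigO h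
    have s2 := StableM0.score2_isBigO h
    refine ⟨s1 0, s1 1, s1 2, s1 3, fun i x => ?_, (s2 0 0).congr_right fun x => ?_,
      (s2 0 1).congr_right fun x => ?_, s2 0 2, (s2 0 3).congr_right fun x => ?_,
      (s2 1 1).congr_right fun x => ?_, (s2 1 2).congr_right fun x => ?_,
      (s2 1 3).congr_right fun x => ?_, (s2 2 2).congr_right fun x => ?_,
      (s2 2 3).congr_right fun x => ?_, (s2 3 3).congr_right fun x => ?_⟩
    · rw [StableM0.scoreX_eq i x h, StableM0.score2_eq 0 i x h, neg_neg, StableM0.hess_symm]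
    · simp only [StableM0.growth, Matrix.cons_val]; rw [sq, mul_inv]
    all_goals simp [StableM0.growth, sq]
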